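/- All spaces are over $\mathbb{C}$ and all algebras are associative and unital. A Lie superalgebra $\mathfrak g=\mathfrak g_{\bar 0}\oplus\mathfrak g_{\bar 1}$ is called basic classical if it is finite dimensional, admits a nondegenerate even supersymmetric invariant bilinear form, and is either simple with $\mathfrak g_{\bar 1}$ completely reducible as a $\mathfrak g_{\bar 0}$-module, or isomorphic to some $\mathfrak{gl}(m|n)$. Let $\mathfrak g$ be a basic classical Lie superalgebra with a nondegenerate even supersymmetric invariant bilinear form $(\cdot,\cdot)$, let $e\in\mathfrak g_{\bar 0}$ be nilpotent, and put $\chi=(e,\cdot)$ and $\mathfrak g_e=\ker(\operatorname{ad} e)$. Let $h,f\in\mathfrak g_{\bar 0}$ satisfy $[h,e]=2e$, $[h,f]=-2f$, $[e,f]=h$, and put $\mathfrak g(i)=\{x\in\mathfrak g : [h,x]=ix\}$. Let $u_1,\dots,u_{2s}$ be a basis of $\mathfrak g(-1)_{\bar 0}$ with $\chi([u_i,u_j])=i^*\delta_{i+j,2s+1}$, where $i^*=-1$ for $i\le s$ and $i^*=1$ for $i>s$, and let $v_1,\dots,v_r$ be a basis of $\mathfrak g(-1)_{\bar 1}$ with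 $\chi([v_i,v_j])=\delta_{i+j,r+1}$. Let $\mathfrak m$ be the sum of all $\mathfrak g(i)$ with $i\le -2$, of the span of $u_{s+1},\dots,u_{2s}$, and of the span of $v_{\frac r2+1},\dots,v_r$ if $r$ is even, respectively of $v_{\frac{r+3}2},\dots,v_r$ if $r$ is odd. Let $\mathfrak m'=\mathfrak m$ if $r$ is even and $\mathfrak m'=\mathfrak m\oplus\mathbb C v_{\frac{r+1}2}$ if $r$ is odd. Let $I_\chi$ be the left ideal of the universal enveloping superalgebra $U(\mathfrak g)$ generated by all $x-\chi(x)$ with $x\in\mathfrak m$, and let $Q_\chi=U(\mathfrak g)/I_\chi$. The refined finite $W$-superalgebra is the superalgebra $W'_\chi=Q_\chi^{\operatorname{ad}\mathfrak m'}$ of the elements of $Q_\chi$ annihilated by the superadjoint action of $\mathfrak m'$, with the product $(x+I_\chi)(y+I_\chi)=xy+I_\chi$. Then there exists an associative $\mathbb C[t]$-superalgebra $\mathcal H_\chi$ ($t$ being even), free as a $\mathbb C[t]$-module, such that, as complex superalgebras, $$\mathcal H_\chi/(t-\lambda)\mathcal H_\chi\;\cong\;W'_\chi\quad\text{for every }\lambda\in\mathbb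 C\setminus\{0\},\qquad \mathcal H_\chi/t\,\mathcal H_\chi\;\cong\;U(\mathfrak g_e).$$ In other words, $U(\mathfrak g_e)$ is a contraction of $W'_\chi$. -/

import Mathlib

open scoped Polynomial

universe w

noncomputable section

/-- The sign `(-1) ^ (i j)` for parities `i`, `j`. -/
def koszulSign (i j : ZMod 2) : ℂ := (-1) ^ (i.val * j.val)

/-- A complex Lie superalgebra structure on the vector space `g`: a decomposition
`g = part 0 ⊕ part 1`, and an even bilinear bracket which is super skew-symmetric and satisfies
the super Jacobi identity. -/
structure LieSuperalgebra (g : Type w) [AddCommGroup g] [Module ℂ g] where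
  /-- The even part `part 0` and the odd part `part 1`. -/
  part : ZMod 2 → Submodule ℂ g
  isCompl_part : IsCompl (part 0) (part 1)
  /-- The Lie superbracket. -/
  bracket : g →ₗ[ℂ] g →ₗ[ℂ] g
  bracket_mem : ∀ (i j : ZMod 2) (x y : g), x ∈ part i → y ∈ part j →
    bracket x y ∈ part (i + j)
  skew : ∀ (i j : ZMod 2) (x y : g), x ∈ part i → y ∈ part j →
    bracket x y = -(koszulSign i j • bracket y x)
  jacobi : ∀ (i j : ZMod 2) (x y z : g), x ∈ part i → y ∈ part j →
    bracket x (bracket y z) = bracket (bracket x y) z + koszulSign i j • bracket y (bracket x z)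

namespace LieSuperalgebra

variable {g : Type w} [AddCommGroup g] [Module ℂ g] (L : LieSuperalgebra g)

/-- The even component of a vector. -/
def even : g →ₗ[ℂ] g := (L.part 0).projection (L.part 1) L.isCompl_part

/-- The odd component of a vector. -/
def odd : g →ₗ[ℂ] g := (L.part 1).projection (L.part 0) L.isCompl_part.symm

theorem even_mem (x : g) : L.even x ∈ L.part 0 := Submodule.projection_apply_mem _ x

theorem odd_mem (x : g) : L.odd x ∈ L.part 1 := Submodule.projection_apply_mem _ x

theorem even_add_odd (x : g) : L.even x + L.odd x = x :=
  Submodule.projection_add_projection_eq_self L.isCompl_part x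

theorem even_of_even {x : g} (hx : x ∈ L.part 0) : L.even x = x :=
  Submodule.projection_apply_of_mem_left L.isCompl_part hx

theorem odd_of_odd {x : g} (hx : x ∈ L.part 1) : L.odd x = x :=
  Submodule.projection_apply_of_mem_left L.isCompl_part.symm hx

theorem even_of_odd {x : g} (hx : x ∈ L.part 1) : L.even x = 0 :=
  Submodule.projection_apply_of_mem_right L.isCompl_part hx

theorem odd_of_even {x : g} (hx : x ∈ L.part 0) : L.odd x = 0 :=
  Submodule.projection_apply_of_mem_right L.isCompl_part.symm hx

theorem bracket_even_left {x : g} (hx : x ∈ L.part 0) (y : g) :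
    L.even (L.bracket x y) = L.bracket x (L.even y) ∧
      L.odd (L.bracket x y) = L.bracket x (L.odd y) := by
  have h0 : L.bracket x (L.even y) ∈ L.part 0 := by
    simpa using L.bracket_mem 0 0 x _ hx (L.even_mem y)
  have h1 : L.bracket x (L.odd y) ∈ L.part 1 := by
    simpa using L.bracket_mem 0 1 x _ hx (L.odd_mem y)
  have h : L.bracket x y = L.bracket x (L.even y) + L.bracket x (L.odd y) := by
    rw [← map_add, L.even_add_odd]
  rw [h, map_add, map_add, L.even_of_even h0, L.odd_of_even h0, L.even_of_odd h1, L.odd_of_odd h1]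
  simp

/-- A subspace is graded if it contains the homogeneous components of its elements. -/
def IsGradedSubspace (S : Submodule ℂ g) : Prop := ∀ x ∈ S, L.even x ∈ S ∧ L.odd x ∈ S

theorem IsGradedSubspace.sup {S T : Submodule ℂ g} (hS : L.IsGradedSubspace S)
    (hT : L.IsGradedSubspace T) : L.IsGradedSubspace (S ⊔ T) := by
  intro x hx
  obtain ⟨a, ha, b, hb, rfl⟩ := Submodule.mem_sup.1 hx
  rw [map_add, map_add]
  exact ⟨Submodule.add_mem_sup (hS a ha).1 (hT b hb).1,
    Submodule.add_mem_sup (hS a ha).2 (hT b hb).2⟩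

theorem IsGradedSubspace.iSup {κ : Sort*} {S : κ → Submodule ℂ g}
    (hS : ∀ k, L.IsGradedSubspace (S k)) : L.IsGradedSubspace (⨆ k, S k) := by
  intro x hx
  induction hx using Submodule.iSup_induction' with
  | mem k x hx =>
    exact ⟨Submodule.mem_iSup_of_mem k (hS k x hx).1, Submodule.mem_iSup_of_mem k (hS k x hx).2⟩
  | zero => simp
  | add x y _ _ hx hy =>
    rw [map_add, map_add]
    exact ⟨add_mem hx.1 hy.1, add_mem hx.2 hy.2⟩

theorem IsGradedSubspace.of_le (i : ZMod 2) {S : Submodule ℂ g} (hS : S ≤ L.part i) :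
    L.IsGradedSubspace S := by
  intro x hx
  have h := hS hx
  fin_cases i
  · rw [L.even_of_even h, L.odd_of_even h]
    exact ⟨hx, zero_mem S⟩
  · rw [L.even_of_odd h, L.odd_of_odd h]
    exact ⟨zero_mem S, hx⟩

/-! ### Basic classical Lie superalgebras -/

/-- A nondegenerate even supersymmetric invariant bilinear form. -/
structure IsBasicForm (B : LinearMap.BilinForm ℂ g) : Prop where
  even : ∀ x y : g, x ∈ L.part 0 → y ∈ L.part 1 → B x y = 0
  supersymm : ∀ (i j : ZMod 2) (x y : g), x ∈ L.part i → y ∈ L.part j →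
    B x y = koszulSign i j * B y x
  invariant : ∀ x y z : g, B (L.bracket x y) z = B x (L.bracket y z)
  nondegenerate : B.Nondegenerate

/-- Simplicity: not abelian, and without nontrivial graded ideals. -/
structure IsSimple : Prop where
  non_abelian : ∃ x y : g, L.bracket x y ≠ 0
  eq_bot_or_eq_top : ∀ I : Submodule ℂ g, L.IsGradedSubspace I →
    (∀ x : g, ∀ y ∈ I, L.bracket x y ∈ I) → I = ⊥ ∨ I = ⊤

/-- The adjoint action of the even part on the odd part is completely reducible. -/
def OddPartCompletelyReducible : Prop :=
  ∀ S : Submodule ℂ g, S ≤ L.part 1 → (∀ x ∈ L.part 0, ∀ y ∈ S, L.bracket x y ∈ S) →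
    ∃ T : Submodule ℂ g, T ≤ L.part 1 ∧ (∀ x ∈ L.part 0, ∀ y ∈ T, L.bracket x y ∈ T) ∧
      S ⊓ T = ⊥ ∧ S ⊔ T = L.part 1

/-- The `(m|n)`-block matrices of parity `i`: block diagonal ones for `i = 0`, block off-diagonal
ones for `i = 1`. -/
def IsBlockOfParity {m n : ℕ} (i : ZMod 2) (A : Matrix (Fin m ⊕ Fin n) (Fin m ⊕ Fin n) ℂ) : Prop :=
  if i = 0 then A.toBlocks₁₂ = 0 ∧ A.toBlocks₂₁ = 0 else A.toBlocks₁₁ = 0 ∧ A.toBlocks₂₂ = 0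

/-- `L` is isomorphic to some `𝔤𝔩(m|n)`: the space of `(m|n)`-block matrices with the
supercommutator as bracket. -/
def IsGeneralLinear : Prop :=
  ∃ (m n : ℕ) (φ : g ≃ₗ[ℂ] Matrix (Fin m ⊕ Fin n) (Fin m ⊕ Fin n) ℂ),
    (∀ (i : ZMod 2) (x : g), x ∈ L.part i ↔ IsBlockOfParity i (φ x)) ∧
    ∀ (i j : ZMod 2) (x y : g), x ∈ L.part i → y ∈ L.part j →
      φ (L.bracket x y) = φ x * φ y - koszulSign i j • (φ y * φ x)

/-- Basic classical Lie superalgebras: finite dimensional, with a nondegenerate even supersymmetric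
invariant bilinear form, and either classical (simple, with `g₁` completely reducible over `g₀`)
or some `𝔤𝔩(m|n)`. -/
structure IsBasicClassical : Prop where
  finiteDimensional : FiniteDimensional ℂ g
  exists_form : ∃ B : LinearMap.BilinForm ℂ g, L.IsBasicForm B
  classical_or_gl : (L.IsSimple ∧ L.OddPartCompletelyReducible) ∨ L.IsGeneralLinear

/-! ### The centralizer of an even element -/

theorem bracket_mem_centralizer {e : g} (he : e ∈ L.part 0) {x y : g}
    (hx : L.bracket e x = 0) (hy : L.bracket e y = 0) : L.bracket e (L.bracket x y) = 0 := by
  have hx0 : L.bracket e (L.even x) = 0 := by rw [← (L.bracket_even_left he x).1, hx, map_zero]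
  have hx1 : L.bracket e (L.odd x) = 0 := by rw [← (L.bracket_even_left he x).2, hx, map_zero]
  have h0 := L.jacobi 0 0 e _ y he (L.even_mem x)
  have h1 := L.jacobi 0 1 e _ y he (L.odd_mem x)
  rw [hx0, hy] at h0
  rw [hx1, hy] at h1
  rw [← L.even_add_odd x, map_add, LinearMap.add_apply, map_add, h0, h1]
  simp

/-- The centralizer `g_e = ker (ad e)` of an even element `e`, as a Lie superalgebra with the
parity and the bracket of `g`. -/
def centralizer (e : g) (he : e ∈ L.part 0) :
    LieSuperalgebra (LinearMap.ker (L.bracket e)) where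
  part i := (L.part i).comap (LinearMap.ker (L.bracket e)).subtype
  isCompl_part := by
    constructor
    · rw [Submodule.disjoint_def]
      intro x h0 h1
      exact Subtype.ext (Submodule.disjoint_def.1 L.isCompl_part.disjoint _ h0 h1)
    · rw [codisjoint_iff, eq_top_iff]
      rintro ⟨x, hx⟩ -
      have hx' : L.bracket e x = 0 := hx
      have hx0 : L.bracket e (L.even x) = 0 := by
        rw [← (L.bracket_even_left he x).1, hx', map_zero]
      have hx1 : L.bracket e (L.odd x) = 0 := by
        rw [← (L.bracket_even_left he x).2, hx', map_zero]
      refine Submodule.mem_sup.2 ⟨⟨L.even x, hx0⟩, L.even_mem x, ⟨L.odd x, hx1⟩, L.odd_mem x, ?_⟩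
      exact Subtype.ext (L.even_add_odd x)
  bracket := LinearMap.mk₂ ℂ
    (fun x y => ⟨L.bracket x y, L.bracket_mem_centralizer he x.2 y.2⟩)
    (fun x y z => Subtype.ext (by simp)) (fun c x y => Subtype.ext (by simp))
    (fun x y z => Subtype.ext (by simp)) (fun c x y => Subtype.ext (by simp))
  bracket_mem i j x y hx hy := L.bracket_mem i j x y hx hy
  skew i j x y hx hy := Subtype.ext (L.skew i j x y hx hy)
  jacobi i j x y z hx hy := Subtype.ext (L.jacobi i j x y z hx hy)

/-! ### The universal enveloping superalgebra -/

/-- The relations `x y = (-1)^(|x||y|) y x + [x, y]` for homogeneous `x`, `y`. -/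
inductive EnvRel : TensorAlgebra ℂ g → TensorAlgebra ℂ g → Prop
  | supercomm (i j : ZMod 2) (x y : g) (hx : x ∈ L.part i) (hy : y ∈ L.part j) :
      EnvRel (TensorAlgebra.ι ℂ x * TensorAlgebra.ι ℂ y)
        (koszulSign i j • (TensorAlgebra.ι ℂ y * TensorAlgebra.ι ℂ x) +
          TensorAlgebra.ι ℂ (L.bracket x y))

/-- The universal enveloping superalgebra `U(g)`. -/
def Env : Type w := RingQuot L.EnvRel

instance : Ring L.Env := inferInstanceAs (Ring (RingQuot L.EnvRel))

instance : Algebra ℂ L.Env := inferInstanceAs (Algebra ℂ (RingQuot L.EnvRel))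

/-- The quotient map from the tensor algebra to `U(g)`. -/
def envMk : TensorAlgebra ℂ g →ₐ[ℂ] L.Env := RingQuot.mkAlgHom ℂ L.EnvRel

/-- Algebra homomorphisms out of `U(g)` from those out of the tensor algebra. -/
def envLift {A : Type*} [Ring A] [Algebra ℂ A] (F : TensorAlgebra ℂ g →ₐ[ℂ] A)
    (hF : ∀ ⦃a b⦄, L.EnvRel a b → F a = F b) : L.Env →ₐ[ℂ] A :=
  RingQuot.liftAlgHom ℂ ⟨F, hF⟩

theorem envLift_mk {A : Type*} [Ring A] [Algebra ℂ A] (F : TensorAlgebra ℂ g →ₐ[ℂ] A)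
    (hF : ∀ ⦃a b⦄, L.EnvRel a b → F a = F b) (a : TensorAlgebra ℂ g) :
    L.envLift F hF (L.envMk a) = F a :=
  RingQuot.liftAlgHom_mkAlgHom_apply ℂ F hF a

/-- The canonical map `g → U(g)`. -/
def ι : g →ₗ[ℂ] L.Env := L.envMk.toLinearMap ∘ₗ TensorAlgebra.ι ℂ

theorem ι_mul_ι (i j : ZMod 2) {x y : g} (hx : x ∈ L.part i) (hy : y ∈ L.part j) :
    L.ι x * L.ι y = koszulSign i j • (L.ι y * L.ι x) + L.ι (L.bracket x y) := by
  have h : L.envMk _ = L.envMk _ :=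
    RingQuot.mkAlgHom_rel ℂ (EnvRel.supercomm (L := L) i j x y hx hy)
  simpa [ι] using h

/-- The map `x ↦ (-1)^|x| x`. -/
def parityMap : g →ₗ[ℂ] g := L.even - L.odd

theorem koszulSign_zero_one : koszulSign 0 1 = 1 := by
  have h : (0 : ZMod 2).val * (1 : ZMod 2).val = 0 := by decide
  rw [koszulSign, h, pow_zero]

theorem koszulSign_one_one : koszulSign 1 1 = -1 := by
  have h : (1 : ZMod 2).val * (1 : ZMod 2).val = 1 := by decide
  rw [koszulSign, h, pow_one]

theorem parityMap_apply_of_mem (i : ZMod 2) {x : g} (hx : x ∈ L.part i) :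
    L.parityMap x = koszulSign i 1 • x := by
  have hi : ∀ i : ZMod 2, i = 0 ∨ i = 1 := by decide
  rcases hi i with rfl | rfl
  · simp [parityMap, L.even_of_even hx, L.odd_of_even hx, koszulSign_zero_one]
  · simp [parityMap, L.even_of_odd hx, L.odd_of_odd hx, koszulSign_one_one]

theorem koszulSign_add_one (i j : ZMod 2) :
    koszulSign (i + j) 1 = koszulSign i 1 * koszulSign j 1 := by
  have h : ∀ i j : ZMod 2, (i + j).val * (1 : ZMod 2).val =
      i.val * (1 : ZMod 2).val + j.val * (1 : ZMod 2).val ∨ (i = 1 ∧ j = 1) := by decide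
  rcases h i j with h | ⟨rfl, rfl⟩
  · rw [koszulSign, h, pow_add, koszulSign, koszulSign]
  · have h2 : (1 + 1 : ZMod 2) = 0 := by decide
    rw [h2, koszulSign_zero_one, koszulSign_one_one]
    norm_num

/-- The parity automorphism of `U(g)`: it sends a product of homogeneous elements
`x₁ ⋯ x_k` of `g` to `(-1)^(|x₁| + ⋯ + |x_k|) x₁ ⋯ x_k`. -/
def envParity : L.Env →ₐ[ℂ] L.Env :=
  L.envLift (TensorAlgebra.lift ℂ (L.ι ∘ₗ L.parityMap)) <| by
    rintro _ _ ⟨i, j, x, y, hx, hy⟩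
    simp only [map_mul, map_add, map_smul, TensorAlgebra.lift_ι_apply, LinearMap.comp_apply,
      L.parityMap_apply_of_mem i hx, L.parityMap_apply_of_mem j hy,
      L.parityMap_apply_of_mem (i + j) (L.bracket_mem i j x y hx hy), koszulSign_add_one,
      smul_mul_smul_comm, L.ι_mul_ι i j hx hy]
    rw [smul_add, smul_comm, mul_comm (koszulSign j 1)]

theorem envParity_ι (x : g) : L.envParity (L.ι x) = L.ι (L.parityMap x) := by
  change L.envLift _ _ (L.envMk (TensorAlgebra.ι ℂ x)) = _
  rw [envLift_mk, TensorAlgebra.lift_ι_apply, LinearMap.comp_apply]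

/-- The even (`i = 0`) and the odd (`i = 1`) part of `U(g)`: the eigenspaces of the parity
automorphism for the eigenvalues `1` and `-1`. -/
def envPart (i : ZMod 2) : Submodule ℂ L.Env :=
  Module.End.eigenspace L.envParity.toLinearMap (koszulSign i 1)

/-- The superadjoint action of `g` on `U(g)`: `ad x (u) = x u - (-1)^(|x||u|) u x` for homogeneous
`x` and `u`. -/
def adEnv (x : g) (u : L.Env) : L.Env :=
  L.ι x * u - u * L.ι (L.even x) - L.envParity u * L.ι (L.odd x)

/-! ### Refined finite W-superalgebras -/

/-- The subspace `g(k)` of the grading of `g` defined by the element `h`. -/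
def weightSpace (h : g) (k : ℤ) : Submodule ℂ g :=
  Module.End.eigenspace (L.bracket h) (k : ℂ)

/-- The choices in the construction of the W-superalgebras attached to `e` and to `χ = B e`:
an `𝔰𝔩₂`-triple `(e, h, f)` of even elements (`e = 0` is allowed, then `h = f = 0`), and bases
`u₁, …, u_{2s}` of `g(-1)₀` and `v₁, …, v_r` of `g(-1)₁` in which the form
`⟨x, y⟩ = χ([x, y])` is in standard position. Indices are shifted to start at `0`. -/
structure WDatum (B : LinearMap.BilinForm ℂ g) (e : g) where
  h : g
  f : g
  h_mem : h ∈ L.part 0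
  f_mem : f ∈ L.part 0
  bracket_h_e : L.bracket h e = (2 : ℂ) • e
  bracket_h_f : L.bracket h f = (-2 : ℂ) • f
  bracket_e_f : L.bracket e f = h
  s : ℕ
  r : ℕ
  u : Module.Basis (Fin (2 * s)) ℂ ↥(L.weightSpace h (-1) ⊓ L.part 0)
  v : Module.Basis (Fin r) ℂ ↥(L.weightSpace h (-1) ⊓ L.part 1)
  pairing_u : ∀ i j : Fin (2 * s), B e (L.bracket (u i : g) (u j : g)) =
    if (i : ℕ) + (j : ℕ) + 1 = 2 * s then (if (i : ℕ) < s then -1 else 1) else 0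
  pairing_v : ∀ i j : Fin r, B e (L.bracket (v i : g) (v j : g)) =
    if (i : ℕ) + (j : ℕ) + 1 = r then 1 else 0

namespace WDatum

variable {L} {B : LinearMap.BilinForm ℂ g} {e : g} (D : L.WDatum B e)

/-- The subalgebra `𝔪`: the sum of the `g(k)`, `k ≤ -2`, of the span of `u_{s+1}, …, u_{2s}`, and
of the span of `v_{r/2+1}, …, v_r` (`r` even) or `v_{(r+3)/2}, …, v_r` (`r` odd). -/
def m : Submodule ℂ g :=
  (⨆ k : {k : ℤ // k ≤ -2}, L.weightSpace D.h k) ⊔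
    Submodule.span ℂ {x | ∃ i : Fin (2 * D.s), D.s ≤ (i : ℕ) ∧ x = D.u i} ⊔
    Submodule.span ℂ {x | ∃ i : Fin D.r, D.r ≤ 2 * (i : ℕ) ∧ x = D.v i}

/-- The subspace `𝔪'`: equal to `𝔪` for even `r`, and to `𝔪 ⊕ ℂ v_{(r+1)/2}` for odd `r`. -/
def m' : Submodule ℂ g :=
  D.m ⊔ Submodule.span ℂ {x | ∃ i : Fin D.r, 2 * (i : ℕ) + 1 = D.r ∧ x = D.v i}

theorem m_graded : L.IsGradedSubspace D.m := by
  refine IsGradedSubspace.sup L (IsGradedSubspace.sup L (IsGradedSubspace.iSup L ?_) ?_) ?_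
  · intro k x hx
    rw [weightSpace, Module.End.mem_eigenspace_iff] at hx
    refine ⟨?_, ?_⟩ <;> rw [weightSpace, Module.End.mem_eigenspace_iff]
    · rw [← (L.bracket_even_left D.h_mem x).1, hx, map_smul]
    · rw [← (L.bracket_even_left D.h_mem x).2, hx, map_smul]
  · refine IsGradedSubspace.of_le L 0 (Submodule.span_le.2 ?_)
    rintro _ ⟨i, -, rfl⟩
    exact (D.u i).2.2
  · refine IsGradedSubspace.of_le L 1 (Submodule.span_le.2 ?_)
    rintro _ ⟨i, -, rfl⟩
    exact (D.v i).2.2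

theorem m'_graded : L.IsGradedSubspace D.m' := by
  refine IsGradedSubspace.sup L D.m_graded (IsGradedSubspace.of_le L 1 (Submodule.span_le.2 ?_))
  rintro _ ⟨i, -, rfl⟩
  exact (D.v i).2.2

/-- The left ideal `I_χ` of `U(g)` generated by the elements `x - χ(x)`, `x ∈ 𝔪`, so that
`Q_χ = U(g) / I_χ`. -/
def leftIdeal : Ideal L.Env :=
  Ideal.span {w | ∃ x ∈ D.m, w = L.ι x - algebraMap ℂ L.Env (B e x)}

theorem leftIdeal_mul (hB : L.IsBasicForm B) (he : e ∈ L.part 0) {w n : L.Env}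
    (hw : w ∈ D.leftIdeal) (hn : ∀ x ∈ D.m', L.adEnv x n ∈ D.leftIdeal) :
    w * n ∈ D.leftIdeal := by
  induction hw using Submodule.span_induction with
  | mem w hw =>
    obtain ⟨x, hx, rfl⟩ := hw
    have hx0 := (D.m_graded x hx).1
    have hx1 := (D.m_graded x hx).2
    have hgen : ∀ y ∈ D.m, L.ι y - algebraMap ℂ L.Env (B e y) ∈ D.leftIdeal := fun y hy =>
      Ideal.subset_span ⟨y, hy, rfl⟩
    have hodd : B e (L.odd x) = 0 := hB.even _ _ he (L.odd_mem x)
    have hsplit : B e x = B e (L.even x) := by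
      conv_lhs => rw [← L.even_add_odd x, map_add, hodd, add_zero]
    have key : (L.ι x - algebraMap ℂ L.Env (B e x)) * n = L.adEnv x n +
        (n * (L.ι (L.even x) - algebraMap ℂ L.Env (B e (L.even x))) +
          L.envParity n * (L.ι (L.odd x) - algebraMap ℂ L.Env (B e (L.odd x)))) := by
      rw [hodd, hsplit, adEnv, sub_mul, mul_sub, Algebra.commutes (B e (L.even x)) n]
      simp only [map_zero, sub_zero]
      abel
    rw [key]
    exact add_mem (hn x (Submodule.mem_sup_left hx)) (add_mem
      (Ideal.mul_mem_left _ _ (hgen _ hx0)) (Ideal.mul_mem_left _ _ (hgen _ hx1)))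
  | zero => simp
  | add a b _ _ ha hb => rw [add_mul]; exact add_mem ha hb
  | smul a b _ hb => rw [smul_eq_mul, mul_assoc]; exact Ideal.mul_mem_left _ _ hb

/-- The preimage in `U(g)` of the space `Q_χ^{ad 𝔪'}` of invariants of `𝔪'` in
`Q_χ = U(g) / I_χ`. -/
def invariants (hB : L.IsBasicForm B) (he : e ∈ L.part 0) : Subalgebra ℂ L.Env where
  carrier := {n | ∀ x ∈ D.m', L.adEnv x n ∈ D.leftIdeal}
  mul_mem' := by
    intro a b ha hb x hx
    have h0 := (D.m'_graded x hx).1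
    have h1 := (D.m'_graded x hx).2
    have key : L.adEnv x (a * b) = L.adEnv x a * b + (a * L.adEnv (L.even x) b +
        L.envParity a * L.adEnv (L.odd x) b) := by
      simp only [adEnv, L.even_of_even (L.even_mem x), L.odd_of_even (L.even_mem x),
        L.even_of_odd (L.odd_mem x), L.odd_of_odd (L.odd_mem x), map_mul, map_zero, mul_zero, sub_zero, sub_mul, mul_sub,
        mul_assoc]
      abel
    rw [key]
    exact add_mem (D.leftIdeal_mul hB he (ha x hx) hb) (add_mem
      (Ideal.mul_mem_left _ _ (hb _ h0)) (Ideal.mul_mem_left _ _ (hb _ h1)))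
  add_mem' := by
    intro a b ha hb x hx
    have key : L.adEnv x (a + b) = L.adEnv x a + L.adEnv x b := by
      simp only [adEnv, map_add, mul_add, add_mul]
      abel
    rw [key]
    exact add_mem (ha x hx) (hb x hx)
  algebraMap_mem' := by
    intro c x _
    have key : L.adEnv x (algebraMap ℂ L.Env c) = 0 := by
      have h : L.ι x = L.ι (L.even x) + L.ι (L.odd x) := by rw [← map_add, L.even_add_odd]
      rw [adEnv, AlgHom.commutes, h, ← Algebra.commutes c, Algebra.commutes c (L.ι (L.odd x)),
        mul_add]
      rw [Algebra.commutes c (L.ι (L.even x)), Algebra.commutes c (L.ι (L.odd x))]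
      abel
    rw [key]
    exact zero_mem _

/-- The elements of `I_χ` in the preimage of `Q_χ^{ad 𝔪'}`. -/
def invariantsIdeal (hB : L.IsBasicForm B) (he : e ∈ L.part 0) : Ideal (D.invariants hB he) :=
  D.leftIdeal.comap (D.invariants hB he).val

instance (hB : L.IsBasicForm B) (he : e ∈ L.part 0) : (D.invariantsIdeal hB he).IsTwoSided :=
  ⟨fun b ha => D.leftIdeal_mul hB he ha b.2⟩

/-- The refined W-superalgebra `W'_χ = Q_χ^{ad 𝔪'}`, with the product
`(x + I_χ) (y + I_χ) = x y + I_χ`. -/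
abbrev RefinedW (hB : L.IsBasicForm B) (he : e ∈ L.part 0) : Type w :=
  D.invariants hB he ⧸ D.invariantsIdeal hB he

/-- The elements of `W'_χ` represented by elements of `U(g)` of parity `i`. -/
def refinedWPart (hB : L.IsBasicForm B) (he : e ∈ L.part 0) (i : ZMod 2) :
    Submodule ℂ (D.RefinedW hB he) :=
  ((L.envPart i).comap (D.invariants hB he).val.toLinearMap).map
    (Ideal.Quotient.mkₐ ℂ (D.invariantsIdeal hB he)).toLinearMap

end WDatum

end LieSuperalgebra

/-! ### Specialization of algebras over `ℂ[t]` -/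

section SpecializationAt

variable (H : Type w) [Ring H] [Algebra ℂ[X] H] (c : ℂ)

/-- The two-sided ideal `(t - c) H`. -/
def specializationIdeal : Ideal H := Ideal.span {algebraMap ℂ[X] H (Polynomial.X - Polynomial.C c)}

instance : (specializationIdeal H c).IsTwoSided := ⟨by
  intro a b ha
  obtain ⟨d, rfl⟩ := Ideal.mem_span_singleton'.1 ha
  refine Ideal.mem_span_singleton'.2 ⟨d * b, ?_⟩
  rw [mul_assoc, mul_assoc, Algebra.commutes]⟩

/-- The specialization `H / (t - c) H`. -/
def SpecializationAt : Type w := H ⧸ specializationIdeal H c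

instance : Ring (SpecializationAt H c) := inferInstanceAs (Ring (H ⧸ specializationIdeal H c))

/-- The quotient map `H → H / (t - c) H`. -/
def SpecializationAt.mk : H →+* SpecializationAt H c := Ideal.Quotient.mk (specializationIdeal H c)

instance : Algebra ℂ (SpecializationAt H c) :=
  RingHom.toAlgebra' ((SpecializationAt.mk H c).comp ((algebraMap ℂ[X] H).comp Polynomial.C)) (by
    intro z x
    obtain ⟨y, rfl⟩ := Ideal.Quotient.mk_surjective x
    change SpecializationAt.mk H c _ * SpecializationAt.mk H c y =
      SpecializationAt.mk H c y * SpecializationAt.mk H c _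
    rw [← map_mul, ← map_mul, RingHom.comp_apply, Algebra.commutes])

variable {H}

/-- The image in `H / (t - c) H` of the part of parity `i` of `H`. -/
def specializationPart (𝒜 : ZMod 2 → Submodule ℂ[X] H) (i : ZMod 2) :
    Submodule ℂ (SpecializationAt H c) :=
  Submodule.span ℂ (SpecializationAt.mk H c '' (𝒜 i : Set H))

end SpecializationAt

/-- Isomorphism of complex superalgebras: a `ℂ`-algebra isomorphism that matches the even parts
and the odd parts. -/
def SuperalgebraIso {A B : Type*} [Ring A] [Algebra ℂ A] [Ring B] [Algebra ℂ B]
    (𝒜 : ZMod 2 → Submodule ℂ A) (ℬ : ZMod 2 → Submodule ℂ B) : Prop :=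
  ∃ φ : A ≃ₐ[ℂ] B, ∀ i : ZMod 2, (𝒜 i).map φ.toLinearMap = ℬ i

end

noncomputable section

/-! Count a vector of `g(k)` with Kazhdan degree `k + 2`. By `𝔰𝔩₂`-theory and nondegeneracy of the
form, `𝔪` has a homogeneous complement with a basis `c_j` made of a basis of `g_e` and of vectors
dual, for `χ([·, ·])`, to a basis `x_i` of `𝔪'` (`exists_frame`). By PBW the sorted words in the
`c_j` are a basis of `Q_χ` (`linearIndependent_wd`). Order words by degree and, in equal degree, let
longer words be smaller. On leading terms `ad x_i` is then differentiation with respect to the dual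
letter (`adEnv_wd`). As with Taylor coefficients, an invariant is determined by its values at words
in `g_e`, and these values can be prescribed (`IsDualFamily.mem_leftIdeal_of_invariant`,
`IsDualFamily.exists_invariant`). So each `c_j` in `g_e` lifts to an invariant `ν_j`, equal to `c_j`
up to words of smaller degree and words of equal degree and length at least two, and the sorted
products of the `ν_j` are a basis of `W'_χ`.

The supercommutator of `ν_i` and `ν_j` is the lift of the bracket in `g_e`, plus terms of degree
below `d_i + d_j - 2`, or of exactly this degree and of length at least two. Now filter by weight,
that is degree minus twice the length, so that `g_e(k)` has weight `k`. All extra terms have weight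
below that of the bracket, with one possible exception: a constant, when both letters have weight
`0`. It is excluded by an explicit choice of generators in weight `0`: `x - ½ ∑ [x, y_i] z_i`, with
dual bases of `g(-1)`, is invariant and is compatible with brackets exactly modulo `I_χ`
(`DualBases.osc_mem_invariants`, `DualBases.osc_bracket`). Hence the top-weight relations of `W'_χ`
are those of `U(g_e)` (`Generators.exists_commutator`).

The contraction is the Rees algebra of the weight filtration, realized inside the functions `ℂ →
W'_χ` and generated over `ℂ[t]` by `c ↦ c ^ wt_j • ν_j`. Sorted words are a `ℂ[t]`-basis. Evaluation
at `c ≠ 0` identifies that fibre with `W'_χ`; at `0` the terms of smaller weight disappear, and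
`U(g_e)` maps onto the fibre, a spanning set of sorted words going to a basis
(`evalSpecialization_bijective`, `superalgebraIso_zero`).

PBW for `U(g)` itself comes from a faithful representation: contracting the coproduct into `End ⊗
U(g)` with coordinate functionals deletes one letter at a time, which yields functionals triangular
on sorted words (`exists_word_functional`). -/

theorem koszulSign_comm (i j : ZMod 2) : koszulSign i j = koszulSign j i := by
  rw [koszulSign, koszulSign, mul_comm]

theorem koszulSign_mul_self (i j : ZMod 2) : koszulSign i j * koszulSign i j = 1 := by
  rw [koszulSign, ← mul_pow]; norm_num

theorem koszulSign_zero_left (j : ZMod 2) : koszulSign 0 j = 1 := by simp [koszulSign]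

theorem koszulSign_zero_right (j : ZMod 2) : koszulSign j 0 = 1 := by simp [koszulSign]

theorem koszulSign_one_one' : koszulSign 1 1 = -1 := LieSuperalgebra.koszulSign_one_one

theorem parity_cases (i : ZMod 2) : i = 0 ∨ i = 1 := by revert i; decide

theorem koszulSign_add_left (i j k : ZMod 2) :
    koszulSign (i + j) k = koszulSign i k * koszulSign j k := by
  rcases parity_cases k with rfl | rfl
  · simp [koszulSign_zero_right]
  · exact LieSuperalgebra.koszulSign_add_one i j

theorem koszulSign_add_right (i j k : ZMod 2) :
    koszulSign i (j + k) = koszulSign i j * koszulSign i k := by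
  rw [koszulSign_comm, koszulSign_add_left, koszulSign_comm j, koszulSign_comm k]

theorem koszulSign_one_eq_of_ne {i j : ZMod 2} (h : koszulSign i 1 = koszulSign j 1) : i = j := by
  rcases parity_cases i with rfl | rfl <;> rcases parity_cases j with rfl | rfl <;>
    simp_all [koszulSign_zero_left, koszulSign_one_one'] <;> norm_num at h

/-! ### Super-permanents of words, and straightening to sorted words. -/

section Words

variable {J : Type*} [LinearOrder J] (p : J → ZMod 2)

/-- The sum of the values of `f` on the lists obtained from a list by deleting one entry `i`,
with the sign for moving this entry to the front. -/
def deleteSum {A : Type*} [AddCommGroup A] [Module ℂ A] (i : J) : (List J → A) → List J → A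
  | _, [] => 0
  | f, j :: l => (if i = j then f l else 0) +
      koszulSign (p i) (p j) • deleteSum i (fun l' => f (j :: l')) l

/-- The super-permanent of the Kronecker deltas of the entries of two lists. -/
def listPairing : List J → List J → ℂ
  | [], l => if l = [] then 1 else 0
  | i :: I, l => deleteSum p i (listPairing I) l

section

variable {A A' : Type*} [AddCommGroup A] [Module ℂ A] [AddCommGroup A'] [Module ℂ A']

/-- Only lists which become a rearrangement of `l` on adding `i` are ever evaluated. This is how
length and degree bounds reach the shorter list in inductions. -/
theorem deleteSum_congr (i : J) {f f' : List J → A} (l : List J)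
    (h : ∀ l', (i :: l').Perm l → f l' = f' l') : deleteSum p i f l = deleteSum p i f' l := by
  induction l generalizing f f' with
  | nil => rfl
  | cons j l ih =>
    simp only [deleteSum]
    rw [ih (f := fun l' => f (j :: l')) (f' := fun l' => f' (j :: l')) fun l' hl' =>
      h _ ((List.Perm.swap _ _ _).trans (hl'.cons j))]
    split_ifs with hij
    · subst hij; rw [h l (List.Perm.refl _)]
    · rfl

theorem deleteSum_zero (i : J) (l : List J) : deleteSum p i (fun _ => (0 : A)) l = 0 := by
  induction l with
  | nil => rfl
  | cons j l ih => simp [deleteSum, ih]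

theorem deleteSum_map (T : A →ₗ[ℂ] A') (i : J) (f : List J → A) (l : List J) :
    T (deleteSum p i f l) = deleteSum p i (fun l' => T (f l')) l := by
  induction l generalizing f with
  | nil => simp [deleteSum]
  | cons j l ih => simp only [deleteSum, map_add, map_smul, ih, apply_ite T, map_zero]

theorem deleteSum_mem (S : Submodule ℂ A) (i : J) (f : List J → A) (l : List J)
    (h : ∀ l', (i :: l').Perm l → f l' ∈ S) : deleteSum p i f l ∈ S := by
  induction l generalizing f with
  | nil => exact S.zero_mem
  | cons j l ih =>
    refine S.add_mem ?_ (S.smul_mem _ (ih _ fun l' hl' =>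
      h _ ((List.Perm.swap _ _ _).trans (hl'.cons j))))
    split_ifs with hij
    · subst hij; exact h l (List.Perm.refl _)
    · exact S.zero_mem

/-- If the deleted letter is one of the two being exchanged, the sign for moving it past the other
one is the sign of the exchange. Otherwise both letters survive and the hypothesis on `f` supplies
the sign. -/
theorem deleteSum_swap (k : J) (f : List J → A) (l₁ : List J) (i j : J) (l₂ : List J)
    (h : ∀ l₁ l₂ : List J, f (l₁ ++ i :: j :: l₂) =
      koszulSign (p i) (p j) • f (l₁ ++ j :: i :: l₂)) :
    deleteSum p k f (l₁ ++ i :: j :: l₂) =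
      koszulSign (p i) (p j) • deleteSum p k f (l₁ ++ j :: i :: l₂) := by
  induction l₁ generalizing f with
  | nil =>
    have h2 : (fun l' => f (i :: j :: l')) = fun l' => koszulSign (p i) (p j) • f (j :: i :: l') :=
      funext fun l' => h [] l'
    have h3 : deleteSum p k (fun l' => f (i :: j :: l')) l₂ =
        koszulSign (p i) (p j) • deleteSum p k (fun l' => f (j :: i :: l')) l₂ := by
      rw [h2]
      exact (deleteSum_map p (koszulSign (p i) (p j) • LinearMap.id) k
        (fun l' => f (j :: i :: l')) l₂).symm
    simp only [List.nil_append, deleteSum, h3, smul_add, smul_smul]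
    have e1 : koszulSign (p k) (p i) • (if k = j then f (i :: l₂) else 0) =
        koszulSign (p i) (p j) • (if k = j then f (i :: l₂) else 0) := by
      split_ifs with hk
      · rw [hk, koszulSign_comm]
      · simp
    have e2 : (koszulSign (p i) (p j) * koszulSign (p k) (p j)) •
        (if k = i then f (j :: l₂) else 0) = (if k = i then f (j :: l₂) else 0) := by
      split_ifs with hk
      · rw [hk, koszulSign_mul_self, one_smul]
      · simp
    rw [e1, e2, add_left_comm]
    congr 2
    · congr 1; ring
  | cons a l₁ ih =>
    simp only [List.cons_append, deleteSum]
    rw [ih (fun l' => f (a :: l')) fun l l' => h (a :: l) l', h l₁ l₂, smul_add,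
      smul_comm (koszulSign (p k) (p a))]
    split_ifs <;> simp

end

theorem listPairing_eq_zero {I l : List J} (h : ¬ I.Perm l) : listPairing p I l = 0 := by
  induction I generalizing l with
  | nil =>
    rw [listPairing, if_neg]
    rintro rfl
    exact h (List.Perm.refl _)
  | cons i I ih =>
    rw [listPairing, deleteSum_congr p i (f' := fun _ => 0) l, deleteSum_zero]
    intro l' hl'
    exact ih fun hp => h ((hp.cons i).trans hl')

/-- In its second argument the pairing obeys exactly the rule that words obey up to lower terms.
Functionals known on sorted words can therefore be computed on all words. -/
theorem listPairing_swap (I l₁ : List J) (i j : J) (l₂ : List J) :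
    listPairing p I (l₁ ++ i :: j :: l₂) =
      koszulSign (p i) (p j) * listPairing p I (l₁ ++ j :: i :: l₂) := by
  induction I generalizing l₁ l₂ with
  | nil => simp [listPairing]
  | cons k I ih => exact deleteSum_swap p k (listPairing p I) l₁ i j l₂ fun l l' => ih l l'

/-- Weakly increasing lists in which odd entries do not repeat. -/
def IsSortedWord (l : List J) : Prop := l.Pairwise fun i j => i < j ∨ i = j ∧ p i = 0

variable {p}

theorem isSortedWord_cons {i : J} {l : List J} :
    IsSortedWord p (i :: l) ↔ (∀ j ∈ l, i < j ∨ i = j ∧ p i = 0) ∧ IsSortedWord p l :=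
  List.pairwise_cons

theorem IsSortedWord.tail {i : J} {l : List J} (h : IsSortedWord p (i :: l)) :
    IsSortedWord p l := (List.pairwise_cons.1 h).2

theorem IsSortedWord.pairwise_le {l : List J} (h : IsSortedWord p l) :
    l.Pairwise (· ≤ ·) := h.imp fun h => h.elim le_of_lt fun h => h.1.le

theorem IsSortedWord.eq_of_perm {l l' : List J} (h : IsSortedWord p l) (h' : IsSortedWord p l')
    (hp : l.Perm l') : l = l' :=
  hp.eq_of_pairwise' h.pairwise_le h'.pairwise_le

theorem listPairing_eq_zero_of_ne {I l : List J} (h : IsSortedWord p I) (h' : IsSortedWord p l)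
    (hne : I ≠ l) : listPairing p I l = 0 :=
  listPairing_eq_zero p fun hp => hne (h.eq_of_perm h' hp)

/-- Sortedness puts all copies of `i` at the front, so deleting any one of them leaves the same
list, and no sign occurs because `i` is even. -/
theorem deleteSum_of_even {i : J} (hi : p i = 0) (f : List J → ℂ) {l : List J}
    (hl : IsSortedWord p (i :: l)) :
    deleteSum p i f (i :: l) = ((l.count i : ℂ) + 1) * f l := by
  induction l generalizing f with
  | nil => simp [deleteSum]
  | cons j l ih =>
    have hs : IsSortedWord p (i :: l) :=
      hl.sublist ((List.sublist_cons_self j l).cons_cons i)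
    by_cases hij : i = j
    · subst hij
      rw [deleteSum, ih (fun l' => f (i :: l')) hs]
      simp [hi, koszulSign_zero_left]
      ring
    · have hni : i ∉ l := by
        intro hmem
        have h1 : i ≤ j := (List.pairwise_cons.1 hl.pairwise_le).1 j (by simp)
        have h2 : j ≤ i := (List.pairwise_cons.1 hl.tail.pairwise_le).1 i hmem
        exact hij (le_antisymm h1 h2)
      have h0 : ∀ f' : List J → ℂ, deleteSum p i f' (j :: l) = 0 := by
        intro f'
        rw [deleteSum_congr p i (f' := fun _ => 0), deleteSum_zero]
        intro l' hl'
        have := hl'.subset (List.mem_cons_self)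
        simp [hij, hni] at this
      rw [deleteSum, h0, List.count_cons_of_ne (Ne.symm hij), List.count_eq_zero_of_not_mem hni]
      simp

/-- The value is the product of the factorials of the multiplicities of the even letters; odd
letters occur once and contribute `1`. -/
theorem listPairing_self_ne_zero {l : List J} (h : IsSortedWord p l) :
    listPairing p l l ≠ 0 := by
  induction l with
  | nil => simp [listPairing]
  | cons i l ih =>
    rcases parity_cases (p i) with hi | hi
    · rw [listPairing, deleteSum_of_even hi _ h]
      exact mul_ne_zero (Nat.cast_add_one_ne_zero _) (ih h.tail)
    · have hni : i ∉ l := fun hmem => by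
        rcases (List.pairwise_cons.1 h).1 i hmem with h | h
        · exact lt_irrefl _ h
        · simp [hi] at h
      rw [listPairing, deleteSum, deleteSum_congr p i (f' := fun _ => 0) l, deleteSum_zero]
      · simpa using ih h.tail
      · intro l' hl'
        exact absurd (hl'.subset List.mem_cons_self) hni

/-- Straightening: if the words satisfy the supercommutation rule up to words of smaller degree,
then they lie in a subspace as soon as the sorted ones do. -/
theorem straightening {M : Type*} [AddCommGroup M] [Module ℂ M] (W : List J → M)
    (K : Submodule ℂ M) (d : J → ℕ) (P : List J → Prop)
    (hP : ∀ l l', l.Perm l' → P l → P l')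
    (hsort : ∀ l, P l → IsSortedWord p l → W l ∈ K)
    (hcomm : ∀ l₁ i j l₂, P (l₁ ++ i :: j :: l₂) →
      (∀ k, P k → (k.map d).sum < ((l₁ ++ i :: j :: l₂).map d).sum → W k ∈ K) →
      W (l₁ ++ i :: j :: l₂) - koszulSign (p i) (p j) • W (l₁ ++ j :: i :: l₂) ∈ K)
    (l : List J) (hl : P l) : W l ∈ K := by
  induction hn : (l.map d).sum using Nat.strong_induction_on generalizing l with
  | _ n ih =>
  subst hn
  have hsw : ∀ l₁ i j l₂, (l₁ ++ i :: j :: l₂).Perm l →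
      W (l₁ ++ i :: j :: l₂) - koszulSign (p i) (p j) • W (l₁ ++ j :: i :: l₂) ∈ K := by
    intro l₁ i j l₂ hp
    refine hcomm l₁ i j l₂ (hP _ _ hp.symm hl) fun k hk hlt => ih _ ?_ k hk rfl
    rwa [(hp.map d).sum_eq] at hlt
  -- A permutation is a chain of adjacent exchanges, each of which costs a scalar modulo `K`; the
  -- prefix `pre` lets the induction on permutations act in the tail.
  have key : ∀ k k' : List J, k.Perm k' → ∀ pre, (pre ++ k).Perm l →
      ∃ ε : ℂ, W (pre ++ k) - ε • W (pre ++ k') ∈ K := by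
    intro k k' hk
    induction hk with
    | nil => exact fun pre _ => ⟨1, by simp⟩
    | cons a _ ih =>
      intro pre hpre
      obtain ⟨ε, hε⟩ := ih (pre ++ [a]) (by simpa using hpre)
      exact ⟨ε, by simpa using hε⟩
    | swap a b t => exact fun pre hpre => ⟨_, hsw pre b a t hpre⟩
    | trans h1 _ ih1 ih2 =>
      intro pre hpre
      obtain ⟨ε, hε⟩ := ih1 pre hpre
      obtain ⟨ε', hε'⟩ := ih2 pre ((h1.symm.append_left pre).trans hpre)
      refine ⟨ε * ε', ?_⟩
      have := K.add_mem hε (K.smul_mem ε hε')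
      rwa [smul_sub, sub_add_sub_cancel, smul_smul] at this
  obtain ⟨ε, hε⟩ := key l (l.mergeSort (· ≤ ·)) (List.mergeSort_perm _ _).symm []
    (List.Perm.refl _)
  have hperm : (l.mergeSort (· ≤ ·)).Perm l := List.mergeSort_perm _ _
  have hle : (l.mergeSort (· ≤ ·)).Pairwise (· ≤ ·) := List.pairwise_mergeSort' (· ≤ ·) l
  generalize l.mergeSort (· ≤ ·) = l' at hε hperm hle
  suffices h : W l' ∈ K by
    have := K.add_mem hε (K.smul_mem ε h)
    simpa using this
  by_cases hs : IsSortedWord p l'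
  · exact hsort l' (hP _ _ hperm.symm hl) hs
  · have hex : ∃ l₁ i l₂, l' = l₁ ++ i :: i :: l₂ ∧ p i = 1 := by
      clear hε hperm
      induction l' with
      | nil => exact absurd List.Pairwise.nil hs
      | cons a t iht =>
        by_cases ht : IsSortedWord p t
        · cases t with
          | nil => exact absurd (List.pairwise_singleton _ _) hs
          | cons b t =>
            have hab : a ≤ b := (List.pairwise_cons.1 hle).1 b (by simp)
            rcases hab.lt_or_eq with hab | hab
            · refine absurd (isSortedWord_cons.2 ⟨fun x hx => Or.inl ?_, ht⟩) hs
              rcases List.mem_cons.1 hx with rfl | hx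
              · exact hab
              · exact hab.trans_le ((List.pairwise_cons.1 (List.pairwise_cons.1 hle).2).1 x hx)
            · subst hab
              rcases parity_cases (p a) with hp | hp
              · refine absurd (isSortedWord_cons.2 ⟨fun x hx => ?_, ht⟩) hs
                rcases List.mem_cons.1 hx with rfl | hx
                · exact Or.inr ⟨rfl, hp⟩
                · exact (List.pairwise_cons.1 ht).1 x hx
              · exact ⟨[], a, t, rfl, hp⟩
        · obtain ⟨l₁, i, l₂, rfl, hi⟩ := iht (List.pairwise_cons.1 hle).2 ht
          exact ⟨a :: l₁, i, l₂, rfl, hi⟩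
    obtain ⟨l₁, i, l₂, rfl, hi⟩ := hex
    -- Exchanging an odd letter with itself has sign `-1`, so twice the word lies in `K`.
    have := hsw l₁ i i l₂ hperm
    rw [hi, koszulSign_one_one', neg_one_smul, sub_neg_eq_add, ← two_smul ℂ] at this
    exact (K.smul_mem_iff two_ne_zero).1 this

end Words

/-! ### Triangular pairings between vectors and functionals. -/

section Triangular

variable {T V : Type*} [AddCommGroup V] [Module ℂ V] (v : T → V) (φ : T → V →ₗ[ℂ] ℂ)
  (d : T → ℤ) (r : T → ℕ)

/-- A family of vectors and a family of functionals whose matrix is triangular for the order by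
increasing `d` and, for equal `d`, by decreasing `r`. -/
structure IsTriangular : Prop where
  lt : ∀ a b, d b < d a → φ a (v b) = 0
  len : ∀ a b, d b = d a → r a < r b → φ a (v b) = 0
  ne : ∀ a b, d b = d a → r a = r b → a ≠ b → φ a (v b) = 0
  diag : ∀ a, φ a (v a) ≠ 0

variable {v φ d r}

/-- Test with the functional of an index in the support with `d` maximal and, among those, `r`
minimal: all other terms vanish and the diagonal term does not. -/
theorem IsTriangular.eq_zero (h : IsTriangular v φ d r) (α : T →₀ ℂ)
    (h0 : ∀ a ∈ α.support, φ a (α.sum fun b z => z • v b) = 0) : α = 0 := by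
  by_contra hα
  obtain ⟨a, ha, hmax⟩ := α.support.exists_max_image
    (fun a => toLex (d a, OrderDual.toDual (r a))) (Finsupp.support_nonempty_iff.2 hα)
  have hval := h0 a ha
  rw [Finsupp.sum, map_sum, Finset.sum_eq_single a] at hval
  · rw [map_smul, smul_eq_mul] at hval
    exact mul_ne_zero (Finsupp.mem_support_iff.1 ha) (h.diag a) hval
  · intro b hb hba
    rw [map_smul]
    have hb' := hmax b hb
    rw [Prod.Lex.toLex_le_toLex] at hb'
    rcases hb' with hb' | ⟨hb', hb''⟩
    · rw [h.lt a b hb', smul_zero]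
    · rcases (OrderDual.toDual_le_toDual.1 hb'').lt_or_eq with hr | hr
      · rw [h.len a b hb' hr, smul_zero]
      · rw [h.ne a b hb' hr (Ne.symm hba), smul_zero]
  · exact fun hna => absurd ha hna

theorem IsTriangular.linearIndependent (h : IsTriangular v φ d r) : LinearIndependent ℂ v := by
  rw [linearIndependent_iff]
  intro α hα
  refine h.eq_zero α fun a _ => ?_
  rw [← Finsupp.linearCombination_apply, hα, map_zero]

/-- With finitely many indices the system is square, so its injectivity gives solvability. -/
theorem IsTriangular.exists_unique_values [Finite T] (h : IsTriangular v φ d r) (y : T → ℂ) :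
    ∃ q ∈ Submodule.span ℂ (Set.range v), ∀ a, φ a q = y a := by
  let f : (T →₀ ℂ) →ₗ[ℂ] (T → ℂ) := (LinearMap.pi φ) ∘ₗ Finsupp.linearCombination ℂ v
  have hf : Function.Injective f := by
    rw [← LinearMap.ker_eq_bot, LinearMap.ker_eq_bot']
    intro α hα
    exact h.eq_zero α fun a _ => congrFun hα a
  have hdim : Module.finrank ℂ (T →₀ ℂ) = Module.finrank ℂ (T → ℂ) := by
    cases nonempty_fintype T
    simp
  have hs := (LinearMap.injective_iff_surjective_of_finrank_eq_finrank hdim).1 hf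
  obtain ⟨α, hα⟩ := hs y
  exact ⟨_, Finsupp.range_linearCombination ℂ (v := v) ▸ ⟨α, rfl⟩, fun a => congrFun hα a⟩

theorem IsTriangular.eq_zero_of_mem_span (h : IsTriangular v φ d r) {q : V}
    (hq : q ∈ Submodule.span ℂ (Set.range v)) (h0 : ∀ a, φ a q = 0) : q = 0 := by
  obtain ⟨α, rfl⟩ := (Finsupp.mem_span_range_iff_exists_finsupp).1 hq
  rw [h.eq_zero α fun a _ => h0 a]
  simp

end Triangular

/-! ### The Poincaré–Birkhoff–Witt theorem from a faithful representation. -/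

namespace LieSuperalgebra

variable {g : Type w} [AddCommGroup g] [Module ℂ g] (L : LieSuperalgebra g)

/-- The product in `U(g)` of the entries of a list of vectors. -/
def word {J : Type*} (b : J → g) (l : List J) : L.Env := (l.map fun j => L.ι (b j)).prod

section

variable {J : Type*} (b : J → g)

@[simp] theorem word_nil : L.word b [] = 1 := rfl

@[simp] theorem word_cons (j : J) (l : List J) : L.word b (j :: l) = L.ι (b j) * L.word b l := by
  simp [word]

@[simp] theorem word_append (l l' : List J) : L.word b (l ++ l') = L.word b l * L.word b l' := by
  simp [word]

end

theorem envMk_surjective : Function.Surjective L.envMk := RingQuot.mkAlgHom_surjective ℂ L.EnvRel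

/-- The algebra homomorphism out of `U(g)` that extends a linear map compatible with the
supercommutation relations. -/
def envExtend {A : Type*} [Ring A] [Algebra ℂ A] (f : g →ₗ[ℂ] A)
    (hf : ∀ (i j : ZMod 2) (x y : g), x ∈ L.part i → y ∈ L.part j →
      f x * f y = koszulSign i j • (f y * f x) + f (L.bracket x y)) : L.Env →ₐ[ℂ] A :=
  L.envLift (TensorAlgebra.lift ℂ f) <| by
    rintro _ _ ⟨i, j, x, y, hx, hy⟩
    simpa using hf i j x y hx hy

theorem envExtend_ι {A : Type*} [Ring A] [Algebra ℂ A] (f : g →ₗ[ℂ] A) (hf) (x : g) :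
    L.envExtend f hf (L.ι x) = f x := by
  change L.envLift _ _ (L.envMk (TensorAlgebra.ι ℂ x)) = _
  rw [envLift_mk, TensorAlgebra.lift_ι_apply]

theorem exists_functional_one : ∃ F : L.Env →ₗ[ℂ] ℂ, F 1 = 1 :=
  ⟨(L.envExtend (0 : g →ₗ[ℂ] ℂ) (by simp)).toLinearMap, by simp⟩

/-- A representation of a Lie superalgebra in an associative algebra `A` in which an element `π`
implements the parity. -/
structure SuperRep (A : Type*) [Ring A] [Algebra ℂ A] where
  ρ : g →ₗ[ℂ] A
  π : A
  π_mul_π : π * π = 1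
  π_mul : ∀ (i : ZMod 2) (x : g), x ∈ L.part i → π * ρ x = koszulSign i 1 • (ρ x * π)
  ρ_mul : ∀ (i j : ZMod 2) (x y : g), x ∈ L.part i → y ∈ L.part j →
      ρ x * ρ y = koszulSign i j • (ρ y * ρ x) + ρ (L.bracket x y)

namespace SuperRep

open TensorProduct

variable {L} {A : Type*} [Ring A] [Algebra ℂ A] (R : L.SuperRep A)

/-- The power of `π` given by a parity. -/
def piPow (i : ZMod 2) : A := if i = 0 then 1 else R.π

theorem piPow_mul (i j : ZMod 2) : R.piPow i * R.piPow j = R.piPow (i + j) := by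
  rcases parity_cases i with rfl | rfl <;> rcases parity_cases j with rfl | rfl <;>
    simp [piPow, R.π_mul_π, show (1 + 1 : ZMod 2) = 0 from rfl]

theorem piPow_ρ (i j : ZMod 2) (x : g) (hx : x ∈ L.part j) :
    R.piPow i * R.ρ x = koszulSign i j • (R.ρ x * R.piPow i) := by
  rcases parity_cases i with rfl | rfl
  · simp [piPow, koszulSign_zero_left]
  · simp [piPow, R.π_mul j x hx, koszulSign_comm]

/-- The map `x ↦ x ⊗ 1 + π ^ |x| ⊗ x`. -/
def coproductAux : g →ₗ[ℂ] A ⊗[ℂ] L.Env :=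
  (TensorProduct.mk ℂ A L.Env).flip 1 ∘ₗ R.ρ + TensorProduct.mk ℂ A L.Env 1 ∘ₗ L.ι ∘ₗ L.even +
    TensorProduct.mk ℂ A L.Env R.π ∘ₗ L.ι ∘ₗ L.odd

theorem coproductAux_apply (i : ZMod 2) {x : g} (hx : x ∈ L.part i) :
    R.coproductAux x = R.ρ x ⊗ₜ 1 + R.piPow i ⊗ₜ L.ι x := by
  rcases parity_cases i with rfl | rfl
  · simp [coproductAux, piPow, L.even_of_even hx, L.odd_of_even hx]
  · simp [coproductAux, piPow, L.even_of_odd hx, L.odd_of_odd hx]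

/-- The algebra homomorphism `U(g) → A ⊗ U(g)` given by `x ↦ x ⊗ 1 + π ^ |x| ⊗ x`. -/
def coproduct : L.Env →ₐ[ℂ] A ⊗[ℂ] L.Env :=
  L.envExtend R.coproductAux <| by
    intro i j x y hx hy
    rw [R.coproductAux_apply i hx, R.coproductAux_apply j hy,
      R.coproductAux_apply (i + j) (L.bracket_mem i j x y hx hy)]
    -- The tensor product here is the ordinary one. The mixed terms match because moving a power of
    -- `π` past `ρ` produces the Koszul sign of a super tensor product.
    simp only [add_mul, mul_add, Algebra.TensorProduct.tmul_mul_tmul, mul_one, one_mul,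
      R.ρ_mul i j x y hx hy, R.piPow_ρ i j y hy, R.piPow_ρ j i x hx, R.piPow_mul,
      L.ι_mul_ι i j hx hy, smul_add, TensorProduct.add_tmul, TensorProduct.tmul_add,
      TensorProduct.smul_tmul', TensorProduct.tmul_smul, smul_smul, koszulSign_comm j i,
      koszulSign_mul_self, one_smul, add_comm j i]
    abel

theorem coproduct_ι (i : ZMod 2) {x : g} (hx : x ∈ L.part i) :
    R.coproduct (L.ι x) = R.ρ x ⊗ₜ 1 + R.piPow i ⊗ₜ L.ι x := by
  rw [coproduct, envExtend_ι, R.coproductAux_apply i hx]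

section Functionals

variable {J : Type*} {p : J → ZMod 2} {b : J → g} (hb : ∀ j, b j ∈ L.part (p j))

include hb in
-- The second factor keeps the whole word only if every letter contributes its term `π ^ |x| ⊗ x`.
theorem coproduct_word (l : List J) :
    R.coproduct (L.word b l) - R.piPow (l.map p).sum ⊗ₜ L.word b l ∈
      Submodule.span ℂ {t | ∃ (a : A) (l' : List J), l'.length < l.length ∧
        t = a ⊗ₜ L.word b l'} := by
  induction l with
  | nil => simp [piPow, Algebra.TensorProduct.one_def]
  | cons j l ih =>
    have h1 : R.coproduct (L.word b (j :: l)) - R.piPow ((j :: l).map p).sum ⊗ₜ L.word b (j :: l) =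
        (R.ρ (b j) ⊗ₜ 1 + R.piPow (p j) ⊗ₜ L.ι (b j)) *
          (R.coproduct (L.word b l) - R.piPow (l.map p).sum ⊗ₜ L.word b l) +
        (R.ρ (b j) * R.piPow (l.map p).sum) ⊗ₜ L.word b l := by
      rw [word_cons, map_mul, R.coproduct_ι _ (hb j), mul_sub, add_mul _ _ (_ ⊗ₜ _),
        Algebra.TensorProduct.tmul_mul_tmul, Algebra.TensorProduct.tmul_mul_tmul, R.piPow_mul,
        one_mul, List.map_cons, List.sum_cons]
      abel
    rw [h1]
    refine Submodule.add_mem _ ?_ (Submodule.subset_span ⟨_, l, by simp, rfl⟩)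
    generalize R.coproduct (L.word b l) - R.piPow (l.map p).sum ⊗ₜ L.word b l = t at ih
    induction ih using Submodule.span_induction with
    | mem t ht =>
      obtain ⟨a, l', hl', rfl⟩ := ht
      rw [add_mul, Algebra.TensorProduct.tmul_mul_tmul, Algebra.TensorProduct.tmul_mul_tmul,
        one_mul, ← word_cons]
      exact Submodule.add_mem _ (Submodule.subset_span ⟨_, l', by simp; omega, rfl⟩)
        (Submodule.subset_span ⟨_, j :: l', by simpa using hl', rfl⟩)
    | zero => simp
    | add x y _ _ hx hy => rw [mul_add]; exact Submodule.add_mem _ hx hy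
    | smul c x _ hx => rw [mul_smul_comm]; exact Submodule.smul_mem _ c hx

/-- Contraction of the first factor of `A ⊗ U(g)` with a functional. -/
def contract (f : A →ₗ[ℂ] ℂ) : A ⊗[ℂ] L.Env →ₗ[ℂ] L.Env :=
  TensorProduct.lift (LinearMap.lsmul ℂ L.Env ∘ₗ f)

theorem contract_tmul (f : A →ₗ[ℂ] ℂ) (a : A) (u : L.Env) :
    contract f (a ⊗ₜ u) = f a • u := by
  simp [contract]

variable [LinearOrder J] (f : J → (A →ₗ[ℂ] ℂ)) (hf1 : ∀ i, f i 1 = 0) (hfρ : ∀ i j, f i (R.ρ (b j)) = if i = j then 1 else 0)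
  (hfr : ∀ i a, f i (a * R.π) = f i a) (hfl : ∀ i a, f i (R.π * a) = koszulSign (p i) 1 * f i a)

include hb hf1 hfρ hfr hfl in
-- Since `f i` kills the powers of `π`, at least one letter must go to the first factor. If exactly
-- one does, it has to be `i`, and the powers of `π` to its left give the sign for moving it to the
-- front; if two or more do, the remaining word is shorter by at least two.
theorem contract_coproduct_word (i : J) (l : List J) :
    contract (f i) (R.coproduct (L.word b l)) - deleteSum p i (L.word b) l ∈
      Submodule.span ℂ (L.word b '' {l' | l'.length + 2 ≤ l.length}) := by
  have hr : ∀ a k, f i (a * R.piPow k) = f i a := by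
    intro a k
    rcases parity_cases k with rfl | rfl
    · simp [piPow]
    · simp [piPow, hfr]
  have hl : ∀ a k, f i (R.piPow k * a) = koszulSign (p i) k * f i a := by
    intro a k
    rcases parity_cases k with rfl | rfl
    · simp [piPow, koszulSign_zero_right]
    · simp [piPow, hfl]
  have hc : ∀ (k : ZMod 2) (u : L.Env) (t : A ⊗[ℂ] L.Env), contract (f i) ((R.piPow k ⊗ₜ u) * t) =
      koszulSign (p i) k • (u * contract (f i) t) := by
    intro k u t
    induction t using TensorProduct.induction_on with
    | zero => simp
    | tmul a v =>
      rw [Algebra.TensorProduct.tmul_mul_tmul, contract_tmul, contract_tmul, hl, mul_smul_comm,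
        smul_smul]
    | add x y hx hy => rw [mul_add, map_add, hx, hy, map_add, mul_add, smul_add]
  induction l with
  | nil =>
    simp [deleteSum, map_one, Algebra.TensorProduct.one_def, contract_tmul, hf1]
  | cons j l ih =>
    have hw := R.coproduct_word hb l
    have h1 : contract (f i) (R.coproduct (L.word b (j :: l))) - deleteSum p i (L.word b) (j :: l) =
        contract (f i) ((R.ρ (b j) ⊗ₜ 1) *
          (R.coproduct (L.word b l) - R.piPow (l.map p).sum ⊗ₜ L.word b l)) +
        koszulSign (p i) (p j) • (L.ι (b j) *
          (contract (f i) (R.coproduct (L.word b l)) - deleteSum p i (L.word b) l)) := by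
      have h2 : deleteSum p i (fun l' => L.word b (j :: l')) l =
          L.ι (b j) * deleteSum p i (L.word b) l := by
        simp only [word_cons]
        exact (deleteSum_map p (LinearMap.mulLeft ℂ (L.ι (b j))) i (L.word b) l).symm
      rw [word_cons, map_mul, R.coproduct_ι _ (hb j), add_mul, map_add, hc, deleteSum, h2, mul_sub,
        map_sub, Algebra.TensorProduct.tmul_mul_tmul, contract_tmul, hr, hfρ, one_mul, mul_sub,
        smul_sub, ite_smul, one_smul, zero_smul]
      abel
    rw [h1]
    refine Submodule.add_mem _ ?_ (Submodule.smul_mem _ _ ?_)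
    · generalize R.coproduct (L.word b l) - R.piPow (l.map p).sum ⊗ₜ L.word b l = t at hw
      induction hw using Submodule.span_induction with
      | mem t ht =>
        obtain ⟨a, l', hl', rfl⟩ := ht
        rw [Algebra.TensorProduct.tmul_mul_tmul, contract_tmul, one_mul]
        exact Submodule.smul_mem _ _ (Submodule.subset_span ⟨l', by simp; omega, rfl⟩)
      | zero => simp
      | add x y _ _ hx hy => rw [mul_add, map_add]; exact Submodule.add_mem _ hx hy
      | smul c x _ hx => rw [mul_smul_comm, map_smul]; exact Submodule.smul_mem _ c hx
    · generalize contract (f i) (R.coproduct (L.word b l)) - deleteSum p i (L.word b) l = t at ih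
      induction ih using Submodule.span_induction with
      | mem t ht =>
        obtain ⟨l', hl', rfl⟩ := ht
        rw [← word_cons]
        exact Submodule.subset_span ⟨j :: l', by
          rw [Set.mem_ofPred_eq] at hl' ⊢
          simp only [List.length_cons]
          omega, rfl⟩
      | zero => simp
      | add x y _ _ hx hy => rw [mul_add]; exact Submodule.add_mem _ hx hy
      | smul c x _ hx => rw [mul_smul_comm]; exact Submodule.smul_mem _ c hx

include hb hf1 hfρ hfr hfl in
-- Start from the counit and contract the coproduct once for every letter of `I`. The words shorter
-- by two are killed by the previous functional, so each contraction acts as a deletion.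
theorem exists_word_functional (I : List J) : ∃ F : L.Env →ₗ[ℂ] ℂ,
    (∀ l : List J, l.length = I.length → F (L.word b l) = listPairing p I l) ∧
      ∀ l : List J, l.length < I.length → F (L.word b l) = 0 := by
  induction I with
  | nil =>
    obtain ⟨F, hF⟩ := L.exists_functional_one
    refine ⟨F, fun l hl => ?_, fun l hl => absurd hl (by simp)⟩
    rw [List.length_eq_zero_iff.1 hl]
    simpa [listPairing] using hF
  | cons i I ih =>
    obtain ⟨F, hF, hF0⟩ := ih
    have key : ∀ l : List J, l.length ≤ I.length + 1 →
        F (contract (f i) (R.coproduct (L.word b l))) = deleteSum p i (fun l' => F (L.word b l')) l := by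
      intro l hl
      have h := R.contract_coproduct_word hb f hf1 hfρ hfr hfl i l
      have h0 : Submodule.span ℂ (L.word b '' {l' | l'.length + 2 ≤ l.length}) ≤
          LinearMap.ker F := by
        rw [Submodule.span_le]
        rintro _ ⟨l', hl', rfl⟩
        rw [Set.mem_ofPred_eq] at hl'
        exact hF0 l' (by omega)
      have h1 : F _ = 0 := h0 h
      rwa [map_sub, sub_eq_zero, deleteSum_map] at h1
    refine ⟨F ∘ₗ contract (f i) ∘ₗ R.coproduct.toLinearMap, fun l hl => ?_, fun l hl => ?_⟩
    · change F (contract (f i) (R.coproduct (L.word b l))) = _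
      rw [key l (by simpa using hl.le)]
      refine deleteSum_congr p i l fun l' hl' => hF l' ?_
      have := hl'.length_eq
      simp only [List.length_cons] at this hl
      omega
    · change F (contract (f i) (R.coproduct (L.word b l))) = _
      rw [key l hl.le, deleteSum_congr p i (f' := fun _ => 0), deleteSum_zero]
      intro l' hl'
      have := hl'.length_eq
      simp only [List.length_cons] at this hl
      exact hF0 l' (by omega)

end Functionals

end SuperRep

/-- The action on `A × ℂ` obtained from a representation in `A`; here `π` acts on `A` by
conjugation. -/
def SuperRep.addTrivial {L : LieSuperalgebra g} {A : Type*} [Ring A] [Algebra ℂ A]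
    (R : L.SuperRep A) : L.SuperRep (Module.End ℂ (A × ℂ)) where
  ρ := { toFun := fun x => (LinearMap.mulLeft ℂ (R.ρ x)).prodMap 0
         map_add' := fun x y => by ext <;> simp [add_mul]
         map_smul' := fun c x => by ext <;> simp }
  π := (LinearMap.mulLeft ℂ R.π ∘ₗ LinearMap.mulRight ℂ R.π).prodMap LinearMap.id
  π_mul_π := by
    refine LinearMap.ext fun v => Prod.ext ?_ rfl
    change R.π * (R.π * (v.1 * R.π) * R.π) = v.1
    rw [mul_assoc, mul_assoc, R.π_mul_π, mul_one, ← mul_assoc, R.π_mul_π, one_mul]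
  π_mul i x hx := by
    refine LinearMap.ext fun v => Prod.ext ?_ (by simp)
    change R.π * (R.ρ x * v.1 * R.π) = koszulSign i 1 • (R.ρ x * (R.π * (v.1 * R.π)))
    rw [mul_assoc, ← mul_assoc, R.π_mul i x hx, smul_mul_assoc, mul_assoc]
  ρ_mul i j x y hx hy := by
    refine LinearMap.ext fun v => Prod.ext ?_ (by simp)
    change R.ρ x * (R.ρ y * v.1) = koszulSign i j • (R.ρ y * (R.ρ x * v.1)) +
      R.ρ (L.bracket x y) * v.1
    rw [← mul_assoc, R.ρ_mul i j x y hx hy, add_mul, smul_mul_assoc, mul_assoc]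

/-- The coordinate functionals have to kill `1`, but `1` may lie in the image of `g`, as it does for
matrices. Adding a trivial summand separates them: evaluation at `(1, 1)` sends `g` to vectors with
second entry `0`. This vector is fixed by `π`, which gives right invariance; averaging over left
multiplication by `π` gives the sign on the left. -/
theorem SuperRep.exists_word_functional_of_injective {A : Type*} [Ring A] [Algebra ℂ A]
    {L : LieSuperalgebra g} (R : L.SuperRep A) (hR : Function.Injective R.ρ)
    {J : Type*} [LinearOrder J] {p : J → ZMod 2} (b : Module.Basis J ℂ g)
    (hb : ∀ j, b j ∈ L.part (p j)) (I : List J) : ∃ F : L.Env →ₗ[ℂ] ℂ,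
    (∀ l : List J, l.length = I.length → F (L.word b l) = listPairing p I l) ∧
      ∀ l : List J, l.length < I.length → F (L.word b l) = 0 := by
  let T : g × ℂ →ₗ[ℂ] A × ℂ :=
    LinearMap.coprod (LinearMap.inl ℂ A ℂ ∘ₗ R.ρ) (LinearMap.toSpanSingleton ℂ (A × ℂ) (1, 1))
  have hT : Function.Injective T := by
    rw [← LinearMap.ker_eq_bot, LinearMap.ker_eq_bot']
    rintro ⟨x, c⟩ h
    have h2 : c = 0 := by simpa [T] using congrArg Prod.snd h
    have h1 : R.ρ x = 0 := by simpa [T, h2] using congrArg Prod.fst h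
    rw [h2, hR (h1.trans (map_zero _).symm)]
    rfl
  obtain ⟨S, hS⟩ := LinearMap.exists_leftInverse_of_injective T (LinearMap.ker_eq_bot.2 hT)
  let R' := R.addTrivial
  let ev : Module.End ℂ (A × ℂ) →ₗ[ℂ] A × ℂ := LinearMap.applyₗ (1, 1)
  let μ : J → A × ℂ →ₗ[ℂ] ℂ := fun i => b.coord i ∘ₗ LinearMap.fst ℂ g ℂ ∘ₗ S
  have hev : ∀ a, ev (a * R'.π) = ev a := by
    intro a
    change a (R.π * (1 * R.π), 1) = a (1, 1)
    rw [one_mul, R.π_mul_π]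
  have hST : ∀ x c, S (R.ρ x + algebraMap ℂ A c, c) = (x, c) := by
    intro x c
    have := LinearMap.congr_fun hS (x, c)
    simpa [T, Algebra.algebraMap_eq_smul_one] using this
  have hμρ : ∀ i j, μ i (ev (R'.ρ (b j))) = if i = j then 1 else 0 := by
    intro i j
    have h : ev (R'.ρ (b j)) = (R.ρ (b j) + algebraMap ℂ A 0, 0) := by
      change (R.ρ (b j) * 1, (0 : ℂ)) = _
      simp
    change b.coord i (S _).1 = _
    rw [h, hST, Module.Basis.coord_apply, Module.Basis.repr_self, Finsupp.single_apply]
    simp only [eq_comm]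
  have hμ1 : ∀ i, μ i (1, 1) = 0 := by
    intro i
    have h : ((1, 1) : A × ℂ) = (R.ρ 0 + algebraMap ℂ A 1, 1) := by simp
    change b.coord i (S _).1 = _
    rw [h, hST]
    simp
  refine R'.exists_word_functional hb
    (fun i => (2⁻¹ : ℂ) • (μ i ∘ₗ ev + koszulSign (p i) 1 • μ i ∘ₗ ev ∘ₗ LinearMap.mulLeft ℂ R'.π))
    ?_ ?_ ?_ ?_ I
  · intro i
    have h1 : ev 1 = (1, 1) := rfl
    have h2 : ev (R'.π * 1) = (1, 1) := by
      have := hev 1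
      rw [one_mul] at this
      rw [mul_one, this, h1]
    simp only [LinearMap.smul_apply, LinearMap.add_apply, LinearMap.comp_apply,
      LinearMap.mulLeft_apply, h1, h2, hμ1]
    simp
  · intro i j
    simp only [LinearMap.smul_apply, LinearMap.add_apply, LinearMap.comp_apply,
      LinearMap.mulLeft_apply, R'.π_mul _ _ (hb j), map_smul, hev, hμρ]
    split_ifs with hij
    · rw [hij]
      simp only [smul_eq_mul, mul_one, koszulSign_mul_self]
      norm_num
    · simp
  · intro i a
    simp only [LinearMap.smul_apply, LinearMap.add_apply, LinearMap.comp_apply,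
      LinearMap.mulLeft_apply, ← mul_assoc, hev]
  · intro i a
    simp only [LinearMap.smul_apply, LinearMap.add_apply, LinearMap.comp_apply,
      LinearMap.mulLeft_apply, ← mul_assoc, R'.π_mul_π, one_mul, smul_eq_mul, mul_add]
    linear_combination -(2⁻¹ * μ i (ev (R'.π * a))) * koszulSign_mul_self (p i) 1

theorem parityMap_parityMap (x : g) : L.parityMap (L.parityMap x) = x := by
  conv_rhs => rw [← L.even_add_odd x]
  simp [parityMap, L.even_of_even (L.even_mem x), L.odd_of_even (L.even_mem x),
      L.even_of_odd (L.odd_mem x), L.odd_of_odd (L.odd_mem x)]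

theorem induction_part {P : g → Prop} (h : ∀ i, ∀ x ∈ L.part i, P x)
    (hadd : ∀ x y, P x → P y → P (x + y)) (x : g) : P x := by
  rw [← L.even_add_odd x]
  exact hadd _ _ (h 0 _ (L.even_mem x)) (h 1 _ (L.odd_mem x))

theorem parityMap_bracket (x : g) (i : ZMod 2) (hx : x ∈ L.part i) (y : g) :
    L.parityMap (L.bracket x y) = koszulSign i 1 • L.bracket x (L.parityMap y) := by
  refine L.induction_part (P := fun y => L.parityMap (L.bracket x y) =
    koszulSign i 1 • L.bracket x (L.parityMap y)) (fun j y hy => ?_) (fun y z hy hz => ?_) y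
  · rw [L.parityMap_apply_of_mem _ (L.bracket_mem i j x y hx hy), L.parityMap_apply_of_mem j hy,
      map_smul, smul_smul, koszulSign_add_left]
  · simp only [map_add, hy, hz, smul_add]

/-- The adjoint representation. -/
def adjointRep : L.SuperRep (Module.End ℂ g) where
  ρ := L.bracket
  π := L.parityMap
  π_mul_π := LinearMap.ext L.parityMap_parityMap
  π_mul i x hx := LinearMap.ext fun y => L.parityMap_bracket x i hx y
  ρ_mul i j x y hx hy := LinearMap.ext fun z => by
    have := L.jacobi i j x y z hx hy
    change L.bracket x (L.bracket y z) = koszulSign i j • L.bracket y (L.bracket x z) +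
      L.bracket (L.bracket x y) z
    rw [this, add_comm]

/-- The kernel of the adjoint representation is a graded ideal, and it is not everything because the
bracket is nonzero. -/
theorem bracket_injective_of_isSimple (h : L.IsSimple) : Function.Injective L.bracket := by
  rw [← LinearMap.ker_eq_bot]
  have hgr : L.IsGradedSubspace (LinearMap.ker L.bracket) := by
    intro x hx
    have hx' : ∀ y, L.bracket x y = 0 := fun y => LinearMap.congr_fun hx y
    have h0 : ∀ j, ∀ y ∈ L.part j, L.bracket (L.even x) y = 0 ∧ L.bracket (L.odd x) y = 0 := by
      intro j y hy
      have h1 := L.bracket_mem 0 j _ _ (L.even_mem x) hy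
      have h2 := L.bracket_mem 1 j _ _ (L.odd_mem x) hy
      -- The brackets of `y` with the two components are opposite to each other but have different
      -- parities, so both vanish.
      have h3 : L.bracket (L.even x) y = -L.bracket (L.odd x) y := by
        rw [eq_neg_iff_add_eq_zero, ← LinearMap.add_apply, ← map_add, L.even_add_odd, hx']
      have h4 : L.bracket (L.even x) y = 0 := by
        rcases parity_cases j with rfl | rfl
        · exact Submodule.disjoint_def.1 L.isCompl_part.disjoint _ (by simpa using h1)
            (by rw [h3]; simpa using neg_mem h2)
        · refine Submodule.disjoint_def.1 L.isCompl_part.disjoint _ ?_ (by simpa using h1)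
          rw [h3]; simpa [show (1 + 1 : ZMod 2) = 0 from rfl] using neg_mem h2
      exact ⟨h4, by rw [h4] at h3; exact neg_eq_zero.1 h3.symm⟩
    exact ⟨LinearMap.ext (L.induction_part (fun j y hy => (h0 j y hy).1)
        (fun y z hy hz => by rw [map_add, hy, hz]; simp)),
      LinearMap.ext (L.induction_part (fun j y hy => (h0 j y hy).2)
        (fun y z hy hz => by rw [map_add, hy, hz]; simp))⟩
  have hideal : ∀ x : g, ∀ y ∈ LinearMap.ker L.bracket, L.bracket x y ∈ LinearMap.ker L.bracket := by
    intro x y hy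
    have : L.bracket x y = 0 := by
      refine L.induction_part (P := fun x => L.bracket x y = 0) (fun i x hx => ?_)
        (fun a b ha hb => by rw [map_add, LinearMap.add_apply, ha, hb, add_zero]) x
      have hy0 : L.bracket (L.even y) x = 0 := LinearMap.congr_fun (hgr y hy).1 x
      have hy1 : L.bracket (L.odd y) x = 0 := LinearMap.congr_fun (hgr y hy).2 x
      rw [← L.even_add_odd y, map_add, L.skew i 0 x _ hx (L.even_mem y),
        L.skew i 1 x _ hx (L.odd_mem y), hy0, hy1]
      simp
    rw [this]
    exact Submodule.zero_mem _
  rcases h.eq_bot_or_eq_top _ hgr hideal with h0 | h0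
  · exact h0
  · obtain ⟨x, y, hxy⟩ := h.non_abelian
    have : x ∈ LinearMap.ker L.bracket := h0 ▸ Submodule.mem_top
    exact absurd (LinearMap.congr_fun this y) hxy

/-- For `𝔤𝔩(m|n)` the adjoint representation has the identity matrix in its kernel; the tautological
representation is used instead, with parity given by `diag(1, -1)`. -/
theorem exists_superRep_of_isGeneralLinear (h : L.IsGeneralLinear) :
    ∃ (m n : ℕ) (R : L.SuperRep (Matrix (Fin m ⊕ Fin n) (Fin m ⊕ Fin n) ℂ)),
      Function.Injective R.ρ := by
  obtain ⟨m, n, φ, hφ, hbr⟩ := h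
  refine ⟨m, n, ⟨φ.toLinearMap, Matrix.fromBlocks 1 0 0 (-1), ?_, fun i x hx => ?_,
    fun i j x y hx hy => ?_⟩, φ.injective⟩
  · rw [Matrix.fromBlocks_multiply]
    simp [Matrix.fromBlocks_one]
  · have hb := (hφ i x).1 hx
    change _ * φ x = koszulSign i 1 • (φ x * _)
    rw [← Matrix.fromBlocks_toBlocks (φ x), Matrix.fromBlocks_multiply, Matrix.fromBlocks_multiply]
    rcases parity_cases i with rfl | rfl
    · rw [IsBlockOfParity, if_pos rfl] at hb
      simp [hb.1, hb.2, koszulSign_zero_left]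
    · rw [IsBlockOfParity, if_neg one_ne_zero] at hb
      simp [hb.1, hb.2, koszulSign_one_one', Matrix.fromBlocks_neg]
  · change φ x * φ y = koszulSign i j • (φ y * φ x) + φ (L.bracket x y)
    rw [hbr i j x y hx hy]
    abel

/-- The independence half of PBW. The two cases in the definition of basic classical superalgebras
enter only here, each by providing a faithful representation. -/
theorem exists_word_functional {L : LieSuperalgebra g} (hL : L.IsBasicClassical)
    {J : Type*} [LinearOrder J] {p : J → ZMod 2} (b : Module.Basis J ℂ g)
    (hb : ∀ j, b j ∈ L.part (p j)) (I : List J) : ∃ F : L.Env →ₗ[ℂ] ℂ,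
    (∀ l : List J, l.length = I.length → F (L.word b l) = listPairing p I l) ∧
      ∀ l : List J, l.length < I.length → F (L.word b l) = 0 := by
  rcases hL.classical_or_gl with h | h
  · exact L.adjointRep.exists_word_functional_of_injective
      (L.bracket_injective_of_isSimple h.1) b hb I
  · obtain ⟨m, n, R, hR⟩ := L.exists_superRep_of_isGeneralLinear h
    exact R.exists_word_functional_of_injective hR b hb I

end LieSuperalgebra

/-! ### Triples of `𝔰𝔩₂` acting on a finite-dimensional space. -/

namespace Module.End

variable {V : Type*} [AddCommGroup V] [Module ℂ V]

/-- The relations of an `𝔰𝔩₂`-triple for endomorphisms. -/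
structure IsSl2 (H X Y : Module.End ℂ V) : Prop where
  HX : H * X - X * H = 2 * X
  HY : H * Y - Y * H = -(2 * Y)
  XY : X * Y - Y * X = H

theorem IsSl2.symm {H X Y : Module.End ℂ V} (h : IsSl2 H X Y) : IsSl2 (-H) Y X where
  HX := by rw [neg_mul, mul_neg, sub_neg_eq_add, neg_add_eq_sub, ← neg_sub, h.HY, neg_neg]
  HY := by rw [neg_mul, mul_neg, sub_neg_eq_add, neg_add_eq_sub, ← neg_sub, h.HX]
  XY := by rw [← neg_sub, h.XY]

namespace IsSl2

variable {H X Y : Module.End ℂ V} (h : IsSl2 H X Y)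

/-- A multiple of the Casimir element, up to a constant. -/
def casimir (H X Y : Module.End ℂ V) : Module.End ℂ V := (H + 1) * (H + 1) + 4 * (Y * X)

/-- The factors of `4 ^ n • Y ^ n * X ^ n`. -/
def factor (H X Y : Module.End ℂ V) (k : ℕ) : Module.End ℂ V :=
  casimir H X Y - (H + (2 * k + 1)) * (H + (2 * k + 1))

include h

theorem H_mul_X : H * X = X * H + 2 * X := by rw [← h.HX]; abel

theorem H_mul_Y : H * Y = Y * H - 2 * Y := by rw [sub_eq_add_neg, ← h.HY]; abel

theorem X_mul_Y : X * Y = Y * X + H := by rw [← h.XY]; abel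

theorem casimir_symm : casimir (-H) Y X = casimir H X Y := by
  rw [casimir, casimir, h.X_mul_Y]
  noncomm_ring

theorem commute_H_casimir : Commute H (casimir H X Y) := by
  have h1 : Commute H (Y * X) := by
    change H * (Y * X) = Y * X * H
    rw [← mul_assoc, h.H_mul_Y, sub_mul, mul_assoc Y H X, h.H_mul_X]
    noncomm_ring
  exact (((Commute.refl H).add_right (Commute.one_right H)).mul_right
    ((Commute.refl H).add_right (Commute.one_right H))).add_right
      ((Nat.cast_commute 4 H).symm.mul_right h1)

theorem commute_X_casimir : Commute X (casimir H X Y) := by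
  have e : casimir H X Y = H * H + 2 * H + 1 + 4 * (Y * X) := by rw [casimir]; noncomm_ring
  change X * casimir H X Y = casimir H X Y * X
  have h1 : H * H * X = X * (H * H) + 4 * (X * H) + 4 * X := by
    rw [mul_assoc, h.H_mul_X, mul_add, ← mul_assoc, h.H_mul_X]
    have : H * (2 * X) = 2 * (H * X) := by noncomm_ring
    rw [this, h.H_mul_X]
    noncomm_ring
  have h2 : X * (Y * X) = Y * X * X + (X * H + 2 * X) := by
    rw [← mul_assoc, h.X_mul_Y, add_mul, h.H_mul_X]
  have h3 : 2 * H * X = 2 * (X * H) + 4 * X := by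
    rw [mul_assoc, h.H_mul_X]; noncomm_ring
  rw [e]
  simp only [mul_add, add_mul, h1, h3]
  have h4 : X * (4 * (Y * X)) = 4 * (X * (Y * X)) := by noncomm_ring
  rw [h4, h2]
  noncomm_ring

theorem H_mul_X_pow (n : ℕ) : (H + 1) * X ^ n = X ^ n * (H + (2 * n + 1)) := by
  induction n with
  | zero => simp
  | succ n ih =>
    rw [pow_succ, ← mul_assoc, ih, mul_assoc, add_mul, h.H_mul_X]
    have hc : (n : Module.End ℂ V) * X = X * n := Nat.cast_commute n X
    push_cast
    noncomm_ring
    rw [hc]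

/-- The inner `Y X` is a polynomial in `H` and the Casimir element, and moving it past `X ^ n`
shifts `H` by `2 n`. Thus `4 ^ n Y ^ n X ^ n` is the product of the commuting factors `C - (H + 2 k
+ 1)²`, `k < n`. -/
theorem Y_pow_mul_X_pow (n : ℕ) :
    4 ^ n * (Y ^ (n + 1) * X ^ (n + 1)) * 4 = 4 ^ n * (Y ^ n * X ^ n) * factor H X Y n := by
  have h1 : Y * X * 4 = casimir H X Y - (H + 1) * (H + 1) := by
    rw [casimir]; noncomm_ring
  have h2 : Y ^ (n + 1) * X ^ (n + 1) * 4 = Y ^ n * (Y * X * 4) * X ^ n := by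
    rw [pow_succ, pow_succ']; noncomm_ring
  have h3 : (H + 1) * (H + 1) * X ^ n = X ^ n * ((H + (2 * n + 1)) * (H + (2 * n + 1))) := by
    rw [mul_assoc, h.H_mul_X_pow, ← mul_assoc, h.H_mul_X_pow, mul_assoc]
  rw [mul_assoc, h2, h1, mul_assoc (Y ^ n), sub_mul, h3,
    ← (h.commute_X_casimir.pow_left n).eq, ← mul_sub, factor, mul_assoc, mul_assoc]

/-- The product of the first `n` factors. -/
theorem four_pow_apply (n : ℕ) (v : V) :
    (4 ^ (n + 1) : ℂ) • (Y ^ (n + 1)) ((X ^ (n + 1)) v) =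
      (4 ^ n : ℂ) • (Y ^ n) ((X ^ n) (factor H X Y n v)) := by
  have h4 : ∀ (m : ℕ) (T : Module.End ℂ V) (u : V), ((4 : Module.End ℂ V) ^ m * T) u =
      (4 ^ m : ℂ) • T u := by
    intro m T u
    have : (4 : Module.End ℂ V) ^ m = algebraMap ℂ (Module.End ℂ V) (4 ^ m) := by
      rw [map_pow, map_ofNat]
    rw [this, Module.End.mul_apply, Module.algebraMap_end_apply]
  have := LinearMap.congr_fun (h.Y_pow_mul_X_pow n) v
  rw [Module.End.mul_apply, h4, Module.End.mul_apply (4 ^ n * _), h4] at this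
  rw [← Module.End.mul_apply (Y ^ n), ← this, ← Module.End.mul_apply]
  have h5 : (4 : Module.End ℂ V) v = (4 : ℂ) • v := by
    have : (4 : Module.End ℂ V) = algebraMap ℂ (Module.End ℂ V) 4 := by rw [map_ofNat]
    rw [this, Module.algebraMap_end_apply]
  rw [h5, map_smul, smul_smul, pow_succ]

theorem commute_H_factor (k : ℕ) : Commute H (factor H X Y k) := by
  have h1 : Commute H (H + (2 * (k : Module.End ℂ V) + 1)) :=
    (Commute.refl H).add_right (by exact_mod_cast (Nat.cast_commute (2 * k + 1) H).symm)
  exact h.commute_H_casimir.sub_right (h1.mul_right h1)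

theorem commute_casimir_factor (k : ℕ) : Commute (casimir H X Y) (factor H X Y k) := by
  have h1 : Commute (casimir H X Y) (H + (2 * (k : Module.End ℂ V) + 1)) :=
    h.commute_H_casimir.symm.add_right
      (by exact_mod_cast (Nat.cast_commute (2 * k + 1) (casimir H X Y)).symm)
  exact (Commute.refl _).sub_right (h1.mul_right h1)

omit h in
theorem factor_apply (k : ℕ) (v : V) : factor H X Y k v = casimir H X Y v -
    (H (H v) + (2 * (2 * k + 1) : ℂ) • H v + ((2 * k + 1) ^ 2 : ℂ) • v) := by
  have h3 : ∀ v, (H + (2 * (k : Module.End ℂ V) + 1)) v = H v + (2 * k + 1 : ℂ) • v := by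
    intro v
    have : (2 * (k : Module.End ℂ V) + 1) = algebraMap ℂ (Module.End ℂ V) (2 * k + 1) := by
      rw [map_add, map_mul, map_one, map_natCast, map_ofNat]
    rw [LinearMap.add_apply, this, Module.algebraMap_end_apply]
  rw [factor, LinearMap.sub_apply, Module.End.mul_apply, h3, h3, map_add, map_smul]
  module

omit h in
theorem factor_apply_of_eigen (k : ℕ) {η ω : ℂ} {v : V} (h1 : H v = η • v)
    (h2 : casimir H X Y v = ω • v) :
    factor H X Y k v = (ω - (η + (2 * k + 1)) ^ 2) • v := by
  rw [factor_apply, h2, h1, map_smul, h1]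
  module

omit h in
theorem exists_pow_apply_ne_zero {N : Module.End ℂ V} {v : V} (hv : v ≠ 0)
    (hN : ∃ a : ℕ, (N ^ a) v = 0) : ∃ m : ℕ, (N ^ m) v ≠ 0 ∧ N ((N ^ m) v) = 0 := by
  classical
  obtain ⟨m, hm⟩ : ∃ m, Nat.find hN = m + 1 :=
    Nat.exists_eq_succ_of_ne_zero fun h0 => hv (by simpa [h0] using Nat.find_spec hN)
  refine ⟨m, Nat.find_min hN (by omega), ?_⟩
  have := Nat.find_spec hN
  rwa [hm, pow_succ', Module.End.mul_apply] at this

/-- On a joint generalized eigenspace the factor has the single eigenvalue `ω - (η + 2 k + 1)²`.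
Powers of `H - η` and `C - ω` turn a nonzero vector of its kernel into a joint eigenvector still in
the kernel. -/
theorem eq_zero_of_factor_apply (k : ℕ) {η ω : ℂ} (hne : ω ≠ (η + (2 * k + 1)) ^ 2) {v : V}
    (h1 : v ∈ H.maxGenEigenspace η) (h2 : v ∈ (casimir H X Y).maxGenEigenspace ω)
    (h0 : factor H X Y k v = 0) : v = 0 := by
  by_contra hv
  rw [Module.End.mem_maxGenEigenspace] at h1 h2
  obtain ⟨a, ha, ha'⟩ := exists_pow_apply_ne_zero hv h1
  have hcomm : Commute (casimir H X Y - ω • (1 : Module.End ℂ V)) (H - η • (1 : Module.End ℂ V)) :=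
    (h.commute_H_casimir.symm.sub_left ((Commute.one_left _).smul_left _)).sub_right
      ((Commute.one_right _).smul_right _)
  have hcf1 : Commute (factor H X Y k) (H - η • (1 : Module.End ℂ V)) :=
    (h.commute_H_factor k).symm.sub_right ((Commute.one_right _).smul_right _)
  have hcf2 : Commute (factor H X Y k) (casimir H X Y - ω • (1 : Module.End ℂ V)) :=
    (h.commute_casimir_factor k).symm.sub_right ((Commute.one_right _).smul_right _)
  have hsw : ∀ {S T : Module.End ℂ V}, Commute S T → ∀ u, S (T u) = T (S u) := fun hST u =>
    LinearMap.congr_fun hST.eq u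
  obtain ⟨b, hb, hb'⟩ := exists_pow_apply_ne_zero ha (N := casimir H X Y - ω • 1) (by
    obtain ⟨c, hc⟩ := h2
    exact ⟨c, by rw [hsw (hcomm.pow_pow c a), hc, map_zero]⟩)
  set u := ((casimir H X Y - ω • (1 : Module.End ℂ V)) ^ b) (((H - η • 1) ^ a) v)
  have hu1 : H u = η • u := by
    have : (H - η • (1 : Module.End ℂ V)) u = 0 := by
      rw [← hsw (hcomm.pow_left b), ha', map_zero]
    rwa [LinearMap.sub_apply, LinearMap.smul_apply, Module.End.one_apply, sub_eq_zero] at this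
  have hu2 : casimir H X Y u = ω • u := by
    rwa [LinearMap.sub_apply, LinearMap.smul_apply, Module.End.one_apply, sub_eq_zero] at hb'
  have hu0 : factor H X Y k u = 0 := by
    rw [hsw (hcf2.pow_right b), hsw (hcf1.pow_right a), h0, map_zero, map_zero]
  rw [factor_apply_of_eigen k hu1 hu2] at hu0
  rcases smul_eq_zero.1 hu0 with hu0 | hu0
  · exact hne (sub_eq_zero.1 hu0)
  · exact hb hu0

theorem factor_mem (k : ℕ) {η ω : ℂ} {v : V}
    (h1 : v ∈ H.maxGenEigenspace η) (h2 : v ∈ (casimir H X Y).maxGenEigenspace ω) :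
    factor H X Y k v ∈ H.maxGenEigenspace η ∧
      factor H X Y k v ∈ (casimir H X Y).maxGenEigenspace ω :=
  ⟨Module.End.mapsTo_maxGenEigenspace_of_comm (h.commute_H_factor k) η h1,
    Module.End.mapsTo_maxGenEigenspace_of_comm (h.commute_casimir_factor k) ω h2⟩

theorem eq_zero_of_forall_ne (n : ℕ) {η ω : ℂ} {v : V} (h1 : v ∈ H.maxGenEigenspace η)
    (h2 : v ∈ (casimir H X Y).maxGenEigenspace ω) (hv : (Y ^ n) ((X ^ n) v) = 0)
    (hne : ∀ k < n, ω ≠ (η + (2 * k + 1)) ^ 2) : v = 0 := by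
  induction n generalizing v with
  | zero => simpa using hv
  | succ n ih =>
    have hm := h.factor_mem n h1 h2
    have := h.four_pow_apply n v
    rw [hv, smul_zero] at this
    refine h.eq_zero_of_factor_apply n (hne n (by omega)) h1 h2 ?_
    exact ih hm.1 hm.2 ((smul_eq_zero.1 this.symm).resolve_left (pow_ne_zero _ (by norm_num : (4 : ℂ) ≠ 0)))
      fun k hk => hne k (by omega)

/-- All factors of `Y ^ n X ^ n` other than number `k₀` are injective on the generalized eigenspaces
and can be cancelled. -/
theorem factor_apply_eq_zero (n : ℕ) {η ω : ℂ} {v : V} (h1 : v ∈ H.maxGenEigenspace η)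
    (h2 : v ∈ (casimir H X Y).maxGenEigenspace ω) (hv : (Y ^ n) ((X ^ n) v) = 0) (k₀ : ℕ)
    (hne : ∀ k < n, k ≠ k₀ → ω ≠ (η + (2 * k + 1)) ^ 2) : factor H X Y k₀ v = 0 := by
  induction n generalizing v with
  | zero =>
    have : v = 0 := by simpa using hv
    rw [this, map_zero]
  | succ n ih =>
    have hm := h.factor_mem n h1 h2
    have := h.four_pow_apply n v
    rw [hv, smul_zero] at this
    have h3 := (smul_eq_zero.1 this.symm).resolve_left (pow_ne_zero _ (by norm_num : (4 : ℂ) ≠ 0))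
    by_cases hn : n = k₀
    · subst hn
      exact h.eq_zero_of_forall_ne n hm.1 hm.2 h3 fun k hk => hne k (by omega) (by omega)
    · have hm' := h.factor_mem k₀ h1 h2
      refine h.eq_zero_of_factor_apply n (hne n (by omega) hn) hm'.1 hm'.2 ?_
      have hc : Commute (factor H X Y n) (factor H X Y k₀) := by
        have hc1 : Commute (factor H X Y n) (H + (2 * (k₀ : Module.End ℂ V) + 1)) :=
          (h.commute_H_factor n).symm.add_right
            (by exact_mod_cast (Nat.cast_commute (2 * k₀ + 1) (factor H X Y n)).symm)
        exact (h.commute_casimir_factor n).symm.sub_right (hc1.mul_right hc1)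
      have := LinearMap.congr_fun hc.eq v
      rw [Module.End.mul_apply, Module.End.mul_apply] at this
      rw [this]
      exact ih hm.1 hm.2 h3 fun k hk => hne k (by omega)

variable [FiniteDimensional ℂ V]

/-- A nonzero `Y ^ n` is an eigenvector of `ad H` with eigenvalue `-2 n`, and there is room for
finitely many eigenvalues only. -/
theorem isNilpotent_Y : IsNilpotent Y := by
  by_contra hY
  have hpow : ∀ n : ℕ, H * Y ^ n - Y ^ n * H = (-2 * n : ℂ) • Y ^ n := by
    intro n
    induction n with
    | zero => simp
    | succ n ih =>
      have e : H * Y ^ (n + 1) - Y ^ (n + 1) * H =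
          (H * Y ^ n - Y ^ n * H) * Y + Y ^ n * (H * Y - Y * H) := by
        rw [pow_succ]; noncomm_ring
      have e2 : Y ^ n * (2 * Y) = (2 : ℂ) • Y ^ (n + 1) := by
        rw [pow_succ, two_smul]; noncomm_ring
      rw [e, ih, h.HY, mul_neg, e2, smul_mul_assoc, ← pow_succ, ← neg_smul, ← add_smul]
      push_cast
      congr 1; ring
  let T : Module.End ℂ (Module.End ℂ V) := LinearMap.mulLeft ℂ H - LinearMap.mulRight ℂ H
  have hT : ∀ n : ℕ, T.HasEigenvalue (-2 * n : ℂ) := fun n =>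
    Module.End.hasEigenvalue_of_hasEigenvector (x := Y ^ n)
      ⟨Module.End.mem_eigenspace_iff.2 (hpow n), fun h0 => hY ⟨n, h0⟩⟩
  refine Set.infinite_of_injective_forall_mem (f := fun n : ℕ => (-2 * n : ℂ)) ?_ hT
    T.finite_hasEigenvalue
  intro a b hab
  simpa using hab

/-- Let `η`, `ω` be joint generalized eigenvalues of `H` and of the Casimir element `C`. Nilpotency
of `X` forces `ω = (η + 2 k + 1)²`, that of `Y` forces `ω = (-η + 2 j + 1)²`, with natural numbers
`k` and `j`; hence `η = j - k`, and no other factor is singular. A generalized eigenvector is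
therefore killed by `C - (H + 2 k + 1)²` and by `C - (H - 2 j - 1)²`. The difference of the two is a
nonzero multiple of `H - (j - k)`, so the vector is a true eigenvector with an integral eigenvalue.
Complete reducibility is not needed. -/
theorem iSup_eigenspace_eq_top (hX : IsNilpotent X) :
    ⨆ k : ℤ, H.eigenspace (k : ℂ) = ⊤ := by
  obtain ⟨N, hN⟩ := hX
  obtain ⟨N', hN'⟩ := h.isNilpotent_Y
  have htop := Module.End.iSup_iInf_maxGenEigenspace_eq_top_of_iSup_maxGenEigenspace_eq_top_of_commute
    (fun i : Bool => if i then H else casimir H X Y) (by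
      intro i j hij
      cases i <;> cases j <;> simp at hij ⊢
      · exact h.commute_H_casimir.symm
      · exact h.commute_H_casimir)
    (fun i => Module.End.iSup_maxGenEigenspace_eq_top _)
  rw [eq_top_iff, ← htop, iSup_le_iff]
  intro μ v hv
  rw [Submodule.mem_iInf] at hv
  have h1 : v ∈ H.maxGenEigenspace (μ true) := hv true
  have h2 : v ∈ (casimir H X Y).maxGenEigenspace (μ false) := hv false
  have h1' : v ∈ (-H).maxGenEigenspace (-μ true) := by
    rw [Module.End.mem_maxGenEigenspace] at h1 ⊢
    obtain ⟨k, hk⟩ := h1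
    refine ⟨k, ?_⟩
    have e : -H - -μ true • (1 : Module.End ℂ V) = -(H - μ true • 1) := by
      rw [neg_smul]; abel
    rw [e, neg_pow, Module.End.mul_apply, hk, map_zero]
  have h2' : v ∈ (casimir (-H) Y X).maxGenEigenspace (μ false) := by rwa [h.casimir_symm]
  generalize μ true = η at *
  generalize μ false = ω at *
  by_cases hv0 : v = 0
  · rw [hv0]; exact Submodule.zero_mem _
  obtain ⟨k, hk⟩ : ∃ k : ℕ, ω = (η + (2 * k + 1)) ^ 2 := by
    by_contra hne
    push Not at hne
    exact hv0 (h.eq_zero_of_forall_ne N h1 h2 (by simp [hN]) fun k _ => hne k)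
  obtain ⟨j, hj⟩ : ∃ j : ℕ, ω = (-η + (2 * j + 1)) ^ 2 := by
    by_contra hne
    push Not at hne
    exact hv0 (h.symm.eq_zero_of_forall_ne N' h1' h2' (by simp [hN']) fun k _ => hne k)
  have hkj : ((k : ℂ) + j + 1) ≠ 0 := by exact_mod_cast Nat.succ_ne_zero (k + j)
  have hη : η = j - k := by
    have : 4 * ((k : ℂ) + j + 1) * (η - (j - k)) = 0 := by linear_combination hj - hk
    exact sub_eq_zero.1 ((mul_eq_zero.1 this).resolve_left (mul_ne_zero (by norm_num : (4 : ℂ) ≠ 0) hkj))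
  have hA := h.factor_apply_eq_zero N h1 h2 (by simp [hN]) k (by
    intro k' _ hne hk'
    have : 4 * ((k' : ℂ) - k) * (k' + j + 1) = 0 := by
      rw [hη] at hk hk'
      linear_combination hk - hk'
    have h0 : ((k' : ℂ) + j + 1) ≠ 0 := by exact_mod_cast Nat.succ_ne_zero (k' + j)
    have := ((mul_eq_zero.1 this).resolve_right h0)
    have := sub_eq_zero.1 ((mul_eq_zero.1 this).resolve_left (by norm_num : (4 : ℂ) ≠ 0))
    exact hne (by exact_mod_cast this))
  have hB := h.symm.factor_apply_eq_zero N' h1' h2' (by simp [hN']) j (by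
    intro k' _ hne hk'
    have : 4 * ((k' : ℂ) - j) * (k' + k + 1) = 0 := by
      rw [hη] at hj hk'
      linear_combination hj - hk'
    have h0 : ((k' : ℂ) + k + 1) ≠ 0 := by exact_mod_cast Nat.succ_ne_zero (k' + k)
    have := ((mul_eq_zero.1 this).resolve_right h0)
    have := sub_eq_zero.1 ((mul_eq_zero.1 this).resolve_left (by norm_num : (4 : ℂ) ≠ 0))
    exact hne (by exact_mod_cast this))
  refine Submodule.mem_iSup_of_mem ((j : ℤ) - k) (Module.End.mem_eigenspace_iff.2 ?_)
  rw [factor_apply] at hA hB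
  simp only [h.casimir_symm, LinearMap.neg_apply, map_neg, neg_neg] at hB
  have h3 : (4 * ((k : ℂ) + j + 1)) • (H v - ((j : ℂ) - k) • v) = 0 := by
    linear_combination (norm := module) hB - hA
  have := sub_eq_zero.1 ((smul_eq_zero.1 h3).resolve_left (mul_ne_zero (by norm_num : (4 : ℂ) ≠ 0) hkj))
  rw [this]
  push_cast
  rfl

/-- On a vector killed by `X` the Casimir element is `(k + 1)²`. Nilpotency of `Y` then requires `(k
+ 1)² = (-k + 2 j + 1)²` for a natural number `j`, that is `k = j`, against `k < 0`. -/
theorem eq_zero_of_X_apply_eq_zero {k : ℤ} (hk : k < 0) {v : V} (hv : H v = (k : ℂ) • v)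
    (hX : X v = 0) : v = 0 := by
  obtain ⟨N, hN⟩ := h.isNilpotent_Y
  have hC : casimir (-H) Y X v = ((k + 1 : ℂ) ^ 2) • v := by
    have h1 : (H + 1) v = (k + 1 : ℂ) • v := by
      rw [LinearMap.add_apply, hv, Module.End.one_apply, add_smul, one_smul]
    rw [h.casimir_symm, casimir, LinearMap.add_apply, Module.End.mul_apply, Module.End.mul_apply,
      Module.End.mul_apply, hX, map_zero, map_zero, add_zero, h1, map_smul, h1, smul_smul, sq]
  have hH : (-H) v = (-k : ℂ) • v := by rw [LinearMap.neg_apply, hv, neg_smul]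
  have hmem : ∀ {T : Module.End ℂ V} {c : ℂ}, T v = c • v → v ∈ T.maxGenEigenspace c :=
    fun {T c} hT => T.mem_maxGenEigenspace c v |>.2 ⟨1, by simp [hT]⟩
  refine h.symm.eq_zero_of_forall_ne N (hmem hH) (hmem hC) (by simp [hN]) fun j _ hj => ?_
  have : 4 * ((j : ℂ) + 1) * (k - j) = 0 := by linear_combination hj
  have h0 : ((j : ℂ) + 1) ≠ 0 := by exact_mod_cast Nat.succ_ne_zero j
  have := sub_eq_zero.1 ((mul_eq_zero.1 this).resolve_left (mul_ne_zero (by norm_num : (4 : ℂ) ≠ 0) h0))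
  have : k = j := by exact_mod_cast this
  omega

end IsSl2

end Module.End

/-! ### The grading by `ad h` and duality for `χ([·, ·])`. -/

namespace LieSuperalgebra

variable {g : Type w} [AddCommGroup g] [Module ℂ g] (L : LieSuperalgebra g)

/-- The part of parity `p` of the subspace `g(k)`. -/
def piece (h : g) (k : ℤ) (p : ZMod 2) : Submodule ℂ g := L.weightSpace h k ⊓ L.part p

variable {L}

theorem parity_eq_of_add_eq_zero : ∀ {p q : ZMod 2}, p + q = 0 → p = q := by decide

theorem mem_weightSpace {h : g} {k : ℤ} {x : g} :
    x ∈ L.weightSpace h k ↔ L.bracket h x = (k : ℂ) • x := Module.End.mem_eigenspace_iff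

theorem bracket_piece {h : g} (hh : h ∈ L.part 0) {k l : ℤ} {p q : ZMod 2} {x y : g}
    (hx : x ∈ L.piece h k p) (hy : y ∈ L.piece h l q) :
    L.bracket x y ∈ L.piece h (k + l) (p + q) := by
  refine ⟨mem_weightSpace.2 ?_, L.bracket_mem p q x y hx.2 hy.2⟩
  rw [L.jacobi 0 p h x y hh hx.2, mem_weightSpace.1 hx.1, mem_weightSpace.1 hy.1,
    koszulSign_zero_left, one_smul, map_smul, map_smul, LinearMap.smul_apply, ← add_smul]
  push_cast
  rfl

theorem weightSpace_graded {h : g} (hh : h ∈ L.part 0) (k : ℤ) :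
    L.IsGradedSubspace (L.weightSpace h k) := by
  intro x hx
  rw [mem_weightSpace] at hx
  rw [mem_weightSpace, mem_weightSpace, ← (L.bracket_even_left hh x).1,
    ← (L.bracket_even_left hh x).2, hx, map_smul, map_smul]
  exact ⟨rfl, rfl⟩

theorem pieces_iSupIndep (h : g) :
    iSupIndep fun κ : ℤ × ZMod 2 => L.piece h κ.1 κ.2 := by
  -- One operator separates all pieces: it acts on weight `k` and parity `p` by `2 k + p`.
  let T : Module.End ℂ g := (2 : ℂ) • L.bracket h + L.odd
  have hinj : Function.Injective fun κ : ℤ × ZMod 2 => (2 * κ.1 + κ.2.val : ℂ) := by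
    rintro ⟨k, p⟩ ⟨l, q⟩ hkl
    have hkl' : 2 * k + p.val = 2 * l + q.val := by
      simp only at hkl
      exact_mod_cast hkl
    have hp := ZMod.val_lt p
    have hq := ZMod.val_lt q
    have h1 : k = l := by omega
    have h2 : p.val = q.val := by omega
    exact Prod.ext h1 (ZMod.val_injective 2 h2)
  refine (T.eigenspaces_iSupIndep.comp hinj).mono ?_
  rintro ⟨k, p⟩ x hx
  change x ∈ T.eigenspace (2 * (k : ℂ) + p.val)
  rw [Module.End.mem_eigenspace_iff]
  change (2 : ℂ) • L.bracket h x + L.odd x = _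
  rw [mem_weightSpace.1 hx.1, smul_smul, add_smul]
  congr 1
  rcases parity_cases p with rfl | rfl
  · simp [L.odd_of_even hx.2]
  · have : (1 : ZMod 2).val = 1 := rfl
    simp [L.odd_of_odd hx.2, this]

/-- By independence of the pieces, generators from the other pieces cancel in the expansion of `x`.
-/
theorem mem_span_same_piece {h : g} {ι : Type*} {v : ι → g} {k : ι → ℤ}
    {p : ι → ZMod 2} (hv : ∀ i, v i ∈ L.piece h (k i) (p i)) {x : g} {l : ℤ} {q : ZMod 2}
    (hx : x ∈ L.piece h l q) {R : ι → Prop} (hxv : x ∈ Submodule.span ℂ {y | ∃ i, R i ∧ y = v i}) :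
    x ∈ Submodule.span ℂ {y | ∃ i, R i ∧ k i = l ∧ p i = q ∧ y = v i} := by
  have hle : Submodule.span ℂ {y | ∃ i, R i ∧ y = v i} ≤
      Submodule.span ℂ {y | ∃ i, R i ∧ k i = l ∧ p i = q ∧ y = v i} ⊔
        ⨆ (κ : ℤ × ZMod 2) (_ : κ ≠ (l, q)), L.piece h κ.1 κ.2 := by
    rw [Submodule.span_le]
    rintro _ ⟨i, hi, rfl⟩
    by_cases hκ : (k i, p i) = (l, q)
    · rw [Prod.mk.injEq] at hκ
      exact Submodule.mem_sup_left (Submodule.subset_span ⟨i, hi, hκ.1, hκ.2, rfl⟩)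
    · exact Submodule.mem_sup_right (Submodule.mem_iSup_of_mem (k i, p i)
        (Submodule.mem_iSup_of_mem hκ (hv i)))
  obtain ⟨a, ha, b, hb, hab⟩ := Submodule.mem_sup.1 (hle hxv)
  have ha' : a ∈ L.piece h l q := by
    refine (Submodule.span_le.2 ?_ : Submodule.span ℂ _ ≤ L.piece h l q) ha
    rintro _ ⟨i, -, rfl, rfl, rfl⟩
    exact hv i
  have hb0 : b = 0 := by
    refine Submodule.disjoint_def.1 (pieces_iSupIndep h (l, q)) b ?_ hb
    have : b = x - a := by rw [← hab]; abel
    rw [this]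
    exact sub_mem hx ha'
  rwa [← hab, hb0, add_zero]

theorem exists_homogeneous_basis [FiniteDimensional ℂ g] {h : g} (S : Submodule ℂ g)
    (R : ℤ → Prop)
    (hS : S ≤ Submodule.span ℂ {x | x ∈ S ∧ ∃ k q, R k ∧ x ∈ L.piece h k q}) :
    ∃ (n : ℕ) (x : Fin n → g) (k : Fin n → ℤ) (q : Fin n → ZMod 2), LinearIndependent ℂ x ∧
      (∀ i, x i ∈ S) ∧ (∀ i, R (k i) ∧ x i ∈ L.piece h (k i) (q i)) ∧
      S ≤ Submodule.span ℂ (Set.range x) := by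
  obtain ⟨b, hb, hspan, hind⟩ := exists_linearIndependent ℂ
    {x | x ∈ S ∧ ∃ k q, R k ∧ x ∈ L.piece h k q}
  have hfin : Finite b := hind.finite
  let E := (Finite.equivFin b).symm
  have hmem : ∀ i, ((E i : b) : g) ∈ S ∧ ∃ k q, R k ∧ ((E i : b) : g) ∈ L.piece h k q :=
    fun i => hb (E i).2
  choose k q hkq using fun i => (hmem i).2
  refine ⟨_, fun i => ((E i : b) : g), k, q, hind.comp _ E.injective, fun i => (hmem i).1, hkq, ?_⟩
  have : Set.range (fun i => ((E i : b) : g)) = b := by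
    rw [Set.range_comp' (Subtype.val) E, E.range_eq_univ, Set.image_univ, Subtype.range_coe]
  rw [this, hspan]
  exact hS

namespace WDatum

variable {B : LinearMap.BilinForm ℂ g} {e : g} (D : L.WDatum B e) (he : e ∈ L.part 0)

include he in
theorem isSl2 : Module.End.IsSl2 (L.bracket D.h) (L.bracket e) (L.bracket D.f) where
  HX := LinearMap.ext fun z => by
    rw [two_mul]
    change L.bracket D.h (L.bracket e z) - L.bracket e (L.bracket D.h z) =
      L.bracket e z + L.bracket e z
    rw [L.jacobi 0 0 D.h e z D.h_mem he, D.bracket_h_e, koszulSign_zero_left, one_smul,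
      add_sub_cancel_right, map_smul, LinearMap.smul_apply, two_smul]
  HY := LinearMap.ext fun z => by
    rw [two_mul]
    change L.bracket D.h (L.bracket D.f z) - L.bracket D.f (L.bracket D.h z) =
      -(L.bracket D.f z + L.bracket D.f z)
    rw [L.jacobi 0 0 D.h D.f z D.h_mem D.f_mem, D.bracket_h_f, koszulSign_zero_left, one_smul,
      add_sub_cancel_right, map_smul, LinearMap.smul_apply, neg_smul, two_smul]
  XY := LinearMap.ext fun z => by
    change L.bracket e (L.bracket D.f z) - L.bracket D.f (L.bracket e z) = L.bracket D.h z
    rw [L.jacobi 0 0 e D.f z he D.f_mem, D.bracket_e_f, koszulSign_zero_left, one_smul,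
      add_sub_cancel_right]

section

variable (hB : L.IsBasicForm B)

include hB he in
-- Invariance gives `k χ(x) = (e, [h, x]) = ([e, h], x) = -2 χ(x)`, and an even form pairs `e`
-- trivially with odd vectors.
theorem chi_eq_zero {k : ℤ} {q : ZMod 2} (hkq : k ≠ -2 ∨ q ≠ 0) {x : g}
    (hx : x ∈ L.piece D.h k q) : B e x = 0 := by
  rcases hkq with hk | hq
  · have h1 := hB.invariant e D.h x
    rw [L.skew 0 0 e D.h he D.h_mem, D.bracket_h_e, mem_weightSpace.1 hx.1, koszulSign_zero_left,
      one_smul] at h1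
    simp only [map_neg, map_smul, LinearMap.neg_apply, LinearMap.smul_apply, smul_eq_mul] at h1
    have h2 : ((k : ℂ) + 2) * B e x = 0 := by linear_combination -h1
    refine (mul_eq_zero.1 h2).resolve_left fun h0 => hk ?_
    have : (k : ℂ) = ((-2 : ℤ) : ℂ) := by push_cast; linear_combination h0
    exact_mod_cast this
  · have hq1 : q = 1 := (parity_cases q).resolve_left hq
    exact hB.even _ _ he (hq1 ▸ hx.2)

include hB in
theorem bracket_eq_zero_of_chi {x : g} (h : ∀ y, B e (L.bracket x y) = 0) :
    L.bracket e x = 0 :=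
  hB.nondegenerate.1 _ fun y => by rw [hB.invariant]; exact h y

variable [FiniteDimensional ℂ g] (hnil : IsNilpotent (L.bracket e : Module.End ℂ g))

include he

theorem eq_zero_of_bracket_eq_zero {k : ℤ} (hk : k < 0) {x : g} (hx : x ∈ L.weightSpace D.h k)
    (h0 : L.bracket e x = 0) : x = 0 :=
  (D.isSl2 he).eq_zero_of_X_apply_eq_zero hk (mem_weightSpace.1 hx) h0

include hnil

theorem iSup_weightSpace : ⨆ k : ℤ, L.weightSpace D.h k = ⊤ :=
  (D.isSl2 he).iSup_eigenspace_eq_top hnil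

theorem le_span_homogeneous {S : Submodule ℂ g} (hgr : L.IsGradedSubspace S)
    (hh : ∀ x ∈ S, L.bracket D.h x ∈ S) :
    S ≤ Submodule.span ℂ {x | x ∈ S ∧ ∃ k q, x ∈ L.piece D.h k q} := by
  have htop : ⨆ μ : ℂ, Module.End.genEigenspace (L.bracket D.h) μ 1 = ⊤ := by
    rw [eq_top_iff, ← D.iSup_weightSpace he hnil]
    exact iSup_le fun k => le_iSup (fun μ : ℂ => Module.End.genEigenspace (L.bracket D.h) μ 1)
      (k : ℂ)
  have h1 := Submodule.eq_iSup_inf_genEigenspace (p := S) 1 hh htop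
  conv_lhs => rw [h1]
  rw [iSup_le_iff]
  rintro μ x ⟨hxS, hxμ⟩
  by_cases hμ : ∃ k : ℤ, μ = k
  · obtain ⟨k, rfl⟩ := hμ
    have h2 := weightSpace_graded D.h_mem k x hxμ
    rw [← L.even_add_odd x]
    exact add_mem (Submodule.subset_span ⟨(hgr x hxS).1, k, 0, h2.1, L.even_mem x⟩)
      (Submodule.subset_span ⟨(hgr x hxS).2, k, 1, h2.2, L.odd_mem x⟩)
  · have h3 : x = 0 := by
      refine Submodule.disjoint_def.1
        (Module.End.eigenspaces_iSupIndep (L.bracket D.h) μ) x hxμ ?_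
      have : (⊤ : Submodule ℂ g) ≤ ⨆ (ν : ℂ) (_ : ν ≠ μ), Module.End.eigenspace (L.bracket D.h) ν := by
        rw [← D.iSup_weightSpace he hnil]
        exact iSup_le fun k => le_iSup₂_of_le (k : ℂ) (fun h => hμ ⟨k, h.symm⟩) le_rfl
      exact this Submodule.mem_top
    rw [h3]
    exact Submodule.zero_mem _

theorem piece_induction {P : g → Prop} (h : ∀ k q, ∀ x ∈ L.piece D.h k q, P x)
    (hadd : ∀ x y, P x → P y → P (x + y)) (x : g) : P x := by
  have hx := D.le_span_homogeneous he hnil (S := ⊤) (fun _ _ => ⟨trivial, trivial⟩)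
    (fun _ _ => trivial) (show x ∈ (⊤ : Submodule ℂ g) from trivial)
  have h0 : P 0 := h 0 0 0 (Submodule.zero_mem _)
  refine Submodule.span_induction (p := fun x _ => ∀ c : ℂ, P (c • x)) ?_ ?_ ?_ ?_ hx 1 |>
    (one_smul ℂ x ▸ ·)
  · rintro x ⟨-, k, q, hx⟩ c
    exact h k q _ (Submodule.smul_mem _ c hx)
  · intro c; rwa [smul_zero]
  · intro x y _ _ hx hy c
    rw [smul_add]
    exact hadd _ _ (hx c) (hy c)
  · intro a x _ hx c
    rw [smul_smul]
    exact hx _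

include hB

/-- Against a single piece only the component of `y` of complementary weight and equal parity
matters, so test vectors may be taken homogeneous. -/
theorem exists_component (k : ℤ) (q : ZMod 2) (y : g) : ∃ y' ∈ L.piece D.h (-2 - k) q,
    ∀ x ∈ L.piece D.h k q, B e (L.bracket x y') = B e (L.bracket x y) := by
  refine D.piece_induction he hnil (P := fun y => ∃ y' ∈ L.piece D.h (-2 - k) q,
    ∀ x ∈ L.piece D.h k q, B e (L.bracket x y') = B e (L.bracket x y)) ?_ ?_ y
  · intro l r y hy
    by_cases hlr : l = -2 - k ∧ r = q
    · exact ⟨y, hlr.1 ▸ hlr.2 ▸ hy, fun _ _ => rfl⟩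
    · refine ⟨0, Submodule.zero_mem _, fun x hx => ?_⟩
      rw [map_zero, map_zero, D.chi_eq_zero he hB ?_ (bracket_piece D.h_mem hx hy)]
      by_contra hcon
      push Not at hcon
      exact hlr ⟨by omega, (parity_eq_of_add_eq_zero hcon.2).symm⟩
  · rintro a b ⟨a', ha', ha⟩ ⟨b', hb', hb⟩
    exact ⟨a' + b', add_mem ha' hb', fun x hx => by rw [map_add, map_add, map_add, map_add, ha x hx, hb x hx]⟩

/-- A relation between the functionals `χ([x_i, ·])` restricts to each piece and gives there a
vector `z` of negative weight with `χ([z, ·]) = 0`. Then `[e, z] = 0` by nondegeneracy and `z = 0`,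
because `ad e` is injective in negative weights. So the functionals are independent, and dual
vectors exist. -/
theorem exists_dual {n : ℕ} {x : Fin n → g} {k : Fin n → ℤ} {q : Fin n → ZMod 2}
    (hx : LinearIndependent ℂ x) (hxk : ∀ i, k i < 0 ∧ x i ∈ L.piece D.h (k i) (q i)) :
    ∃ y : Fin n → g, (∀ j, y j ∈ L.piece D.h (-2 - k j) (q j)) ∧
      ∀ i j, B e (L.bracket (x i) (y j)) = if i = j then 1 else 0 := by
  have hne : ∀ i j, (k i, q i) ≠ (k j, q j) → ∀ y ∈ L.piece D.h (-2 - k j) (q j),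
      B e (L.bracket (x i) y) = 0 := by
    intro i j hij y hy
    refine D.chi_eq_zero he hB ?_ (bracket_piece D.h_mem (hxk i).2 hy)
    by_contra hcon
    push Not at hcon
    exact hij (Prod.ext (by simp only; omega) (parity_eq_of_add_eq_zero hcon.2))
  let T : g →ₗ[ℂ] (Fin n → ℂ) := LinearMap.pi fun i => (B e) ∘ₗ L.bracket (x i)
  have hT : LinearMap.range T = ⊤ := by
    by_contra hcon
    obtain ⟨f, hf0, hf⟩ := Submodule.exists_le_ker_of_lt_top _ (lt_top_iff_ne_top.2 hcon)
    refine hf0 ?_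
    have hfs : ∀ w, f w = ∑ i, w i * f (fun j => if i = j then 1 else 0) := fun w => by
      simpa using f.pi_apply_eq_sum_univ w
    have hα : ∀ j, f (fun i => if j = i then 1 else 0) = 0 := by
      intro j
      -- The part of the relation `f` that lives in the piece of `x j`.
      let z : g := ∑ i, if (k i, q i) = (k j, q j) then
        f (fun l => if i = l then 1 else 0) • x i else 0
      have hz : z ∈ L.piece D.h (k j) (q j) := by
        refine Submodule.sum_mem _ fun i _ => ?_
        split_ifs with h
        · rw [Prod.mk.injEq] at h
          exact Submodule.smul_mem _ _ (h.1 ▸ h.2 ▸ (hxk i).2)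
        · exact Submodule.zero_mem _
      have hz0 : ∀ y, B e (L.bracket z y) = 0 := by
        intro y
        obtain ⟨y', hy', hyy⟩ := D.exists_component he hB hnil (k j) (q j) y
        rw [← hyy z hz]
        have h1 : f (T y') = 0 := hf ⟨y', rfl⟩
        rw [hfs] at h1
        rw [map_sum, LinearMap.sum_apply, map_sum]
        refine Eq.trans ?_ h1
        refine Finset.sum_congr rfl fun i _ => ?_
        change _ = B e (L.bracket (x i) y') * _
        split_ifs with h
        · rw [map_smul, LinearMap.smul_apply, map_smul, smul_eq_mul, mul_comm]
        · rw [map_zero, LinearMap.zero_apply, map_zero, hne i j h y' hy', zero_mul]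
      have hz1 : z = 0 := D.eq_zero_of_bracket_eq_zero he (hxk j).1 hz.1
        (bracket_eq_zero_of_chi hB hz0)
      have h2 := Fintype.linearIndependent_iff.1 hx
        (fun i => if (k i, q i) = (k j, q j) then f (fun l => if i = l then 1 else 0) else 0) (by
          rw [← hz1]
          refine Finset.sum_congr rfl fun i _ => ?_
          split_ifs <;> simp) j
      simpa using h2
    refine LinearMap.ext fun w => ?_
    rw [hfs]
    simp [hα]
  have hex : ∀ j, ∃ y ∈ L.piece D.h (-2 - k j) (q j),
      ∀ i, B e (L.bracket (x i) y) = if i = j then 1 else 0 := by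
    intro j
    obtain ⟨y, hy⟩ := LinearMap.range_eq_top.1 hT (fun i => if i = j then 1 else 0)
    obtain ⟨y', hy', hyy⟩ := D.exists_component he hB hnil (k j) (q j) y
    refine ⟨y', hy', fun i => ?_⟩
    by_cases hij : (k i, q i) = (k j, q j)
    · rw [Prod.mk.injEq] at hij
      rw [hyy (x i) (hij.1 ▸ hij.2 ▸ (hxk i).2)]
      exact congrFun hy i
    · rw [hne i j hij y' hy', if_neg]
      rintro rfl
      exact hij rfl
  choose y hy hxy using hex
  exact ⟨y, hy, fun i j => hxy j i⟩

end

end WDatum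

end LieSuperalgebra

/-! ### The subspaces `𝔪` and `𝔪'` and bases adapted to them. -/

namespace LieSuperalgebra.WDatum

variable {g : Type w} [AddCommGroup g] [Module ℂ g] {L : LieSuperalgebra g}
  {B : LinearMap.BilinForm ℂ g} {e : g} (D : L.WDatum B e)

theorem m_le_m' : D.m ≤ D.m' := le_sup_left

theorem weightSpace_le_m {k : ℤ} (hk : k ≤ -2) : L.weightSpace D.h k ≤ D.m :=
  le_sup_of_le_left (le_sup_of_le_left
    (le_iSup (fun k : {k : ℤ // k ≤ -2} => L.weightSpace D.h k) ⟨k, hk⟩))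

/-- Homogeneous generators of `𝔪`. -/
def mGens : Set g := {x | ∃ k q, k ≤ -2 ∧ x ∈ L.piece D.h k q} ∪
  {x | ∃ i : Fin (2 * D.s), D.s ≤ (i : ℕ) ∧ x = D.u i} ∪
  {x | ∃ i : Fin D.r, D.r ≤ 2 * (i : ℕ) ∧ x = D.v i}

/-- Homogeneous generators of `𝔪'`. -/
def m'Gens : Set g := {x | ∃ k q, k ≤ -2 ∧ x ∈ L.piece D.h k q} ∪
  {x | ∃ i : Fin (2 * D.s), D.s ≤ (i : ℕ) ∧ x = D.u i} ∪
  {x | ∃ i : Fin D.r, D.r ≤ 2 * (i : ℕ) + 1 ∧ x = D.v i}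

theorem m_eq_span : D.m = Submodule.span ℂ D.mGens := by
  apply le_antisymm
  · refine sup_le (sup_le (iSup_le ?_) ?_) ?_
    · rintro ⟨k, hk⟩ x hx
      have h := weightSpace_graded D.h_mem k x hx
      rw [← L.even_add_odd x]
      exact add_mem (Submodule.subset_span (Or.inl (Or.inl ⟨k, 0, hk, h.1, L.even_mem x⟩)))
        (Submodule.subset_span (Or.inl (Or.inl ⟨k, 1, hk, h.2, L.odd_mem x⟩)))
    · exact Submodule.span_mono fun x hx => Or.inl (Or.inr hx)
    · exact Submodule.span_mono fun x hx => Or.inr hx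
  · rw [Submodule.span_le]
    rintro x ((⟨k, q, hk, hx⟩ | hx) | hx)
    · exact D.weightSpace_le_m hk hx.1
    · exact Submodule.mem_sup_left (Submodule.mem_sup_right (Submodule.subset_span hx))
    · exact Submodule.mem_sup_right (Submodule.subset_span hx)

theorem m'_eq_span : D.m' = Submodule.span ℂ D.m'Gens := by
  apply le_antisymm
  · rw [m', m_eq_span]
    refine sup_le (Submodule.span_mono ?_) (Submodule.span_mono ?_)
    · rintro x ((hx | hx) | ⟨i, hi, hx⟩)
      · exact Or.inl (Or.inl hx)
      · exact Or.inl (Or.inr hx)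
      · exact Or.inr ⟨i, by omega, hx⟩
    · rintro x ⟨i, hi, hx⟩
      exact Or.inr ⟨i, by omega, hx⟩
  · rw [Submodule.span_le]
    rintro x ((hx | hx) | ⟨i, hi, hx⟩)
    · exact D.m_le_m' (D.m_eq_span ▸ Submodule.subset_span (Or.inl (Or.inl hx)))
    · exact D.m_le_m' (D.m_eq_span ▸ Submodule.subset_span (Or.inl (Or.inr hx)))
    · by_cases h : D.r ≤ 2 * (i : ℕ)
      · exact D.m_le_m' (D.m_eq_span ▸ Submodule.subset_span (Or.inr ⟨i, h, hx⟩))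
      · exact Submodule.mem_sup_right (Submodule.subset_span ⟨i, by omega, hx⟩)

theorem u_mem (i : Fin (2 * D.s)) : (D.u i : g) ∈ L.piece D.h (-1) 0 := (D.u i).2

theorem v_mem (i : Fin D.r) : (D.v i : g) ∈ L.piece D.h (-1) 1 := (D.v i).2

theorem mGens_homogeneous {x : g} (hx : x ∈ D.mGens) : ∃ k q, k < 0 ∧ x ∈ L.piece D.h k q := by
  rcases hx with (⟨k, q, hk, hx⟩ | ⟨i, -, rfl⟩) | ⟨i, -, rfl⟩
  · exact ⟨k, q, by omega, hx⟩
  · exact ⟨-1, 0, by omega, D.u_mem i⟩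
  · exact ⟨-1, 1, by omega, D.v_mem i⟩

theorem m'Gens_homogeneous {x : g} (hx : x ∈ D.m'Gens) :
    ∃ k q, k < 0 ∧ x ∈ L.piece D.h k q := by
  rcases hx with (⟨k, q, hk, hx⟩ | ⟨i, -, rfl⟩) | ⟨i, -, rfl⟩
  · exact ⟨k, q, by omega, hx⟩
  · exact ⟨-1, 0, by omega, D.u_mem i⟩
  · exact ⟨-1, 1, by omega, D.v_mem i⟩

theorem m_le_span_homogeneous : D.m ≤
    Submodule.span ℂ {x | x ∈ D.m ∧ ∃ k q, k < 0 ∧ x ∈ L.piece D.h k q} := by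
  conv_lhs => rw [m_eq_span]
  exact Submodule.span_mono fun x hx =>
    ⟨D.m_eq_span ▸ Submodule.subset_span hx, D.mGens_homogeneous hx⟩

theorem m'_le_span_homogeneous : D.m' ≤
    Submodule.span ℂ {x | x ∈ D.m' ∧ ∃ k q, k < 0 ∧ x ∈ L.piece D.h k q} := by
  conv_lhs => rw [m'_eq_span]
  exact Submodule.span_mono fun x hx =>
    ⟨D.m'_eq_span ▸ Submodule.subset_span hx, D.m'Gens_homogeneous hx⟩

/-- Weights in `𝔪'` are at most `-1`, so brackets have weight at most `-2`, where `𝔪` is everything.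
-/
theorem bracket_mem_m {x y : g} (hx : x ∈ D.m') (hy : y ∈ D.m') : L.bracket x y ∈ D.m := by
  rw [m'_eq_span] at hx hy
  induction hx using Submodule.span_induction with
  | mem x hx =>
    induction hy using Submodule.span_induction with
    | mem y hy =>
      obtain ⟨k, q, hk, hx⟩ := D.m'Gens_homogeneous hx
      obtain ⟨l, r, hl, hy⟩ := D.m'Gens_homogeneous hy
      exact D.weightSpace_le_m (by omega) (bracket_piece D.h_mem hx hy).1
    | zero => rw [map_zero]; exact zero_mem _
    | add y z _ _ hy hz => rw [map_add]; exact add_mem hy hz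
    | smul c y _ hy => rw [map_smul]; exact Submodule.smul_mem _ c hy
  | zero => rw [map_zero]; exact zero_mem _
  | add y z _ _ hy hz => rw [map_add]; exact add_mem hy hz
  | smul c y _ hy => rw [map_smul]; exact Submodule.smul_mem _ c hy

variable (he : e ∈ L.part 0) (hB : L.IsBasicForm B)

include hB he

/-- Only two vectors of `g(-1)` could pair nontrivially, and the selected indices are too large for
their sum to hit the antidiagonal. The middle `v` for odd `r` pairs with itself, which is why one
argument has to be in `𝔪` rather than `𝔪'`. -/
theorem chi_bracket_eq_zero {x y : g} (hx : x ∈ D.m') (hy : y ∈ D.m) :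
    B e (L.bracket x y) = 0 := by
  rw [m'_eq_span] at hx
  rw [m_eq_span] at hy
  induction hx using Submodule.span_induction with
  | mem x hx =>
    induction hy using Submodule.span_induction with
    | mem y hy =>
      obtain ⟨k, q, hk, hxk⟩ := D.m'Gens_homogeneous hx
      obtain ⟨l, r, hl, hyl⟩ := D.mGens_homogeneous hy
      rcases hx with (⟨k, q, hk, hx⟩ | ⟨i, hi, rfl⟩) | ⟨i, hi, rfl⟩
      · exact D.chi_eq_zero he hB (Or.inl (by omega)) (bracket_piece D.h_mem hx hyl)
      · rcases hy with (⟨l, r, hl, hy⟩ | ⟨j, hj, rfl⟩) | ⟨j, hj, rfl⟩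
        · exact D.chi_eq_zero he hB (Or.inl (by omega)) (bracket_piece D.h_mem hxk hy)
        · rw [D.pairing_u, if_neg (by omega)]
        · exact D.chi_eq_zero he hB (Or.inr (by decide))
            (bracket_piece D.h_mem (D.u_mem i) (D.v_mem j))
      · rcases hy with (⟨l, r, hl, hy⟩ | ⟨j, hj, rfl⟩) | ⟨j, hj, rfl⟩
        · exact D.chi_eq_zero he hB (Or.inl (by omega)) (bracket_piece D.h_mem hxk hy)
        · exact D.chi_eq_zero he hB (Or.inr (by decide))
            (bracket_piece D.h_mem (D.v_mem i) (D.u_mem j))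
        · rw [D.pairing_v, if_neg (by omega)]
    | zero => simp
    | add y z _ _ hy hz => rw [map_add, map_add, hy, hz, add_zero]
    | smul c y _ hy => rw [map_smul, map_smul, hy, smul_zero]
  | zero => simp
  | add y z _ _ hy hz => rw [map_add, LinearMap.add_apply, map_add, hy, hz, add_zero]
  | smul c y _ hy => rw [map_smul, LinearMap.smul_apply, map_smul, hy, smul_zero]

omit hB he in
-- Pairing with the basis vector at the mirrored index reads off a coefficient, and the mirror of an
-- index outside `𝔪` is an index of `𝔪'`. For odd `r` the middle index is its own mirror, so `𝔪'` is
-- needed.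
theorem mem_m_of_orthogonal {q : ZMod 2} {y : g} (hy : y ∈ L.piece D.h (-1) q)
    (h : ∀ x ∈ D.m', B e (L.bracket x y) = 0) : y ∈ D.m := by
  rcases parity_cases q with rfl | rfl
  · have hsum : y = ∑ i, D.u.repr ⟨y, hy⟩ i • (D.u i : g) := by
      conv_lhs => rw [show y = ((⟨y, hy⟩ : ↥(L.weightSpace D.h (-1) ⊓ L.part 0)) : g) from rfl,
        ← D.u.sum_repr ⟨y, hy⟩]
      push_cast
      rfl
    generalize D.u.repr ⟨y, hy⟩ = α at hsum
    have hα : ∀ i : Fin (2 * D.s), (i : ℕ) < D.s → α i = 0 := by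
      intro i hi
      let j : Fin (2 * D.s) := ⟨2 * D.s - 1 - i, by omega⟩
      have h1 := h (D.u j) (D.m'_eq_span ▸ Submodule.subset_span
        (Or.inl (Or.inr ⟨j, by simp only [j]; omega, rfl⟩)))
      rw [hsum, map_sum, map_sum, Finset.sum_eq_single i] at h1
      · rw [map_smul, map_smul, D.pairing_u, if_pos (by simp only [j]; omega),
          if_neg (by simp only [j]; omega)] at h1
        simpa using h1
      · intro l _ hl
        have hl' : (l : ℕ) ≠ i := fun h => hl (Fin.ext h)
        rw [map_smul, map_smul, D.pairing_u, if_neg (by simp only [j]; omega), smul_zero]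
      · simp
    rw [hsum]
    refine Submodule.sum_mem _ fun i _ => ?_
    by_cases hi : (i : ℕ) < D.s
    · rw [hα i hi, zero_smul]; exact zero_mem _
    · exact Submodule.smul_mem _ _ (D.m_eq_span ▸ Submodule.subset_span
        (Or.inl (Or.inr ⟨i, by omega, rfl⟩)))
  · have hsum : y = ∑ i, D.v.repr ⟨y, hy⟩ i • (D.v i : g) := by
      conv_lhs => rw [show y = ((⟨y, hy⟩ : ↥(L.weightSpace D.h (-1) ⊓ L.part 1)) : g) from rfl,
        ← D.v.sum_repr ⟨y, hy⟩]
      push_cast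
      rfl
    generalize D.v.repr ⟨y, hy⟩ = α at hsum
    have hα : ∀ i : Fin D.r, 2 * (i : ℕ) < D.r → α i = 0 := by
      intro i hi
      let j : Fin D.r := ⟨D.r - 1 - i, by omega⟩
      have h1 := h (D.v j) (D.m'_eq_span ▸ Submodule.subset_span
        (Or.inr ⟨j, by simp only [j]; omega, rfl⟩))
      rw [hsum, map_sum, map_sum, Finset.sum_eq_single i] at h1
      · rw [map_smul, map_smul, D.pairing_v, if_pos (by simp only [j]; omega)] at h1
        simpa using h1
      · intro l _ hl
        have hl' : (l : ℕ) ≠ i := fun h => hl (Fin.ext h)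
        rw [map_smul, map_smul, D.pairing_v, if_neg (by simp only [j]; omega), smul_zero]
      · simp
    rw [hsum]
    refine Submodule.sum_mem _ fun i _ => ?_
    by_cases hi : 2 * (i : ℕ) < D.r
    · rw [hα i hi, zero_smul]; exact zero_mem _
    · exact Submodule.smul_mem _ _ (D.m_eq_span ▸ Submodule.subset_span
        (Or.inr ⟨i, by omega, rfl⟩))

variable [FiniteDimensional ℂ g] (hnil : IsNilpotent (L.bracket e : Module.End ℂ g))

include hnil

/-- For `y` of nonnegative weight, `χ([y, x]) ≠ 0` forces `x` into weight at most `-2`, hence into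
`𝔪'`. So `y` is orthogonal to everything, and nondegeneracy applies. -/
theorem bracket_eq_zero_of_orthogonal {k : ℤ} (hk : 0 ≤ k) {q : ZMod 2} {y : g}
    (hy : y ∈ L.piece D.h k q) (h : ∀ x ∈ D.m', B e (L.bracket x y) = 0) :
    L.bracket e y = 0 := by
  refine bracket_eq_zero_of_chi hB fun x => ?_
  refine D.piece_induction he hnil (P := fun x => B e (L.bracket y x) = 0) ?_
    (fun a b ha hb => by rw [map_add, map_add, ha, hb, add_zero]) x
  intro l r x hx
  by_cases hl : l ≤ -2
  · rw [L.skew q r y x hy.2 hx.2, map_neg, map_smul, h x (D.m_le_m' (D.weightSpace_le_m hl hx.1)),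
      smul_zero, neg_zero]
  · exact D.chi_eq_zero he hB (Or.inl (by omega)) (bracket_piece D.h_mem hy hx)

omit hB he hnil [FiniteDimensional ℂ g] in
/-- A homogeneous basis `c` of a complement of `𝔪`, consisting of a basis of `g_e`, with indices
`j ≥ a`, and of vectors dual to a homogeneous basis `x` of `𝔪'`, with indices `j < a`. The
Kazhdan degree of `c j` is `d j`. -/
structure Frame where
  n : ℕ
  a : ℕ
  c : Fin n → g
  x : Fin n → g
  d : Fin n → ℕ
  p : Fin n → ZMod 2
  d_pos : ∀ j, 1 ≤ d j
  c_mem : ∀ j, c j ∈ L.piece D.h ((d j : ℤ) - 2) (p j)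
  x_mem : ∀ i, i.1 < a → x i ∈ L.piece D.h (-(d i : ℤ)) (p i)
  x_mem_m' : ∀ i, i.1 < a → x i ∈ D.m'
  m'_le : D.m' ≤ Submodule.span ℂ {y | ∃ i : Fin n, i.1 < a ∧ y = x i}
  pair : ∀ i j, i.1 < a → B e (L.bracket (x i) (c j)) = if i = j then 1 else 0
  two_le : ∀ j, ¬ j.1 < a → 2 ≤ d j
  bracket_c : ∀ j, ¬ j.1 < a → L.bracket e (c j) = 0
  ker_le : LinearMap.ker (L.bracket e) ≤ Submodule.span ℂ {y | ∃ j : Fin n, ¬ j.1 < a ∧ y = c j}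
  exists_sub_mem : ∀ (k : ℤ) (q : ZMod 2), ∀ v ∈ L.piece D.h k q, ∃ μ ∈ D.m, μ ∈ L.piece D.h k q ∧
    v - μ ∈ Submodule.span ℂ {y | ∃ j, (d j : ℤ) - 2 = k ∧ p j = q ∧ y = c j}
  eq_zero_of_sum_mem : ∀ α : Fin n → ℂ, ∑ j, α j • c j ∈ D.m → α = 0

/-- Take a homogeneous basis `x` of `𝔪'`, dual vectors `y`, and a homogeneous basis `z` of `g_e`. A
vector of weight at least `-1`, corrected by the `y_i`, becomes orthogonal to `𝔪'`, hence lies in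
`𝔪` in weight `-1` and in `g_e` in weight at least `0`; lower weights are in `𝔪` anyway. For
independence modulo `𝔪`, pairing with `x_i` isolates the coefficient of `y_i`, and `𝔪` meets `g_e`
in zero. -/
theorem exists_frame : Nonempty D.Frame := by
  obtain ⟨a, x, k, q, hx, hxm, hxk, hxs⟩ := exists_homogeneous_basis (h := D.h) D.m' (fun k => k < 0)
    D.m'_le_span_homogeneous
  obtain ⟨y, hy, hxy⟩ := D.exists_dual he hB hnil hx hxk
  have hker : LinearMap.ker (L.bracket e) ≤ Submodule.span ℂ
      {x | x ∈ LinearMap.ker (L.bracket e) ∧ ∃ k q, 0 ≤ k ∧ x ∈ L.piece D.h k q} := by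
    refine (D.le_span_homogeneous he hnil (S := LinearMap.ker (L.bracket e)) ?_ ?_).trans ?_
    · intro z hz
      have hz' : L.bracket e z = 0 := hz
      refine ⟨?_, ?_⟩
      · change L.bracket e (L.even z) = 0
        rw [← (L.bracket_even_left he z).1, hz', map_zero]
      · change L.bracket e (L.odd z) = 0
        rw [← (L.bracket_even_left he z).2, hz', map_zero]
    · intro z hz
      have hz' : L.bracket e z = 0 := hz
      change L.bracket e (L.bracket D.h z) = 0
      rw [L.jacobi 0 0 e D.h z he D.h_mem, L.skew 0 0 e D.h he D.h_mem, D.bracket_h_e, hz',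
        koszulSign_zero_left]
      simp [hz']
    · rw [Submodule.span_le]
      rintro z ⟨hz, l, r, hzl⟩
      by_cases hl : 0 ≤ l
      · exact Submodule.subset_span ⟨hz, l, r, hl, hzl⟩
      · rw [D.eq_zero_of_bracket_eq_zero he (by omega) hzl.1 hz]
        exact zero_mem _
  obtain ⟨b, z, l, r, hz, hze, hzl, hzs⟩ := exists_homogeneous_basis (h := D.h) _ (fun k => 0 ≤ k) hker
  have hze' : ∀ j, L.bracket e (z j) = 0 := hze
  have hxz : ∀ i j, B e (L.bracket (x i) (z j)) = 0 := by
    intro i j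
    rw [L.skew (q i) (r j) _ _ (hxk i).2.2 (hzl j).2.2, map_neg, map_smul, ← hB.invariant, hze']
    simp
  have hmz : ∀ z ∈ D.m, L.bracket e z = 0 → z = 0 := by
    intro z hz hz0
    obtain ⟨β, rfl⟩ := (Submodule.mem_span_range_iff_exists_fun ℂ).1 (hxs (D.m_le_m' hz))
    refine Finset.sum_eq_zero fun j _ => ?_
    have h1 := hB.invariant e (∑ i, β i • x i) (y j)
    rw [hz0, map_zero, LinearMap.zero_apply, map_sum, LinearMap.sum_apply, map_sum,
      Finset.sum_eq_single j] at h1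
    · rw [map_smul, LinearMap.smul_apply, map_smul, hxy, if_pos rfl, smul_eq_mul, mul_one] at h1
      rw [← h1, zero_smul]
    · intro i _ hi
      rw [map_smul, LinearMap.smul_apply, map_smul, hxy, if_neg hi, smul_zero]
    · simp
  let c : Fin (a + b) → g := Fin.append y z
  -- Kazhdan degree is weight plus two; the vector dual to `x i` has weight `-2 - k i`.
  let d : Fin (a + b) → ℕ := Fin.append (fun i => (-k i).toNat) (fun j => (l j + 2).toNat)
  let p : Fin (a + b) → ZMod 2 := Fin.append q r
  have hcases : ∀ {P : Fin (a + b) → Prop}, (∀ i, P (Fin.castAdd b i)) → (∀ j, P (Fin.natAdd a j)) →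
    ∀ i, P i := fun h1 h2 i => Fin.addCases h1 h2 i
  have hc : ∀ j, c j ∈ L.piece D.h ((d j : ℤ) - 2) (p j) := by
    refine hcases (fun i => ?_) fun j => ?_
    · have h1 := hy i
      have h2 := (hxk i).1
      simp only [c, d, p, Fin.append_left]
      rwa [show (((-k i).toNat : ℕ) : ℤ) - 2 = -2 - k i by omega]
    · have h1 := (hzl j).2
      have h2 := (hzl j).1
      simp only [c, d, p, Fin.append_right]
      rwa [show (((l j + 2).toNat : ℕ) : ℤ) - 2 = l j by omega]
  refine ⟨{
    n := a + b
    a := a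
    c := c
    -- The zeros are padding at the indices of `g_e`; all conditions on `x` are restricted to
    -- indices below `a`.
    x := Fin.append x 0
    d := d
    p := p
    d_pos := ?_
    c_mem := hc
    x_mem := ?_
    x_mem_m' := ?_
    m'_le := ?_
    pair := ?_
    two_le := ?_
    bracket_c := ?_
    ker_le := ?_
    exists_sub_mem := ?_
    eq_zero_of_sum_mem := ?_ }⟩
  · refine hcases (fun i => ?_) fun j => ?_
    · have := (hxk i).1; simp only [d, Fin.append_left]; omega
    · have := (hzl j).1; simp only [d, Fin.append_right]; omega
  · refine hcases (fun i _ => ?_) fun j hj => by simp at hj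
    have h1 := (hxk i).2
    have h2 := (hxk i).1
    simp only [d, p, Fin.append_left]
    rwa [show -(((-k i).toNat : ℕ) : ℤ) = k i by omega]
  · refine hcases (fun i _ => ?_) fun j hj => by simp at hj
    simpa only [Fin.append_left] using hxm i
  · refine hxs.trans (Submodule.span_mono ?_)
    rintro _ ⟨i, rfl⟩
    exact ⟨Fin.castAdd b i, by simp, by simp⟩
  · refine hcases (fun i => ?_) fun j => ?_
    · refine hcases (fun j _ => ?_) fun j _ => ?_
      · simp only [c, Fin.append_left, hxy, Fin.castAdd_inj]
      · simp only [c, Fin.append_left, Fin.append_right, hxz]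
        rw [if_neg]
        intro h
        have := congrArg Fin.val h
        simp at this
        omega
    · intro _ hj; simp at hj
  · refine hcases (fun i hi => by simp at hi) fun j _ => ?_
    have := (hzl j).1; simp only [d, Fin.append_right]; omega
  · refine hcases (fun i hi => by simp at hi) fun j _ => ?_
    simpa only [c, Fin.append_right] using hze' j
  · refine hzs.trans (Submodule.span_mono ?_)
    rintro _ ⟨j, rfl⟩
    exact ⟨Fin.natAdd a j, by simp, by simp [c]⟩
  · intro k' q' v hv
    by_cases hk' : k' ≤ -2
    · exact ⟨v, D.weightSpace_le_m hk' hv.1, hv, by rw [sub_self]; exact zero_mem _⟩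
    have hterm : ∀ i, B e (L.bracket (x i) v) ≠ 0 → -2 - k i = k' ∧ q i = q' := by
      intro i hi
      have := bracket_piece D.h_mem (hxk i).2 hv
      by_contra hcon
      refine hi (D.chi_eq_zero he hB ?_ this)
      by_contra hcon'
      push Not at hcon'
      exact hcon ⟨by omega, parity_eq_of_add_eq_zero hcon'.2⟩
    have hsum : ∑ i, B e (L.bracket (x i) v) • y i ∈
        Submodule.span ℂ {w | ∃ j, (d j : ℤ) - 2 = k' ∧ p j = q' ∧ w = c j} := by
      refine Submodule.sum_mem _ fun i _ => ?_
      by_cases hi : B e (L.bracket (x i) v) = 0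
      · rw [hi, zero_smul]; exact zero_mem _
      · have h1 := hterm i hi
        have h2 := (hxk i).1
        refine Submodule.smul_mem _ _ (Submodule.subset_span ⟨Fin.castAdd b i, ?_, ?_, ?_⟩)
        · simp only [d, Fin.append_left]; omega
        · simpa only [p, Fin.append_left] using h1.2
        · simp only [c, Fin.append_left]
    have hle : Submodule.span ℂ {w | ∃ j, (d j : ℤ) - 2 = k' ∧ p j = q' ∧ w = c j} ≤
        L.piece D.h k' q' := by
      rw [Submodule.span_le]
      rintro _ ⟨j, rfl, rfl, rfl⟩
      exact hc j
    -- Subtracting the `χ`-components along the dual vectors makes `v'` orthogonal to `𝔪'`.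
    set v' := v - ∑ i, B e (L.bracket (x i) v) • y i with hv'
    have hv'p : v' ∈ L.piece D.h k' q' := sub_mem hv (hle hsum)
    have horth : ∀ w ∈ D.m', B e (L.bracket w v') = 0 := by
      intro w hw
      refine (Submodule.span_le.2 ?_ : Submodule.span ℂ (Set.range x) ≤
        LinearMap.ker (B e ∘ₗ L.bracket.flip v')) (hxs hw)
      rintro _ ⟨i, rfl⟩
      change B e (L.bracket (x i) v') = 0
      rw [hv', map_sub, map_sub, map_sum, map_sum, Finset.sum_eq_single i]
      · rw [map_smul, map_smul, hxy, if_pos rfl, smul_eq_mul, mul_one, sub_self]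
      · intro j _ hj
        rw [map_smul, map_smul, hxy, if_neg (Ne.symm hj), smul_zero]
      · simp
    rcases (show k' = -1 ∨ 0 ≤ k' by omega) with hk1 | hk0
    · refine ⟨v', ?_, hv'p, by rw [hv', sub_sub_cancel]; exact hsum⟩
      subst hk1
      exact D.mem_m_of_orthogonal hv'p horth
    · refine ⟨0, zero_mem _, zero_mem _, ?_⟩
      have hv'e := D.bracket_eq_zero_of_orthogonal he hB hnil hk0 hv'p horth
      have h1 := mem_span_same_piece (fun j => (hzl j).2) hv'p (R := fun _ => True)
        (Submodule.span_mono (by rintro _ ⟨j, rfl⟩; exact ⟨j, trivial, rfl⟩) (hzs hv'e))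
      have h2 : v - 0 = v' + ∑ i, B e (L.bracket (x i) v) • y i := by rw [hv']; abel
      rw [h2]
      refine add_mem (Submodule.span_mono ?_ h1) hsum
      rintro _ ⟨j, -, h3, h4, rfl⟩
      have h5 := (hzl j).1
      refine ⟨Fin.natAdd a j, ?_, ?_, ?_⟩
      · simp only [d, Fin.append_right]; omega
      · simpa only [p, Fin.append_right] using h4
      · simp only [c, Fin.append_right]
  · intro α hα
    rw [Fin.sum_univ_add] at hα
    simp only [c, Fin.append_left, Fin.append_right] at hα
    have hα0 : ∀ i, α (Fin.castAdd b i) = 0 := by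
      intro i
      have h1 := D.chi_bracket_eq_zero he hB (hxm i) hα
      rw [map_add, map_add, map_sum, map_sum, map_sum, map_sum, Finset.sum_eq_single i,
        Finset.sum_eq_zero] at h1
      · simpa [hxy] using h1
      · intro j _; rw [map_smul, map_smul, hxz, smul_zero]
      · intro j _ hj; rw [map_smul, map_smul, hxy, if_neg (Ne.symm hj), smul_zero]
      · simp
    rw [Finset.sum_eq_zero (fun i _ => by rw [hα0, zero_smul]), zero_add] at hα
    have h0 := hmz _ hα (by
      rw [map_sum]
      exact Finset.sum_eq_zero fun j _ => by rw [map_smul, hze', smul_zero])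
    have h1 := Fintype.linearIndependent_iff.1 hz _ h0
    exact funext (hcases hα0 h1)

end LieSuperalgebra.WDatum

/-! ### The superadjoint action on `U(g)` and the left ideal `I_χ`. -/

namespace LieSuperalgebra

variable {g : Type w} [AddCommGroup g] [Module ℂ g] {L : LieSuperalgebra g}

/-- The superadjoint action as a bilinear map. -/
def adEnvHom : g →ₗ[ℂ] L.Env →ₗ[ℂ] L.Env :=
  LinearMap.mul ℂ L.Env ∘ₗ L.ι - (LinearMap.mul ℂ L.Env).flip ∘ₗ L.ι ∘ₗ L.even -
    ((LinearMap.mul ℂ L.Env).flip.compl₂ L.envParity.toLinearMap) ∘ₗ L.ι ∘ₗ L.odd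

theorem adEnvHom_apply (x : g) (u : L.Env) : adEnvHom x u = L.adEnv x u := rfl

/-- The power of the parity automorphism given by a parity. -/
def envParityPow (p : ZMod 2) : L.Env →ₐ[ℂ] L.Env := if p = 0 then AlgHom.id ℂ L.Env else L.envParity

theorem adEnv_of_mem {p : ZMod 2} {x : g} (hx : x ∈ L.part p) (u : L.Env) :
    L.adEnv x u = L.ι x * u - envParityPow p u * L.ι x := by
  rcases parity_cases p with rfl | rfl
  · simp [adEnv, envParityPow, L.even_of_even hx, L.odd_of_even hx]
  · simp [adEnv, envParityPow, L.even_of_odd hx, L.odd_of_odd hx]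

theorem envParityPow_ι (p : ZMod 2) {q : ZMod 2} {y : g} (hy : y ∈ L.part q) :
    envParityPow p (L.ι y) = koszulSign p q • L.ι y := by
  rcases parity_cases p with rfl | rfl
  · simp [envParityPow, koszulSign_zero_left]
  · rw [envParityPow, if_neg one_ne_zero, L.envParity_ι, L.parityMap_apply_of_mem q hy, map_smul,
      koszulSign_comm]

theorem adEnv_ι_mul {p q : ZMod 2} {x y : g} (hx : x ∈ L.part p) (hy : y ∈ L.part q) (u : L.Env) :
    L.adEnv x (L.ι y * u) =
      L.ι (L.bracket x y) * u + koszulSign p q • (L.ι y * L.adEnv x u) := by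
  rw [adEnv_of_mem hx, adEnv_of_mem hx, map_mul, envParityPow_ι p hy, ← mul_assoc,
    L.ι_mul_ι p q hx hy, add_mul, mul_sub, smul_sub, smul_mul_assoc, smul_mul_assoc, mul_assoc,
    smul_mul_assoc, mul_assoc]
  abel

theorem adEnv_one (x : g) : L.adEnv x 1 = 0 := by
  rw [adEnv, map_one, mul_one, one_mul, one_mul, sub_sub, ← map_add, L.even_add_odd, sub_self]

theorem adEnv_ι {p : ZMod 2} {x : g} (hx : x ∈ L.part p) (y : g) :
    L.adEnv x (L.ι y) = L.ι (L.bracket x y) := by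
  refine L.induction_part (P := fun y => L.adEnv x (L.ι y) = L.ι (L.bracket x y)) ?_ ?_ y
  · intro q y hy
    have := adEnv_ι_mul hx hy 1
    rwa [mul_one, mul_one, adEnv_one, mul_zero, smul_zero, add_zero] at this
  · intro a b ha hb
    rw [← adEnvHom_apply] at *
    rw [map_add, map_add, ha, hb, map_add, map_add]

theorem adEnv_mul (x : g) (a b : L.Env) : L.adEnv x (a * b) = L.adEnv x a * b +
    (a * L.adEnv (L.even x) b + L.envParity a * L.adEnv (L.odd x) b) := by
  simp only [adEnv, L.even_of_even (L.even_mem x), L.odd_of_even (L.even_mem x),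
    L.even_of_odd (L.odd_mem x), L.odd_of_odd (L.odd_mem x), map_mul, map_zero, mul_zero, sub_zero,
    sub_mul, mul_sub, mul_assoc]
  abel

theorem envParity_word {J : Type*} {b : J → g} {p : J → ZMod 2} (hb : ∀ j, b j ∈ L.part (p j))
    (l : List J) : L.envParity (L.word b l) = koszulSign (l.map p).sum 1 • L.word b l := by
  induction l with
  | nil => simp [koszulSign_zero_left]
  | cons j l ih =>
    rw [word_cons, map_mul, ih, L.envParity_ι, L.parityMap_apply_of_mem _ (hb j), map_smul,
      smul_mul_smul_comm, List.map_cons, List.sum_cons, koszulSign_add_left]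

theorem envParity_envParity (u : L.Env) : L.envParity (L.envParity u) = u := by
  have h : (L.envParity.comp L.envParity).comp L.envMk = L.envMk := by
    refine TensorAlgebra.hom_ext (LinearMap.ext fun x => ?_)
    change L.envParity (L.envParity (L.ι x)) = L.ι x
    rw [L.envParity_ι, L.envParity_ι, L.parityMap_parityMap]
  obtain ⟨t, rfl⟩ := L.envMk_surjective u
  exact DFunLike.congr_fun h t

namespace WDatum

variable {B : LinearMap.BilinForm ℂ g} {e : g} {D : L.WDatum B e}

theorem sub_mem_leftIdeal {x : g} (hx : x ∈ D.m) :
    L.ι x - algebraMap ℂ L.Env (B e x) ∈ D.leftIdeal := Ideal.subset_span ⟨x, hx, rfl⟩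

theorem smul_mem_leftIdeal (c : ℂ) {u : L.Env} (hu : u ∈ D.leftIdeal) : c • u ∈ D.leftIdeal := by
  rw [Algebra.smul_def]
  exact Ideal.mul_mem_left _ _ hu

theorem leftIdeal_induction {P : L.Env → Prop} (h0 : P 0) (hadd : ∀ u v, P u → P v → P (u + v))
    (hgen : ∀ u, ∀ y ∈ D.m, P (u * (L.ι y - algebraMap ℂ L.Env (B e y)))) {u : L.Env}
    (hu : u ∈ D.leftIdeal) : P u := by
  refine Submodule.span_induction (p := fun u _ => ∀ v : L.Env, P (v * u)) ?_ ?_ ?_ ?_ hu 1 |>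
    (one_mul u ▸ ·)
  · rintro _ ⟨y, hy, rfl⟩ v
    exact hgen v y hy
  · intro v; rwa [mul_zero]
  · intro a b _ _ ha hb v
    rw [mul_add]
    exact hadd _ _ (ha v) (hb v)
  · intro a b _ hb v
    rw [smul_eq_mul, ← mul_assoc]
    exact hb _

section

variable (he : e ∈ L.part 0) (hB : L.IsBasicForm B)

include he hB

/-- This makes `𝔪'` act on `Q_χ`: a generator `y - χ(y)` is sent to `[x, y]`, which is a generator
again because it lies in `𝔪` and `χ` kills it. -/
theorem adEnv_mem_leftIdeal {x : g} (hx : x ∈ D.m') {u : L.Env} (hu : u ∈ D.leftIdeal) :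
    L.adEnv x u ∈ D.leftIdeal := by
  have key : ∀ p : ZMod 2, ∀ x ∈ D.m', x ∈ L.part p → ∀ y ∈ D.m,
      L.adEnv x (L.ι y - algebraMap ℂ L.Env (B e y)) ∈ D.leftIdeal := by
    intro p x hx hxp y hy
    rw [← adEnvHom_apply, map_sub, adEnvHom_apply, adEnvHom_apply, adEnv_ι hxp,
      Algebra.algebraMap_eq_smul_one, ← adEnvHom_apply, map_smul, adEnvHom_apply, adEnv_one,
      smul_zero, sub_zero]
    have := sub_mem_leftIdeal (D := D) (D.bracket_mem_m hx (D.m_le_m' hy))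
    rwa [D.chi_bracket_eq_zero he hB hx hy, map_zero, sub_zero] at this
  refine leftIdeal_induction (P := fun u => L.adEnv x u ∈ D.leftIdeal) ?_ ?_ ?_ hu
  · rw [← adEnvHom_apply, map_zero]
    exact zero_mem _
  · intro a b ha hb
    rw [← adEnvHom_apply, map_add]
    exact add_mem ha hb
  · intro a y hy
    rw [adEnv_mul]
    exact add_mem (Ideal.mul_mem_left _ _ (sub_mem_leftIdeal hy)) (add_mem
      (Ideal.mul_mem_left _ _ (key 0 _ (D.m'_graded x hx).1 (L.even_mem x) y hy))
      (Ideal.mul_mem_left _ _ (key 1 _ (D.m'_graded x hx).2 (L.odd_mem x) y hy)))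

theorem envParity_mem_leftIdeal {u : L.Env} (hu : u ∈ D.leftIdeal) :
    L.envParity u ∈ D.leftIdeal := by
  refine leftIdeal_induction (P := fun u => L.envParity u ∈ D.leftIdeal) ?_ ?_ ?_ hu
  · rw [map_zero]; exact zero_mem _
  · intro a b ha hb
    rw [map_add]; exact add_mem ha hb
  · intro a y hy
    have h1 : B e (L.parityMap y) = B e y := by
      have h2 : B e (L.odd y) = 0 := hB.even _ _ he (L.odd_mem y)
      conv_rhs => rw [← L.even_add_odd y]
      rw [parityMap, LinearMap.sub_apply, map_sub, map_add, h2, sub_zero, add_zero]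
    rw [map_mul, map_sub, AlgHom.commutes, L.envParity_ι, ← h1]
    exact Ideal.mul_mem_left _ _ (sub_mem_leftIdeal
      (sub_mem (D.m_graded y hy).1 (D.m_graded y hy).2))

end

/-! ### The filtration of `Q_χ` by Kazhdan degree and word length. -/

namespace Frame

variable (F : D.Frame)

/-- The Kazhdan degree of a list of indices. -/
def deg (l : List (Fin F.n)) : ℤ := ((l.map F.d).sum : ℕ)

@[simp] theorem deg_nil : F.deg [] = 0 := rfl

@[simp] theorem deg_cons (j : Fin F.n) (l : List (Fin F.n)) : F.deg (j :: l) = F.d j + F.deg l := by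
  simp [deg]

@[simp] theorem deg_append (l l' : List (Fin F.n)) : F.deg (l ++ l') = F.deg l + F.deg l' := by
  simp [deg]

theorem length_le_deg (l : List (Fin F.n)) : (l.length : ℤ) ≤ F.deg l := by
  induction l with
  | nil => simp
  | cons j l ih =>
    have := F.d_pos j
    rw [deg_cons, List.length_cons]
    push_cast
    omega

theorem deg_perm {l l' : List (Fin F.n)} (h : l.Perm l') : F.deg l = F.deg l' := by
  rw [deg, deg, (h.map F.d).sum_eq]

/-- The words of Kazhdan degree less than `n`, and those of degree `n` and of length at least
`r`. -/
def Cond (n r : ℤ) (l : List (Fin F.n)) : Prop := F.deg l < n ∨ F.deg l = n ∧ r ≤ l.length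

/-- The product in `U(g)` given by a list of indices. -/
def wd (l : List (Fin F.n)) : L.Env := L.word F.c l

@[simp] theorem wd_nil : F.wd [] = 1 := rfl

@[simp] theorem wd_cons (j : Fin F.n) (l : List (Fin F.n)) :
    F.wd (j :: l) = L.ι (F.c j) * F.wd l := L.word_cons _ _ _

@[simp] theorem wd_append (l l' : List (Fin F.n)) : F.wd (l ++ l') = F.wd l * F.wd l' :=
  L.word_append _ _ _

/-- The span of the words of degree less than `n` and of those of degree `n` and length at least
`r`. -/
def wspan (n r : ℤ) : Submodule ℂ L.Env := Submodule.span ℂ (F.wd '' {l | F.Cond n r l})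

/-- The preimage in `U(g)` of the image of `wspan n r` in `Q_χ`. -/
def filt (n r : ℤ) : Submodule ℂ L.Env := D.leftIdeal.restrictScalars ℂ ⊔ F.wspan n r

theorem leftIdeal_le_filt {n r : ℤ} {u : L.Env} (hu : u ∈ D.leftIdeal) : u ∈ F.filt n r :=
  Submodule.mem_sup_left hu

theorem wspan_le_filt (n r : ℤ) : F.wspan n r ≤ F.filt n r := le_sup_right

theorem wd_mem_wspan {n r : ℤ} {l : List (Fin F.n)} (h : F.Cond n r l) : F.wd l ∈ F.wspan n r :=
  Submodule.subset_span ⟨l, h, rfl⟩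

theorem wd_mem_filt {n r : ℤ} {l : List (Fin F.n)} (h : F.Cond n r l) : F.wd l ∈ F.filt n r :=
  F.wspan_le_filt n r (F.wd_mem_wspan h)

/-- The order on degree and length is lexicographic with the length reversed: in equal degree,
longer words count as smaller. A lift of `c_j` then has the one-letter word as its leading term. -/
theorem wspan_mono {n r n' r' : ℤ} (h : n < n' ∨ n = n' ∧ r' ≤ r) : F.wspan n r ≤ F.wspan n' r' := by
  refine Submodule.span_mono (Set.image_mono fun l hl => ?_)
  rw [Set.mem_ofPred_eq, Cond] at hl ⊢
  omega

theorem filt_mono {n r n' r' : ℤ} (h : n < n' ∨ n = n' ∧ r' ≤ r) : F.filt n r ≤ F.filt n' r' :=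
  sup_le_sup_left (F.wspan_mono h) _

theorem filt_induction {n r : ℤ} {P : L.Env → Prop} (h0 : ∀ u ∈ D.leftIdeal, P u)
    (hw : ∀ l, F.Cond n r l → P (F.wd l)) (hadd : ∀ u v, P u → P v → P (u + v))
    (hsmul : ∀ (c : ℂ) u, P u → P (c • u)) {u : L.Env} (hu : u ∈ F.filt n r) : P u := by
  obtain ⟨a, ha, b, hb, rfl⟩ := Submodule.mem_sup.1 hu
  refine hadd _ _ (h0 a ha) ?_
  clear hu
  induction hb using Submodule.span_induction with
  | mem x hx => obtain ⟨l, hl, rfl⟩ := hx; exact hw l hl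
  | zero => exact h0 0 (zero_mem _)
  | add x y _ _ hx hy => exact hadd _ _ hx hy
  | smul c x _ hx => exact hsmul c _ hx

/-- The left factor must be an honest combination of words, because `I_χ` is only a left ideal. -/
theorem wspan_mul_filt {n r n' r' : ℤ} {u v : L.Env} (hu : u ∈ F.wspan n r)
    (hv : v ∈ F.filt n' r') : u * v ∈ F.filt (n + n') (r + r') := by
  induction hu using Submodule.span_induction with
  | mem x hx =>
    obtain ⟨l, hl, rfl⟩ := hx
    refine F.filt_induction (P := fun v => F.wd l * v ∈ F.filt (n + n') (r + r')) ?_ ?_ ?_ ?_ hv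
    · exact fun v hv => F.leftIdeal_le_filt (Ideal.mul_mem_left _ _ hv)
    · intro l' hl'
      rw [← wd_append]
      refine F.wd_mem_filt ?_
      rw [Set.mem_ofPred_eq, Cond] at hl
      rw [Cond] at hl' ⊢
      rw [deg_append, List.length_append]
      push_cast
      omega
    · intro a b ha hb
      rw [mul_add]; exact add_mem ha hb
    · intro c a ha
      rw [mul_smul_comm]; exact Submodule.smul_mem _ _ ha
  | zero => rw [zero_mul]; exact zero_mem _
  | add x y _ _ hx hy => rw [add_mul]; exact add_mem hx hy
  | smul c x _ hx => rw [smul_mul_assoc]; exact Submodule.smul_mem _ _ hx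

theorem c_mem_wspan (j : Fin F.n) : L.ι (F.c j) ∈ F.wspan (F.d j) 1 := by
  have := F.wd_mem_wspan (l := [j]) (n := F.d j) (r := 1) (Or.inr ⟨by simp, by simp⟩)
  simpa using this

theorem c_mul_mem {n r : ℤ} (j : Fin F.n) {v : L.Env} (hv : v ∈ F.filt n r) :
    L.ι (F.c j) * v ∈ F.filt (F.d j + n) (1 + r) :=
  F.wspan_mul_filt (F.c_mem_wspan j) hv

theorem mem_wspan_of_span {k : ℤ} {q : ZMod 2} {γ : g}
    (hγ : γ ∈ Submodule.span ℂ {y | ∃ j, (F.d j : ℤ) - 2 = k ∧ F.p j = q ∧ y = F.c j}) :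
    L.ι γ ∈ F.wspan (k + 2) 1 := by
  have h : Submodule.span ℂ {y | ∃ j, (F.d j : ℤ) - 2 = k ∧ F.p j = q ∧ y = F.c j} ≤
      (F.wspan (k + 2) 1).comap L.ι := by
    rw [Submodule.span_le]
    rintro _ ⟨j, hj, -, rfl⟩
    have := F.c_mem_wspan j
    rwa [show (F.d j : ℤ) = k + 2 by omega] at this
  exact h hγ

section

variable (he : e ∈ L.part 0) (hB : L.IsBasicForm B)

include he hB

theorem one_mem_filt_of_chi {k : ℤ} {q : ZMod 2} {μ : g} (hμ : μ ∈ D.m) (hμk : μ ∈ L.piece D.h k q) :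
    L.ι μ ∈ F.filt (k + 2) 0 := by
  have h1 : L.ι μ = (L.ι μ - algebraMap ℂ L.Env (B e μ)) + B e μ • F.wd [] := by
    rw [wd_nil, Algebra.algebraMap_eq_smul_one, sub_add_cancel]
  rw [h1]
  refine add_mem (F.leftIdeal_le_filt (sub_mem_leftIdeal hμ)) ?_
  by_cases hk : k = -2
  · subst hk
    exact Submodule.smul_mem _ _ (F.wd_mem_filt (Or.inr ⟨by simp, by simp⟩))
  · rw [D.chi_eq_zero he hB (Or.inl hk) hμk, zero_smul]
    exact zero_mem _

/-- Split `x` into a part in `𝔪` and a combination of the `c_j`. The latter prepends a letter; the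
former is moved through the word to the right, where it becomes a scalar, and each commutator on the
way lowers the degree by two. -/
theorem ι_mul_wd_mem {k : ℤ} {q : ZMod 2} {x : g} (hx : x ∈ L.piece D.h k q)
    (l : List (Fin F.n)) : L.ι x * F.wd l ∈ F.filt (F.deg l + k + 2) 0 := by
  induction l generalizing x k q with
  | nil =>
    obtain ⟨μ, hμ, hμk, hγ⟩ := F.exists_sub_mem k q x hx
    have h1 : L.ι x * F.wd [] = L.ι μ + L.ι (x - μ) := by rw [map_sub]; simp
    rw [h1, deg_nil, zero_add]
    exact add_mem (F.one_mem_filt_of_chi he hB hμ hμk)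
      (F.filt_mono (by omega) (F.wspan_le_filt _ _ (F.mem_wspan_of_span hγ)))
  | cons j t ih =>
    obtain ⟨μ, hμ, hμk, hγ⟩ := F.exists_sub_mem k q x hx
    have h1 : L.ι x * F.wd (j :: t) = L.ι μ * F.wd (j :: t) + L.ι (x - μ) * F.wd (j :: t) := by
      rw [map_sub, sub_mul]; abel
    rw [h1]
    refine add_mem ?_ ?_
    · rw [wd_cons, ← mul_assoc, L.ι_mul_ι q (F.p j) hμk.2 (F.c_mem j).2, add_mul, smul_mul_assoc,
        mul_assoc]
      refine add_mem (Submodule.smul_mem _ _ ?_) ?_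
      · refine F.filt_mono ?_ (F.c_mul_mem j (ih hμk))
        rw [deg_cons]; omega
      · refine F.filt_mono ?_ (ih (bracket_piece D.h_mem hμk (F.c_mem j)))
        rw [deg_cons]; omega
    · refine F.filt_mono ?_ (F.wspan_mul_filt (F.mem_wspan_of_span hγ)
        (F.wd_mem_filt (n := F.deg (j :: t)) (r := 0)
          (Or.inr ⟨rfl, Int.natCast_nonneg _⟩)))
      omega

theorem ι_mul_mem {k n : ℤ} {q : ZMod 2} {x : g} (hx : x ∈ L.piece D.h k q) {u : L.Env}
    (hu : u ∈ F.filt n 0) : L.ι x * u ∈ F.filt (n + k + 2) 0 := by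
  refine F.filt_induction (P := fun u => L.ι x * u ∈ F.filt (n + k + 2) 0) ?_ ?_ ?_ ?_ hu
  · exact fun v hv => F.leftIdeal_le_filt (Ideal.mul_mem_left _ _ hv)
  · intro l hl
    refine F.filt_mono ?_ (F.ι_mul_wd_mem he hB hx l)
    rw [Cond] at hl; omega
  · intro a b ha hb
    rw [mul_add]; exact add_mem ha hb
  · intro c a ha
    rw [mul_smul_comm]; exact Submodule.smul_mem _ _ ha

/-- At the right end `μ` equals `χ(μ)`. Only the commutators met on the way remain, two degrees
below the naive bound; signs do not matter since `χ` kills odd vectors. -/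
theorem ι_mul_wd_sub_mem {k : ℤ} {q : ZMod 2} {μ : g} (hμ : μ ∈ D.m) (hμk : μ ∈ L.piece D.h k q)
    (l : List (Fin F.n)) : L.ι μ * F.wd l - B e μ • F.wd l ∈ F.filt (F.deg l + k) 0 := by
  induction l with
  | nil =>
    rw [wd_nil, mul_one, ← Algebra.algebraMap_eq_smul_one]
    exact F.leftIdeal_le_filt (sub_mem_leftIdeal hμ)
  | cons j t ih =>
    have hs : koszulSign q (F.p j) * B e μ = B e μ := by
      by_cases hq : q = 0
      · rw [hq, koszulSign_zero_left, one_mul]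
      · rw [D.chi_eq_zero he hB (Or.inr hq) hμk, mul_zero]
    have h1 : L.ι μ * F.wd (j :: t) - B e μ • F.wd (j :: t) =
        koszulSign q (F.p j) • (L.ι (F.c j) * (L.ι μ * F.wd t - B e μ • F.wd t)) +
          L.ι (L.bracket μ (F.c j)) * F.wd t := by
      rw [wd_cons, ← mul_assoc, L.ι_mul_ι q (F.p j) hμk.2 (F.c_mem j).2, add_mul, smul_mul_assoc,
        mul_assoc, mul_sub, smul_sub, mul_smul_comm, smul_smul, hs]
      abel
    rw [h1]
    refine add_mem (Submodule.smul_mem _ _ ?_) ?_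
    · refine F.filt_mono ?_ (F.c_mul_mem j ih)
      rw [deg_cons]; omega
    · refine F.filt_mono ?_ (F.ι_mul_wd_mem he hB (bracket_piece D.h_mem hμk (F.c_mem j)) t)
      rw [deg_cons]; omega

/-- Vectors of weight at least `-1` raise the length. -/
theorem ι_mul_wd_mem_length {k : ℤ} {q : ZMod 2} {x : g} (hx : x ∈ L.piece D.h k q)
    (l : List (Fin F.n)) :
    L.ι x * F.wd l ∈ F.filt (F.deg l + k + 2) l.length := by
  obtain ⟨μ, hμ, hμk, hγ⟩ := F.exists_sub_mem k q x hx
  have h1 : L.ι x * F.wd l = (L.ι μ * F.wd l - B e μ • F.wd l) + B e μ • F.wd l +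
      L.ι (x - μ) * F.wd l := by
    rw [map_sub, sub_mul]; abel
  rw [h1]
  refine add_mem (add_mem (F.filt_mono (by omega) (F.ι_mul_wd_sub_mem he hB hμ hμk l)) ?_) ?_
  · by_cases hk : k = -2
    · exact Submodule.smul_mem _ _ (F.wd_mem_filt (Or.inr ⟨by omega, le_rfl⟩))
    · rw [D.chi_eq_zero he hB (Or.inl hk) hμk, zero_smul]
      exact zero_mem _
  · refine F.filt_mono ?_ (F.wspan_mul_filt (F.mem_wspan_of_span hγ)
        (F.wd_mem_filt (n := F.deg l) (r := l.length) (Or.inr ⟨rfl, le_rfl⟩)))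
    omega

/-- In top degree only the scalar `χ(x)` preserves the length: the part of `x` along the `c_j` adds
a letter, and everything else has smaller degree. -/
theorem ι_mul_wd_sub_chi_mem {k : ℤ} {q : ZMod 2} {x : g} (hx : x ∈ L.piece D.h k q)
    (l : List (Fin F.n)) :
    L.ι x * F.wd l - B e x • F.wd l ∈ F.filt (F.deg l + k + 2) (l.length + 1) := by
  obtain ⟨μ, hμ, hμk, hγ⟩ := F.exists_sub_mem k q x hx
  have hγ0 : B e (x - μ) = 0 := by
    have hle : Submodule.span ℂ {y | ∃ j, (F.d j : ℤ) - 2 = k ∧ F.p j = q ∧ y = F.c j} ≤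
        LinearMap.ker (B e) := by
      rw [Submodule.span_le]
      rintro _ ⟨j, -, -, rfl⟩
      refine D.chi_eq_zero he hB (Or.inl ?_) (F.c_mem j)
      have := F.d_pos j
      omega
    exact hle hγ
  have hxμ : B e x = B e μ := by rwa [map_sub, sub_eq_zero] at hγ0
  have h1 : L.ι x * F.wd l - B e x • F.wd l = (L.ι μ * F.wd l - B e μ • F.wd l) +
      L.ι (x - μ) * F.wd l := by
    rw [map_sub, sub_mul, hxμ]; abel
  rw [h1]
  refine add_mem (F.filt_mono (by omega) (F.ι_mul_wd_sub_mem he hB hμ hμk l)) ?_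
  refine F.filt_mono ?_ (F.wspan_mul_filt (F.mem_wspan_of_span hγ)
        (F.wd_mem_filt (n := F.deg l) (r := l.length) (Or.inr ⟨rfl, le_rfl⟩)))
  omega

/-- The superderivation `ad x_i` replaces a letter `c_j` by `[x_i, c_j]`, whose leading part is the
scalar `χ([x_i, c_j]) = δ_ij`. On leading terms it is the derivative with respect to `c_i`; the
errors of the same degree are longer by at least one letter. -/
theorem adEnv_wd (i : Fin F.n) (hi : i.1 < F.a) (l : List (Fin F.n)) :
    L.adEnv (F.x i) (F.wd l) - deleteSum F.p i F.wd l ∈ F.filt (F.deg l - F.d i) l.length := by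
  induction l with
  | nil =>
    rw [wd_nil, adEnv_one, deleteSum, sub_zero]
    exact zero_mem _
  | cons j t ih =>
    have h2 : deleteSum F.p i (fun l' => F.wd (j :: l')) t =
        L.ι (F.c j) * deleteSum F.p i F.wd t := by
      simp only [wd_cons]
      exact (deleteSum_map F.p (LinearMap.mulLeft ℂ (L.ι (F.c j))) i F.wd t).symm
    have h1 : L.adEnv (F.x i) (F.wd (j :: t)) - deleteSum F.p i F.wd (j :: t) =
        (L.ι (L.bracket (F.x i) (F.c j)) * F.wd t - B e (L.bracket (F.x i) (F.c j)) • F.wd t) +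
        koszulSign (F.p i) (F.p j) • (L.ι (F.c j) *
          (L.adEnv (F.x i) (F.wd t) - deleteSum F.p i F.wd t)) := by
      rw [wd_cons, adEnv_ι_mul (F.x_mem i hi).2 (F.c_mem j).2, deleteSum, h2, F.pair i j hi, mul_sub,
        smul_sub, ite_smul, one_smul, zero_smul]
      abel
    rw [h1]
    refine add_mem ?_ (Submodule.smul_mem _ _ ?_)
    · refine F.filt_mono ?_ (F.ι_mul_wd_sub_chi_mem he hB
        (bracket_piece D.h_mem (F.x_mem i hi) (F.c_mem j)) t)
      rw [deg_cons, List.length_cons]; push_cast; omega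
    · refine F.filt_mono ?_ (F.c_mul_mem j ih)
      rw [deg_cons, List.length_cons]; push_cast; omega

theorem adEnv_mem_filt {n r : ℤ} (i : Fin F.n) (hi : i.1 < F.a) {u : L.Env} (hu : u ∈ F.filt n r) :
    L.adEnv (F.x i) u ∈ F.filt (n - F.d i) (r - 1) := by
  refine F.filt_induction (P := fun u => adEnvHom (F.x i) u ∈ F.filt (n - F.d i) (r - 1))
    ?_ ?_ ?_ ?_ hu
  · exact fun u hu => F.leftIdeal_le_filt (adEnv_mem_leftIdeal he hB (F.x_mem_m' i hi) hu)
  · intro l hl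
    rw [adEnvHom_apply]
    rw [Cond] at hl
    have h1 := F.filt_mono (n' := n - F.d i) (r' := r - 1) (by omega) (F.adEnv_wd he hB i hi l)
    have h2 : deleteSum F.p i F.wd l ∈ F.filt (n - F.d i) (r - 1) := by
      refine deleteSum_mem F.p _ i _ l fun l' hl' => F.wd_mem_filt ?_
      have h3 := F.deg_perm hl'
      have h4 := hl'.length_eq
      rw [deg_cons] at h3
      rw [List.length_cons] at h4
      rw [Cond]
      omega
    have := add_mem h1 h2
    rwa [sub_add_cancel] at this
  · intro a b ha hb
    rw [map_add]; exact add_mem ha hb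
  · intro c a ha
    rw [map_smul]; exact Submodule.smul_mem _ _ ha

theorem envParity_mem_filt {n r : ℤ} {u : L.Env} (hu : u ∈ F.filt n r) :
    L.envParity u ∈ F.filt n r := by
  refine F.filt_induction (P := fun u => L.envParity u ∈ F.filt n r) ?_ ?_ ?_ ?_ hu
  · exact fun u hu => F.leftIdeal_le_filt (envParity_mem_leftIdeal he hB hu)
  · intro l hl
    rw [wd, envParity_word (fun j => (F.c_mem j).2)]
    exact Submodule.smul_mem _ _ (F.wd_mem_filt hl)
  · intro a b ha hb
    rw [map_add]; exact add_mem ha hb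
  · intro c a ha
    rw [map_smul]; exact Submodule.smul_mem _ _ ha

end

end Frame

end WDatum

end LieSuperalgebra

/-! ### Sorted words as a basis of `Q_χ`. -/

theorem LinearMap.apply_mem_of_mem_span {M N : Type*} [AddCommGroup M] [Module ℂ M]
    [AddCommGroup N] [Module ℂ N] (f : M →ₗ[ℂ] N) {s : Set M} {S : Submodule ℂ N}
    (h : ∀ x ∈ s, f x ∈ S) {x : M} (hx : x ∈ Submodule.span ℂ s) : f x ∈ S :=
  Submodule.span_le.2 (show s ⊆ S.comap f from h) hx

section

variable {J : Type*} [LinearOrder J] {p : J → ZMod 2} {A : Type*} [Ring A] [Algebra ℂ A]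

/-- If the supercommutators of a family of elements are combinations of the family, then the
nonempty products of the family are combinations of the sorted ones. -/
theorem prod_mem_span_sorted {a : J → A}
    (h : ∀ i j, a i * a j - koszulSign (p i) (p j) • (a j * a i) ∈ Submodule.span ℂ (Set.range a))
    {l : List J} (hl : l ≠ []) : (l.map a).prod ∈
      Submodule.span ℂ ((fun l : List _ => (l.map a).prod) '' {l | l ≠ [] ∧ IsSortedWord p l}) := by
  refine straightening (p := p) (fun l => (l.map a).prod) _ (fun _ => 1) (fun l => l ≠ []) ?_ ?_ ?_ l hl
  · rintro l l' hp h rfl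
    exact h hp.eq_nil
  · exact fun l hl hs => Submodule.subset_span ⟨l, ⟨hl, hs⟩, rfl⟩
  · intro l₁ i j l₂ _ ih
    have h1 : ((l₁ ++ i :: j :: l₂).map a).prod -
        koszulSign (p i) (p j) • ((l₁ ++ j :: i :: l₂).map a).prod = (l₁.map a).prod *
          (a i * a j - koszulSign (p i) (p j) • (a j * a i)) * (l₂.map a).prod := by
      simp only [List.map_append, List.map_cons, List.prod_append, List.prod_cons, mul_sub, sub_mul,
        mul_smul_comm, smul_mul_assoc, mul_assoc]
    rw [h1]
    have h2 := h i j
    generalize a i * a j - koszulSign (p i) (p j) • (a j * a i) = y at h2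
    induction h2 using Submodule.span_induction with
    | mem y hy =>
      obtain ⟨k, rfl⟩ := hy
      have := ih (l₁ ++ k :: l₂) (by simp) (by simp)
      simpa [mul_assoc] using this
    | zero => rw [mul_zero, zero_mul]; exact zero_mem _
    | add x y _ _ hx hy => rw [mul_add, add_mul]; exact add_mem hx hy
    | smul c x _ hx => rw [mul_smul_comm, smul_mul_assoc]; exact Submodule.smul_mem _ _ hx

omit [LinearOrder J] in
/-- Translating the letters by scalars changes products by combinations of shorter products. -/
theorem prod_sub_prod_mem {a a' : J → A} {t : J → ℂ} (h : ∀ j, a' j = a j - algebraMap ℂ A (t j))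
    (l : List J) : (l.map a').prod - (l.map a).prod ∈
      Submodule.span ℂ ((fun l : List _ => (l.map a).prod) '' {k | k.length < l.length}) := by
  induction l with
  | nil => simp
  | cons j l ih =>
    have h1 : ((j :: l).map a').prod - ((j :: l).map a).prod =
        a j * ((l.map a').prod - (l.map a).prod) -
          t j • ((l.map a').prod - (l.map a).prod + (l.map a).prod) := by
      simp only [List.map_cons, List.prod_cons, h j, sub_mul, mul_sub, sub_add_cancel,
        Algebra.smul_def]
      abel
    have hmono : Submodule.span ℂ ((fun l : List _ => (l.map a).prod) '' {k | k.length < l.length}) ≤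
        Submodule.span ℂ ((fun l : List _ => (l.map a).prod) '' {k | k.length < (j :: l).length}) := by
      refine Submodule.span_mono (Set.image_mono fun k hk => ?_)
      rw [Set.mem_ofPred_eq] at hk ⊢
      rw [List.length_cons]; omega
    rw [h1]
    refine sub_mem ?_ (Submodule.smul_mem _ _ (add_mem (hmono ih)
      (Submodule.subset_span ⟨l, by simp, rfl⟩)))
    refine (LinearMap.mulLeft ℂ (a j)).apply_mem_of_mem_span ?_ ih
    rintro _ ⟨k, hk, rfl⟩
    exact Submodule.subset_span ⟨j :: k, by simpa using hk, by simp⟩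

/-- A sorted word in a lexicographic sum is a word in the first summand followed by a word in the
second one. -/
theorem IsSortedWord.exists_eq_append {α β : Type*} [LinearOrder α] [LinearOrder β]
    {p : α ⊕ₗ β → ZMod 2} {l : List (α ⊕ₗ β)} (h : IsSortedWord p l) :
    ∃ (l₁ : List α) (l₂ : List β), l = l₁.map (fun i => toLex (Sum.inl i)) ++ l₂.map (fun i => toLex (Sum.inr i)) := by
  induction l with
  | nil => exact ⟨[], [], rfl⟩
  | cons j l ih =>
    obtain ⟨l₁, l₂, rfl⟩ := ih h.tail
    rcases j with i | i
    · exact ⟨i :: l₁, l₂, rfl⟩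
    · cases l₁ with
      | nil => exact ⟨[], i :: l₂, rfl⟩
      | cons i' l₁ =>
        have := (isSortedWord_cons.1 h).1 (toLex (Sum.inl i')) (by simp)
        rcases this with h | h
        · exact absurd h (by exact Sum.Lex.not_inr_lt_inl)
        · exact absurd h.1 (by intro h; injection h)

end

namespace LieSuperalgebra

variable {g : Type w} [AddCommGroup g] [Module ℂ g] {L : LieSuperalgebra g}

theorem span_range_word {J : Type*} {b : J → g} (hb : Submodule.span ℂ (Set.range b) = ⊤) :
    Submodule.span ℂ (Set.range (L.word b)) = ⊤ := by
  have hι : ∀ x : g, ∀ u ∈ Submodule.span ℂ (Set.range (L.word b)),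
      L.ι x * u ∈ Submodule.span ℂ (Set.range (L.word b)) := by
    intro x u hu
    have hx : x ∈ Submodule.span ℂ (Set.range b) := hb ▸ trivial
    induction hx using Submodule.span_induction with
    | mem y hy =>
      obtain ⟨j, rfl⟩ := hy
      induction hu using Submodule.span_induction with
      | mem y hy =>
        obtain ⟨l, rfl⟩ := hy
        exact Submodule.subset_span ⟨j :: l, L.word_cons b j l⟩
      | zero => rw [mul_zero]; exact zero_mem _
      | add x y _ _ hx hy => rw [mul_add]; exact add_mem hx hy
      | smul c x _ hx => rw [mul_smul_comm]; exact Submodule.smul_mem _ _ hx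
    | zero => rw [map_zero, zero_mul]; exact zero_mem _
    | add x y _ _ hx hy => rw [map_add, add_mul]; exact add_mem hx hy
    | smul c x _ hx => rw [map_smul, smul_mul_assoc]; exact Submodule.smul_mem _ _ hx
  have key : ∀ t : TensorAlgebra ℂ g, ∀ u ∈ Submodule.span ℂ (Set.range (L.word b)),
      L.envMk t * u ∈ Submodule.span ℂ (Set.range (L.word b)) := by
    intro t
    induction t using TensorAlgebra.induction with
    | algebraMap r =>
      intro u hu
      rw [AlgHom.commutes, ← Algebra.smul_def]
      exact Submodule.smul_mem _ _ hu
    | ι x => exact fun u hu => hι x u hu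
    | mul s t hs ht =>
      intro u hu
      rw [map_mul, mul_assoc]
      exact hs _ (ht _ hu)
    | add s t hs ht =>
      intro u hu
      rw [map_add, add_mul]
      exact add_mem (hs _ hu) (ht _ hu)
  rw [eq_top_iff]
  rintro u -
  obtain ⟨t, rfl⟩ := L.envMk_surjective u
  have := key t 1 (Submodule.subset_span ⟨[], rfl⟩)
  rwa [mul_one] at this

/-- Words in a homogeneous spanning family are combinations of sorted ones. -/
theorem span_sorted_word {J : Type*} [LinearOrder J] {p : J → ZMod 2} {b : J → g}
    (hb : Submodule.span ℂ (Set.range b) = ⊤) (hp : ∀ j, b j ∈ L.part (p j)) :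
    Submodule.span ℂ (L.word b '' {l | IsSortedWord p l}) = ⊤ := by
  rw [eq_top_iff, ← L.span_range_word hb, Submodule.span_le]
  rintro _ ⟨l, rfl⟩
  by_cases hl : l = []
  · exact Submodule.subset_span ⟨l, hl ▸ List.Pairwise.nil, rfl⟩
  · have := prod_mem_span_sorted (p := p) (a := fun j => L.ι (b j)) (fun i j => ?_) hl
    · refine Submodule.span_mono ?_ this
      rintro _ ⟨k, hk, rfl⟩
      exact ⟨k, hk.2, rfl⟩
    · rw [L.ι_mul_ι _ _ (hp i) (hp j), add_sub_cancel_left]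
      have h1 : L.bracket (b i) (b j) ∈ Submodule.span ℂ (Set.range b) := hb ▸ trivial
      have h2 := Submodule.mem_map_of_mem (f := L.ι) h1
      rwa [Submodule.map_span, ← Set.range_comp] at h2

namespace WDatum

variable {B : LinearMap.BilinForm ℂ g} {e : g} {D : L.WDatum B e}

/-- A homogeneous basis of `𝔪`. -/
theorem exists_basis_m [FiniteDimensional ℂ g] (D : L.WDatum B e) : ∃ (k : ℕ) (y : Fin k → g)
    (q : Fin k → ZMod 2), LinearIndependent ℂ y ∧ (∀ i, y i ∈ D.m) ∧ (∀ i, y i ∈ L.part (q i)) ∧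
      D.m ≤ Submodule.span ℂ (Set.range y) := by
  obtain ⟨k, y, _, q, h1, h2, h3, h4⟩ := exists_homogeneous_basis (h := D.h) D.m (fun k => k < 0)
    D.m_le_span_homogeneous
  exact ⟨k, y, q, h1, h2, fun i => (h3 i).2.2, h4⟩

namespace Frame

variable (F : D.Frame) (he : e ∈ L.part 0) (hB : L.IsBasicForm B)

section

variable {k : ℕ} {y : Fin k → g} {q : Fin k → ZMod 2} (hym : ∀ i, y i ∈ D.m)
  (hyq : ∀ i, y i ∈ L.part (q i)) (hspan : D.m ≤ Submodule.span ℂ (Set.range y))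
  (hgen : Submodule.span ℂ (Set.range (Sum.elim F.c y)) = ⊤)

include he hB hym hyq hspan hgen

/-- Order the letters `c` before those of `𝔪`. Every element is a combination of products of a
sorted `c`-word and an `𝔪`-word, and the latter may be written in the shifted letters `y - χ(y)`. A
further shifted letter on the right keeps the second factor nonempty, and it can be sorted since `χ`
kills brackets of `𝔪`. -/
theorem leftIdeal_le_span : D.leftIdeal.restrictScalars ℂ ≤
    Submodule.span ℂ {u | ∃ (l : List (Fin F.n)) (l' : List (Fin k)), IsSortedWord F.p l ∧
      IsSortedWord q l' ∧ l' ≠ [] ∧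
      u = F.wd l * (l'.map fun i => L.ι (y i) - algebraMap ℂ L.Env (B e (y i))).prod} := by
  set S := Submodule.span ℂ {u | ∃ (l : List (Fin F.n)) (l' : List (Fin k)), IsSortedWord F.p l ∧
      IsSortedWord q l' ∧ l' ≠ [] ∧
      u = F.wd l * (l'.map fun i => L.ι (y i) - algebraMap ℂ L.Env (B e (y i))).prod} with hS
  set a : Fin k → L.Env := fun i => L.ι (y i) - algebraMap ℂ L.Env (B e (y i)) with ha
  have hchi : ∀ z ∈ D.m, L.ι z - algebraMap ℂ L.Env (B e z) ∈ Submodule.span ℂ (Set.range a) := by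
    intro z hz
    replace hz := hspan hz
    induction hz using Submodule.span_induction with
    | mem z hz => obtain ⟨i, rfl⟩ := hz; exact Submodule.subset_span ⟨i, rfl⟩
    | zero => simp
    | add x z _ _ hx hz =>
      rw [map_add, map_add, map_add, add_sub_add_comm]
      exact add_mem hx hz
    | smul c x _ hx =>
      rw [map_smul, map_smul, smul_eq_mul, map_mul, ← Algebra.smul_def, ← smul_sub]
      exact Submodule.smul_mem _ _ hx
  have hcomm : ∀ i j, a i * a j - koszulSign (q i) (q j) • (a j * a i) ∈
      Submodule.span ℂ (Set.range a) := by
    intro i j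
    have h1 : B e (L.bracket (y i) (y j)) = 0 :=
      D.chi_bracket_eq_zero he hB (D.m_le_m' (hym i)) (hym j)
    have h2 := hchi _ (D.bracket_mem_m (D.m_le_m' (hym i)) (D.m_le_m' (hym j)))
    rw [h1, map_zero, sub_zero] at h2
    -- A letter is even, and then no sign occurs, or its shift is zero. Hence the shifts cancel in
    -- supercommutators.
    have h3 : ∀ i, q i = 0 ∨ B e (y i) = 0 := by
      intro i
      rcases parity_cases (q i) with h | h
      · exact Or.inl h
      · exact Or.inr (hB.even _ _ he (h ▸ hyq i))
    convert h2 using 1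
    have h4 := L.ι_mul_ι (q i) (q j) (hyq i) (hyq j)
    simp only [ha, sub_mul, mul_sub, h4, smul_sub]
    simp only [Algebra.algebraMap_eq_smul_one, smul_mul_assoc, mul_smul_comm, one_mul, mul_one]
    rcases h3 i with hi | hi <;> rcases h3 j with hj | hj <;>
      simp only [hi, hj, koszulSign_zero_left, koszulSign_zero_right, one_smul, zero_smul,
        smul_zero] <;> module
  have hprod : ∀ (l : List (Fin F.n)) (l' : List (Fin k)), IsSortedWord F.p l → l' ≠ [] →
      F.wd l * (l'.map a).prod ∈ S := by
    intro l l' hl hl'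
    refine (LinearMap.mulLeft ℂ (F.wd l)).apply_mem_of_mem_span ?_ (prod_mem_span_sorted hcomm hl')
    rintro _ ⟨l', hl', rfl⟩
    exact Submodule.subset_span ⟨l, l', hl, hl'.2, hl'.1, rfl⟩
  have hword : ∀ l : List (Fin k), L.word y l ∈
      Submodule.span ℂ (Set.range fun l : List (Fin k) => (l.map a).prod) := by
    intro l
    have h1 := prod_sub_prod_mem (a := a) (a' := fun i => L.ι (y i)) (t := fun i => - B e (y i))
      (fun i => by simp [ha]) l
    have h2 := add_mem (Submodule.span_mono (Set.image_subset_range _ _) h1)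
      (Submodule.subset_span ⟨l, rfl⟩)
    rwa [sub_add_cancel] at h2
  have hmul : ∀ u : L.Env, ∀ i, u * a i ∈ S := by
    intro u i
    let b : Fin F.n ⊕ₗ Fin k → g := fun j => Sum.elim F.c y (ofLex j)
    have hb : Submodule.span ℂ (Set.range b) = ⊤ := by
      rw [← hgen]
      congr 1
    have hu := L.span_sorted_word (p := fun j => Sum.elim F.p q (ofLex j)) hb (by
      intro j
      rcases hj : ofLex j with j' | j'
      · simpa [b, hj] using (F.c_mem j').2
      · simpa [b, hj] using hyq j')
    refine (LinearMap.mulRight ℂ (a i)).apply_mem_of_mem_span (x := u) ?_ (hu.ge Submodule.mem_top)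
    rintro _ ⟨l, hl, rfl⟩
    obtain ⟨l₁, l₂, rfl⟩ := IsSortedWord.exists_eq_append hl
    have hl₁ : IsSortedWord F.p l₁ := by
      have h1 := (List.pairwise_append.1 hl).1
      rw [List.pairwise_map] at h1
      refine h1.imp ?_
      rintro i j (h | h)
      · exact Or.inl (Sum.Lex.inl_lt_inl_iff.1 h)
      · exact Or.inr ⟨Sum.inl_injective (toLex.injective h.1), h.2⟩
    have h1 : L.word b (l₁.map (fun i => toLex (Sum.inl i)) ++ l₂.map fun i => toLex (Sum.inr i)) =
        F.wd l₁ * L.word y l₂ := by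
      rw [word_append, wd, word, word, word, word, List.map_map, List.map_map]
      rfl
    rw [LinearMap.mulRight_apply, h1, mul_assoc]
    refine (LinearMap.mulLeft ℂ (F.wd l₁) ∘ₗ LinearMap.mulRight ℂ (a i)).apply_mem_of_mem_span ?_
      (hword l₂)
    rintro _ ⟨l, rfl⟩
    simpa using hprod l₁ (l ++ [i]) hl₁ (by simp)
  intro u hu
  refine leftIdeal_induction (P := fun u => u ∈ S) (zero_mem _) (fun _ _ => add_mem) ?_ hu
  intro u z hz
  refine (LinearMap.mulLeft ℂ u).apply_mem_of_mem_span ?_ (hchi z hz)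
  rintro _ ⟨i, rfl⟩
  exact hmul u i

end


include he hB in
-- PBW holds for the letters `c` followed by the shifted letters of `𝔪`. Words without letters of
-- `𝔪` are independent of those with at least one, and the latter span a space containing `I_χ`.
theorem linearIndependent_wd (hL : L.IsBasicClassical)
    (hnil : IsNilpotent (L.bracket e : Module.End ℂ g)) :
    LinearIndependent ℂ fun l : {l : List (Fin F.n) // IsSortedWord F.p l} =>
      (D.leftIdeal.restrictScalars ℂ).mkQ (F.wd l) := by
  have := hL.finiteDimensional
  obtain ⟨k, y, q, hy, hym, hyq, hspan⟩ := D.exists_basis_m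
  have hgen : Submodule.span ℂ (Set.range (Sum.elim F.c y)) = ⊤ := by
    have h1 : Submodule.span ℂ (Set.range F.c) ≤ Submodule.span ℂ (Set.range (Sum.elim F.c y)) :=
      Submodule.span_mono (by rintro _ ⟨j, rfl⟩; exact ⟨Sum.inl j, rfl⟩)
    have h2 : Submodule.span ℂ (Set.range y) ≤ Submodule.span ℂ (Set.range (Sum.elim F.c y)) :=
      Submodule.span_mono (by rintro _ ⟨j, rfl⟩; exact ⟨Sum.inr j, rfl⟩)
    rw [eq_top_iff]
    rintro x -
    refine D.piece_induction he hnil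
      (P := fun x => x ∈ Submodule.span ℂ (Set.range (Sum.elim F.c y))) ?_
      (fun _ _ => add_mem) x
    intro l r x hx
    obtain ⟨μ, hμ, -, hγ⟩ := F.exists_sub_mem l r x hx
    rw [← add_sub_cancel μ x]
    refine add_mem (h2 (hspan hμ)) (h1 (Submodule.span_mono ?_ hγ))
    rintro _ ⟨j, -, -, rfl⟩
    exact ⟨j, rfl⟩
  have hind : LinearIndependent ℂ (Sum.elim F.c y) := by
    rw [Fintype.linearIndependent_iff]
    intro α hα
    simp only [Fintype.sum_sum_type, Sum.elim_inl, Sum.elim_inr] at hα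
    have h1 := F.eq_zero_of_sum_mem (fun j => α (Sum.inl j)) (by
      rw [eq_neg_of_add_eq_zero_left hα]
      exact neg_mem (Submodule.sum_mem _ fun i _ => Submodule.smul_mem _ _ (hym i)))
    have h1' : ∀ j, α (Sum.inl j) = 0 := congrFun h1
    simp only [h1', zero_smul, Finset.sum_const_zero, zero_add] at hα
    have h2 := Fintype.linearIndependent_iff.1 hy _ hα
    rintro (j | j)
    · exact h1' j
    · exact h2 j
  let b : Module.Basis (Fin F.n ⊕ₗ Fin k) ℂ g := (Module.Basis.mk hind hgen.ge).reindex toLex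
  let pJ : Fin F.n ⊕ₗ Fin k → ZMod 2 := fun j => Sum.elim F.p q (ofLex j)
  let t : Fin F.n ⊕ₗ Fin k → ℂ := fun j => Sum.elim (fun _ => 0) (fun i => B e (y i)) (ofLex j)
  have hbl : ∀ j, b (toLex (Sum.inl j)) = F.c j := fun j => by simp [b]
  have hbr : ∀ j, b (toLex (Sum.inr j)) = y j := fun j => by simp [b]
  have hb : ∀ j, b j ∈ L.part (pJ j) := by
    intro j
    induction j using Lex.rec with
    | h j =>
      rcases j with j | j
      · rw [hbl]; exact (F.c_mem j).2
      · rw [hbr]; exact hyq j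
  let a : Fin F.n ⊕ₗ Fin k → L.Env := fun j => L.ι (b j) - algebraMap ℂ L.Env (t j)
  choose φ hφ hφ0 using fun I => exists_word_functional hL b hb I
  -- Shifting letters changes a word by shorter words only, and these are killed by the functional.
  have hval : ∀ I l : List (Fin F.n ⊕ₗ Fin k), l.length ≤ I.length →
      φ I (l.map a).prod = φ I (L.word b l) := by
    intro I l hl
    have h1 := prod_sub_prod_mem (a := fun j => L.ι (b j)) (a' := a) (t := t) (fun j => rfl) l
    have h2 := (φ I).apply_mem_of_mem_span (S := ⊥) (by
      rintro _ ⟨k, hk, rfl⟩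
      exact hφ0 I k (lt_of_lt_of_le hk hl)) h1
    rwa [map_sub, Submodule.mem_bot, sub_eq_zero] at h2
  have htri : IsTriangular (fun l : {l : List (Fin F.n ⊕ₗ Fin k) // IsSortedWord pJ l} =>
      (l.1.map a).prod) (fun l => φ l.1) (fun l => (l.1.length : ℤ)) (fun _ => 0) := by
    constructor
    · intro I l hlt
      have hlt' : l.1.length < I.1.length := by exact_mod_cast hlt
      rw [hval _ _ hlt'.le, hφ0 _ _ hlt']
    · intro I l _ hlt
      exact absurd hlt (lt_irrefl _)
    · intro I l heq _ hne
      have heq' : l.1.length = I.1.length := by exact_mod_cast heq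
      rw [hval _ _ heq'.le, hφ _ _ heq']
      exact listPairing_eq_zero_of_ne I.2 l.2 fun h => hne (Subtype.ext h)
    · intro I
      rw [hval _ _ le_rfl, hφ _ _ rfl]
      exact listPairing_self_ne_zero I.2
  have hv := htri.linearIndependent
  let f : {l : List (Fin F.n) // IsSortedWord F.p l} →
      {l : List (Fin F.n ⊕ₗ Fin k) // IsSortedWord pJ l} := fun l =>
    ⟨l.1.map fun i => toLex (Sum.inl i), by
      rw [IsSortedWord, List.pairwise_map]
      refine l.2.imp ?_
      rintro i j (h | h)
      · exact Or.inl (Sum.Lex.inl_lt_inl_iff.2 h)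
      · exact Or.inr ⟨by rw [h.1], h.2⟩⟩
  have hinj : Function.Injective fun i : Fin F.n => (toLex (Sum.inl i) : Fin F.n ⊕ₗ Fin k) :=
    fun i j h => Sum.inl_injective (toLex.injective h)
  have hf : Function.Injective f := fun l l' h =>
    Subtype.ext (List.map_injective_iff.2 hinj (congrArg Subtype.val h))
  have hal : ∀ j, a (toLex (Sum.inl j)) = L.ι (F.c j) := by
    intro j
    simp only [a, hbl]
    simp [t]
  have har : ∀ j, a (toLex (Sum.inr j)) = L.ι (y j) - algebraMap ℂ L.Env (B e (y j)) := by
    intro j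
    simp only [a, hbr]
    simp [t]
  have hvf : ∀ l, ((f l).1.map a).prod = F.wd l.1 := by
    intro l
    simp only [f, List.map_map]
    rw [wd, word]
    congr 2
    exact funext hal
  have hli := hv.comp f hf
  have hdisj := hv.disjoint_span_image (disjoint_compl_right (a := Set.range f))
  have hfun : (fun l : {l : List (Fin F.n) // IsSortedWord F.p l} =>
      (D.leftIdeal.restrictScalars ℂ).mkQ (F.wd l)) = (D.leftIdeal.restrictScalars ℂ).mkQ ∘
        ((fun l : {l : List (Fin F.n ⊕ₗ Fin k) // IsSortedWord pJ l} => (l.1.map a).prod) ∘ f) :=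
    funext fun l => congrArg _ (hvf l).symm
  rw [hfun]
  refine hli.map ?_
  rw [Submodule.ker_mkQ, Set.range_comp]
  refine hdisj.mono_right ((F.leftIdeal_le_span he hB hym hyq hspan hgen).trans
    (Submodule.span_mono ?_))
  rintro _ ⟨l, l', hl, hl', hne, rfl⟩
  refine ⟨⟨l.map (fun i => toLex (Sum.inl i)) ++ l'.map fun i => toLex (Sum.inr i), ?_⟩, ?_, ?_⟩
  · rw [IsSortedWord, List.pairwise_append, List.pairwise_map, List.pairwise_map]
    refine ⟨hl.imp ?_, hl'.imp ?_, ?_⟩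
    · rintro i j (h | h)
      · exact Or.inl (Sum.Lex.inl_lt_inl_iff.2 h)
      · exact Or.inr ⟨by rw [h.1], h.2⟩
    · rintro i j (h | h)
      · exact Or.inl (Sum.Lex.inr_lt_inr_iff.2 h)
      · exact Or.inr ⟨by rw [h.1], h.2⟩
    · intro x hx z hz
      obtain ⟨i, -, rfl⟩ := List.mem_map.1 hx
      obtain ⟨j, -, rfl⟩ := List.mem_map.1 hz
      exact Or.inl (Sum.Lex.inl_lt_inr i j)
  · rintro ⟨l₀, h⟩
    obtain ⟨i, l', rfl⟩ := List.exists_cons_of_ne_nil hne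
    have h1 : toLex (Sum.inr i) ∈ (f l₀).1 := by rw [h]; simp
    obtain ⟨j, -, hj⟩ := List.mem_map.1 h1
    exact Sum.inl_ne_inr (toLex.injective hj)
  · simp only [List.map_append, List.map_map, List.prod_append]
    rw [wd, word]
    congr 3
    · exact funext hal
    · exact funext har

end Frame
end WDatum
end LieSuperalgebra

/-! ### Dual functionals, and invariants with prescribed values. -/

theorem LinearIndependent.exists_functional {ι V : Type*} [AddCommGroup V] [Module ℂ V] {v : ι → V}
    (hv : LinearIndependent ℂ v) (y : ι → ℂ) : ∃ f : V →ₗ[ℂ] ℂ, ∀ i, f (v i) = y i := by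
  obtain ⟨f, hf⟩ := LinearMap.exists_extend ((Module.Basis.span hv).constr ℂ y)
  refine ⟨f, fun i => ?_⟩
  have h1 := (Module.Basis.span hv).constr_basis ℂ y i
  rw [← hf, LinearMap.comp_apply, Submodule.subtype_apply, Module.Basis.span_apply] at h1
  exact h1

namespace LieSuperalgebra

variable {g : Type w} [AddCommGroup g] [Module ℂ g] {L : LieSuperalgebra g}

theorem envParityPow_envParityPow (p q : ZMod 2) (u : L.Env) :
    envParityPow p (envParityPow q u) = envParityPow (p + q) u := by
  rcases parity_cases p with rfl | rfl <;> rcases parity_cases q with rfl | rfl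
  · simp [envParityPow]
  · simp [envParityPow]
  · simp [envParityPow]
  · rw [show (1 + 1 : ZMod 2) = 0 by decide]
    simp [envParityPow, envParity_envParity]

theorem adEnv_bracket {p q : ZMod 2} {x y : g} (hx : x ∈ L.part p) (hy : y ∈ L.part q) (u : L.Env) :
    L.adEnv x (L.adEnv y u) - koszulSign p q • L.adEnv y (L.adEnv x u) =
      L.adEnv (L.bracket x y) u := by
  have h1 := L.ι_mul_ι p q hx hy
  have h2 : L.ι (L.bracket x y) = L.ι x * L.ι y - koszulSign p q • (L.ι y * L.ι x) := by
    rw [h1, add_sub_cancel_left]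
  have hs := koszulSign_mul_self p q
  simp only [adEnv_of_mem hx, adEnv_of_mem hy, adEnv_of_mem (L.bracket_mem p q x y hx hy), map_sub,
    map_mul, envParityPow_ι p hy, envParityPow_ι q hx, envParityPow_envParityPow, h2, sub_mul,
    mul_sub, smul_mul_assoc, mul_smul_comm, smul_sub, smul_smul, mul_assoc, koszulSign_comm q p, hs,
    one_smul, add_comm q p]
  abel

namespace WDatum

variable {B : LinearMap.BilinForm ℂ g} {e : g} {D : L.WDatum B e}

namespace Frame

variable (F : D.Frame)

/-- The superadjoint action of the entries of a list, the first entry acting first. -/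
def adWord : List (Fin F.n) → L.Env →ₗ[ℂ] L.Env
  | [] => LinearMap.id
  | i :: l => adWord l ∘ₗ adEnvHom (F.x i)

theorem adWord_append (l l' : List (Fin F.n)) (u : L.Env) :
    F.adWord (l ++ l') u = F.adWord l' (F.adWord l u) := by
  induction l generalizing u with
  | nil => rfl
  | cons i l ih => exact ih _

/-- Functionals on `U(g)` which vanish on `I_χ` and are given by pairings of lists on leading
terms. -/
structure IsDualFamily (ψ : List (Fin F.n) → (L.Env →ₗ[ℂ] ℂ)) : Prop where
  zero : ∀ b, ∀ u ∈ D.leftIdeal, ψ b u = 0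
  wd : ∀ b l, F.Cond (F.deg b) b.length l → ψ b (F.wd l) = listPairing F.p b l

/-- The functionals of a dual family, twisted by the superadjoint action of `𝔪'`. -/
def twist (ψ : List (Fin F.n) → (L.Env →ₗ[ℂ] ℂ)) : List (Fin F.n) → (L.Env →ₗ[ℂ] ℂ)
  | [] => ψ []
  | i :: l => if i.1 < F.a then twist ψ l ∘ₗ adEnvHom (F.x i) else ψ (i :: l)

variable {F}

theorem listPairing_eq_zero_of_deg {b l : List (Fin F.n)}
    (h : F.deg l ≠ F.deg b ∨ l.length ≠ b.length) : listPairing F.p b l = 0 := by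
  refine listPairing_eq_zero _ fun hp => ?_
  rcases h with h | h
  · exact h (F.deg_perm hp).symm
  · exact h hp.length_eq.symm

theorem IsDualFamily.eq_zero {ψ : List (Fin F.n) → (L.Env →ₗ[ℂ] ℂ)} (h : F.IsDualFamily ψ) {n r : ℤ}
    {b : List (Fin F.n)} (hn : n < F.deg b ∨ n = F.deg b ∧ (b.length : ℤ) < r) {u : L.Env}
    (hu : u ∈ F.filt n r) : ψ b u = 0 := by
  refine F.filt_induction (P := fun u => ψ b u = 0) (h.zero b) ?_ ?_ ?_ hu
  · intro l hl
    rw [Cond] at hl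
    rw [h.wd b l (by rw [Cond]; omega), listPairing_eq_zero_of_deg (by omega)]
  · intro u v hu hv
    rw [map_add, hu, hv, add_zero]
  · intro c u hu
    rw [map_smul, hu, smul_zero]

variable (F)

theorem twist_append_of_lt (ψ : List (Fin F.n) → (L.Env →ₗ[ℂ] ℂ)) {k b : List (Fin F.n)}
    (hk : ∀ i ∈ k, i.1 < F.a) (hb : ∀ i ∈ b, ¬ i.1 < F.a) (u : L.Env) :
    F.twist ψ (k ++ b) u = ψ b (F.adWord k u) := by
  induction k generalizing u with
  | nil =>
    cases b with
    | nil => rfl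
    | cons i b =>
      rw [List.nil_append, twist, if_neg (hb i (by simp))]
      rfl
  | cons i k ih =>
    rw [List.cons_append, twist, if_pos (hk i (by simp)), LinearMap.comp_apply,
      ih (fun j hj => hk j (by simp [hj]))]
    rfl

theorem twist_of_not_lt (ψ : List (Fin F.n) → (L.Env →ₗ[ℂ] ℂ)) {b : List (Fin F.n)}
    (hb : ∀ i ∈ b, ¬ i.1 < F.a) : F.twist ψ b = ψ b :=
  LinearMap.ext fun u => F.twist_append_of_lt ψ (k := []) (by simp) hb u

theorem exists_append_of_sorted {l : List (Fin F.n)} (hl : IsSortedWord F.p l) :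
    ∃ k b, l = k ++ b ∧ (∀ i ∈ k, i.1 < F.a) ∧ ∀ i ∈ b, ¬ i.1 < F.a := by
  induction l with
  | nil => exact ⟨[], [], rfl, by simp, by simp⟩
  | cons i l ih =>
    obtain ⟨k, b, rfl, hk, hb⟩ := ih hl.tail
    by_cases hi : i.1 < F.a
    · refine ⟨i :: k, b, rfl, ?_, hb⟩
      intro j hj
      rcases List.mem_cons.1 hj with rfl | hj
      · exact hi
      · exact hk j hj
    · refine ⟨[], i :: (k ++ b), rfl, by simp, ?_⟩
      intro j hj
      rcases List.mem_cons.1 hj with rfl | hj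
      · exact hi
      · have h1 : i ≤ j := (List.pairwise_cons.1 hl.pairwise_le).1 j hj
        have h2 : i.1 ≤ j.1 := h1
        omega

variable (he : e ∈ L.part 0) (hB : L.IsBasicForm B)

include he hB

theorem wd_sub_swap_mem (l₁ : List (Fin F.n)) (i j : Fin F.n) (l₂ : List (Fin F.n)) :
    F.wd (l₁ ++ i :: j :: l₂) - koszulSign (F.p i) (F.p j) • F.wd (l₁ ++ j :: i :: l₂) ∈
      F.filt (F.deg (l₁ ++ i :: j :: l₂) - 2) 0 := by
  have h1 : F.wd (l₁ ++ i :: j :: l₂) - koszulSign (F.p i) (F.p j) • F.wd (l₁ ++ j :: i :: l₂) =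
      F.wd l₁ * (L.ι (L.bracket (F.c i) (F.c j)) * F.wd l₂) := by
    have h2 := L.ι_mul_ι _ _ (F.c_mem i).2 (F.c_mem j).2
    simp only [wd_append, wd_cons]
    rw [← mul_assoc (L.ι (F.c i)), h2, add_mul, mul_add, smul_mul_assoc, mul_smul_comm, mul_assoc,
      add_sub_cancel_left]
  rw [h1]
  have h2 := F.ι_mul_wd_mem he hB (bracket_piece D.h_mem (F.c_mem i) (F.c_mem j)) l₂
  refine F.filt_mono ?_ (F.wspan_mul_filt
    (F.wd_mem_wspan (n := F.deg l₁) (r := 0) (Or.inr ⟨rfl, Int.natCast_nonneg _⟩)) h2)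
  simp only [deg_append, deg_cons]
  omega

theorem filt_le_sorted (n r : ℤ) : F.filt n r ≤ D.leftIdeal.restrictScalars ℂ ⊔
    Submodule.span ℂ (F.wd '' {l | F.Cond n r l ∧ IsSortedWord F.p l}) := by
  refine sup_le le_sup_left (Submodule.span_le.2 ?_)
  rintro _ ⟨l, hl, rfl⟩
  refine straightening (p := F.p) F.wd _ F.d (F.Cond n r) ?_ ?_ ?_ l hl
  · intro l l' hp h
    rw [Cond] at h ⊢
    rwa [← F.deg_perm hp, ← hp.length_eq]
  · exact fun l hl hs => Submodule.mem_sup_right (Submodule.subset_span ⟨l, ⟨hl, hs⟩, rfl⟩)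
  · intro l₁ i j l₂ hP ih
    refine F.filt_induction (P := fun u => u ∈ D.leftIdeal.restrictScalars ℂ ⊔
      Submodule.span ℂ (F.wd '' {l | F.Cond n r l ∧ IsSortedWord F.p l}))
      (fun u hu => Submodule.mem_sup_left hu) ?_ (fun _ _ => add_mem)
      (fun c u hu => Submodule.smul_mem _ c hu) (F.wd_sub_swap_mem he hB l₁ i j l₂)
    intro k hk
    have h1 : F.deg k < F.deg (l₁ ++ i :: j :: l₂) := by rw [Cond] at hk; omega
    refine ih k ?_ (by rw [deg, deg] at h1; exact_mod_cast h1)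
    rw [Cond] at hP ⊢
    omega

theorem exists_mem_filt [FiniteDimensional ℂ g]
    (hnil : IsNilpotent (L.bracket e : Module.End ℂ g)) (u : L.Env) :
    ∃ n, u ∈ F.filt n 0 := by
  have hadd : ∀ u v : L.Env, (∃ n, u ∈ F.filt n 0) → (∃ n, v ∈ F.filt n 0) →
      ∃ n, u + v ∈ F.filt n 0 := by
    rintro u v ⟨n, hn⟩ ⟨m, hm⟩
    exact ⟨max n m, add_mem (F.filt_mono (by omega) hn) (F.filt_mono (by omega) hm)⟩
  have hι : ∀ x : g, ∀ u : L.Env, (∃ n, u ∈ F.filt n 0) → ∃ n, L.ι x * u ∈ F.filt n 0 := by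
    intro x
    refine D.piece_induction he hnil
      (P := fun x => ∀ u : L.Env, (∃ n, u ∈ F.filt n 0) → ∃ n, L.ι x * u ∈ F.filt n 0) ?_ ?_ x
    · rintro k q x hx u ⟨n, hn⟩
      exact ⟨_, F.ι_mul_mem he hB hx hn⟩
    · intro x y hx hy u hu
      rw [map_add, add_mul]
      exact hadd _ _ (hx u hu) (hy u hu)
  have hword : ∀ l : List g, ∃ n, L.word id l ∈ F.filt n 0 := by
    intro l
    induction l with
    | nil => exact ⟨0, F.wd_mem_filt (l := []) (Or.inr ⟨rfl, le_rfl⟩)⟩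
    | cons x l ih => rw [word_cons]; exact hι _ _ ih
  have hu : u ∈ Submodule.span ℂ (Set.range (L.word (id : g → g))) := by
    rw [L.span_range_word (by simp)]; trivial
  induction hu using Submodule.span_induction with
  | mem x hx => obtain ⟨l, rfl⟩ := hx; exact hword l
  | zero => exact ⟨0, zero_mem _⟩
  | add x y _ _ hx hy => exact hadd _ _ hx hy
  | smul c x _ hx => obtain ⟨n, hn⟩ := hx; exact ⟨n, Submodule.smul_mem _ c hn⟩

/-- The values are prescribed on sorted words, which are independent in `Q_χ`. They propagate to
unsorted words, since words and pairing satisfy the same exchange rule up to terms of smaller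
degree, where both sides vanish. -/
theorem exists_isDualFamily (hL : L.IsBasicClassical)
    (hnil : IsNilpotent (L.bracket e : Module.End ℂ g)) : ∃ ψ, F.IsDualFamily ψ := by
  have key : ∀ b, ∃ f : L.Env →ₗ[ℂ] ℂ, (∀ u ∈ D.leftIdeal, f u = 0) ∧
      ∀ l, F.Cond (F.deg b) b.length l → f (F.wd l) = listPairing F.p b l := by
    intro b
    obtain ⟨f, hf⟩ := (F.linearIndependent_wd he hB hL hnil).exists_functional
      fun l => listPairing F.p b l.1
    have h0 : ∀ u ∈ D.leftIdeal, (f ∘ₗ (D.leftIdeal.restrictScalars ℂ).mkQ) u = 0 := by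
      intro u hu
      have h1 : (D.leftIdeal.restrictScalars ℂ).mkQ u = 0 := by
        rw [← LinearMap.mem_ker, Submodule.ker_mkQ]
        exact hu
      rw [LinearMap.comp_apply, h1, map_zero]
    refine ⟨f ∘ₗ (D.leftIdeal.restrictScalars ℂ).mkQ, h0, ?_⟩
    have hs : ∀ l, IsSortedWord F.p l →
        (f ∘ₗ (D.leftIdeal.restrictScalars ℂ).mkQ) (F.wd l) = listPairing F.p b l :=
      fun l hl => hf ⟨l, hl⟩
    generalize f ∘ₗ (D.leftIdeal.restrictScalars ℂ).mkQ = f' at h0 hs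
    intro l hl
    rw [← sub_eq_zero, ← Submodule.mem_bot ℂ]
    refine straightening (p := F.p) (fun l => f' (F.wd l) - listPairing F.p b l) ⊥ F.d
      (F.Cond (F.deg b) b.length) ?_ ?_ ?_ l hl
    · intro l l' hp h
      rw [Cond] at h ⊢
      rwa [← F.deg_perm hp, ← hp.length_eq]
    · intro l _ hl
      rw [hs l hl, sub_self]
      exact zero_mem _
    · intro l₁ i j l₂ hP ih
      rw [listPairing_swap, smul_eq_mul, mul_sub, sub_sub_sub_cancel_right, Submodule.mem_bot,
        ← smul_eq_mul, ← map_smul, ← map_sub]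
      refine F.filt_induction (P := fun u => f' u = 0) h0 ?_ ?_ ?_
        (F.wd_sub_swap_mem he hB l₁ i j l₂)
      · intro k hk
        rw [Cond] at hP hk
        have h1 : F.deg k < F.deg (l₁ ++ i :: j :: l₂) := by omega
        have h2 := ih k (by rw [Cond]; omega) (by rw [deg, deg] at h1; exact_mod_cast h1)
        rw [Submodule.mem_bot, sub_eq_zero] at h2
        rw [h2, listPairing_eq_zero_of_deg (by omega)]
      · intro u v hu hv
        rw [map_add, hu, hv, add_zero]
      · intro c u hu
        rw [map_smul, hu, smul_zero]
  choose ψ h1 h2 using key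
  exact ⟨ψ, h1, h2⟩

section

variable {F} {ψ : List (Fin F.n) → (L.Env →ₗ[ℂ] ℂ)} (hψ : F.IsDualFamily ψ)

include hψ

/-- Acting by `ad x_i` deletes the letter `i` from leading terms, and the pairing of lists is
defined by the same deletion, so twisting preserves the leading values. -/
theorem IsDualFamily.twist : F.IsDualFamily (F.twist ψ) := by
  have key : ∀ b, (∀ u ∈ D.leftIdeal, F.twist ψ b u = 0) ∧
      ∀ l, F.Cond (F.deg b) b.length l → F.twist ψ b (F.wd l) = listPairing F.p b l := by
    intro b
    induction b with
    | nil => exact ⟨hψ.zero [], hψ.wd []⟩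
    | cons i b ih =>
      by_cases hi : i.1 < F.a
      · rw [Frame.twist, if_pos hi]
        refine ⟨fun u hu => ih.1 _ (adEnv_mem_leftIdeal he hB (F.x_mem_m' i hi) hu), ?_⟩
        intro l hl
        rw [Cond, deg_cons, List.length_cons] at hl
        push_cast at hl
        have h1 := F.adEnv_wd he hB i hi l
        have h2 : F.twist ψ b (L.adEnv (F.x i) (F.wd l) - deleteSum F.p i F.wd l) = 0 := by
          refine F.filt_induction (P := fun u => F.twist ψ b u = 0) ih.1 ?_ ?_ ?_ h1
          · intro k hk
            rw [Cond] at hk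
            rw [ih.2 k (by rw [Cond]; omega), listPairing_eq_zero_of_deg (by omega)]
          · intro u v hu hv
            rw [map_add, hu, hv, add_zero]
          · intro c u hu
            rw [map_smul, hu, smul_zero]
        rw [map_sub, sub_eq_zero] at h2
        rw [LinearMap.comp_apply, adEnvHom_apply, h2, deleteSum_map, listPairing]
        refine deleteSum_congr F.p i l fun l' hl' => ih.2 l' ?_
        have h3 := F.deg_perm hl'
        have h4 := hl'.length_eq
        rw [deg_cons] at h3
        rw [List.length_cons] at h4
        rw [Cond]
        omega
      · rw [Frame.twist, if_neg hi]
        exact ⟨hψ.zero _, hψ.wd _⟩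
  exact ⟨fun b => (key b).1, fun b => (key b).2⟩

omit he hB in
theorem IsDualFamily.isTriangular (n : ℤ) : IsTriangular
    (fun l : {l : List (Fin F.n) // F.Cond n 0 l ∧ IsSortedWord F.p l} => F.wd l.1)
    (fun l => ψ l.1) (fun l => F.deg l.1) (fun l => l.1.length) := by
  constructor
  · intro b l h
    rw [hψ.wd _ _ (Or.inl h), listPairing_eq_zero_of_deg (Or.inl h.ne)]
  · intro b l h h'
    rw [hψ.wd _ _ (Or.inr ⟨h, by exact_mod_cast h'.le⟩), listPairing_eq_zero_of_deg (Or.inr h'.ne')]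
  · intro b l h h' hne
    rw [hψ.wd _ _ (Or.inr ⟨h, by exact_mod_cast h'.le⟩),
      listPairing_eq_zero_of_ne b.2.2 l.2.2 fun h => hne (Subtype.ext h)]
  · intro b
    rw [hψ.wd _ _ (Or.inr ⟨rfl, le_rfl⟩)]
    exact listPairing_self_ne_zero b.2.2

/-- An element of `U(g)` is in `I_χ` if all functionals of a dual family vanish on it. -/
theorem IsDualFamily.mem_leftIdeal {n : ℤ} {u : L.Env} (hu : u ∈ F.filt n 0)
    (h0 : ∀ b, IsSortedWord F.p b → ψ b u = 0) : u ∈ D.leftIdeal := by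
  obtain ⟨v, hv, q, hq, rfl⟩ := Submodule.mem_sup.1 (F.filt_le_sorted he hB n 0 hu)
  have h1 : q = 0 := by
    refine (hψ.isTriangular n).eq_zero_of_mem_span ?_ fun b => ?_
    · rwa [Set.image_eq_range] at hq
    · have := h0 b.1 b.2.2
      rwa [map_add, hψ.zero _ _ hv, zero_add] at this
  rw [h1, add_zero]
  exact hv

/-- An invariant is determined modulo `I_χ` by the functionals given by words in `g_e`. -/
theorem IsDualFamily.mem_leftIdeal_of_invariant {n : ℤ} {u : L.Env} (hu : u ∈ F.filt n 0)
    (hinv : ∀ i : Fin F.n, i.1 < F.a → L.adEnv (F.x i) u ∈ D.leftIdeal)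
    (h0 : ∀ b, IsSortedWord F.p b → (∀ i ∈ b, ¬ i.1 < F.a) → ψ b u = 0) : u ∈ D.leftIdeal := by
  -- A twisted functional whose word begins with a letter of `𝔪'` kills every invariant; the other
  -- sorted words lie entirely in `g_e`.
  refine (hψ.twist he hB).mem_leftIdeal he hB hu fun b hb => ?_
  cases b with
  | nil => exact h0 [] hb (by simp)
  | cons i b =>
    by_cases hi : i.1 < F.a
    · rw [Frame.twist, if_pos hi]
      exact (hψ.twist he hB).zero _ _ (hinv i hi)
    · rw [Frame.twist, if_neg hi]
      refine h0 _ hb ?_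
      intro j hj
      rcases List.mem_cons.1 hj with rfl | hj
      · exact hi
      · have h1 : i ≤ j := (List.pairwise_cons.1 hb.pairwise_le).1 j hj
        have h2 : i.1 ≤ j.1 := h1
        omega

omit he hB hψ in
theorem finite_cond (n : ℤ) : Finite {l : List (Fin F.n) // F.Cond n 0 l ∧ IsSortedWord F.p l} := by
  refine Set.Finite.to_subtype ((List.finite_length_le (Fin F.n) n.toNat).subset ?_)
  rintro l ⟨hl, -⟩
  rw [Cond] at hl
  have := F.length_le_deg l
  rw [Set.mem_ofPred_eq]
  omega

/-- There are invariants with prescribed values of the functionals given by words in `g_e`. -/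
theorem IsDualFamily.exists_invariant (n : ℤ) (y : List (Fin F.n) → ℂ) : ∃ u ∈ F.filt n 0,
    (∀ i : Fin F.n, i.1 < F.a → L.adEnv (F.x i) u ∈ D.leftIdeal) ∧
      ∀ b, IsSortedWord F.p b → F.deg b ≤ n → (∀ i ∈ b, ¬ i.1 < F.a) → ψ b u = y b := by
  classical
  have := F.finite_cond n
  -- Solve for the twisted functionals: the prescribed values at words in `g_e`, and zero at all
  -- sorted words containing a letter of `𝔪'`.
  obtain ⟨u, hu, hval⟩ := ((hψ.twist he hB).isTriangular n).exists_unique_values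
    fun l => if ∀ i ∈ l.1, ¬ i.1 < F.a then y l.1 else 0
  have hun : u ∈ F.filt n 0 := by
    refine Submodule.span_le.2 ?_ hu
    rintro _ ⟨l, rfl⟩
    exact F.wd_mem_filt l.2.1
  refine ⟨u, hun, ?_, ?_⟩
  · have hzero : ∀ l, IsSortedWord F.p l → (¬ ∀ i ∈ l, ¬ i.1 < F.a) → F.twist ψ l u = 0 := by
      intro l hl hne
      by_cases hdeg : F.deg l ≤ n
      · have h1 := hval ⟨l, by rw [Cond]; omega, hl⟩
        rwa [if_neg hne] at h1
      · exact (hψ.twist he hB).eq_zero (Or.inl (not_le.1 hdeg)) hun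
    -- The twisted functionals give the vanishing for sorted `k`. As `𝔪'` acts by a representation
    -- and its brackets are combinations of the `x_i`, straightening extends it to all nonempty `k`.
    have hG : ∀ b, IsSortedWord F.p b → (∀ i ∈ b, ¬ i.1 < F.a) → ∀ k : List (Fin F.n), k ≠ [] →
        (∀ i ∈ k, i.1 < F.a) → ψ b (F.adWord k u) = 0 := by
      intro b hb hba k hk hka
      rw [← Submodule.mem_bot ℂ]
      refine straightening (p := F.p) (fun k => ψ b (F.adWord k u)) ⊥ (fun _ => 1)
        (fun k => k ≠ [] ∧ ∀ i ∈ k, i.1 < F.a) ?_ ?_ ?_ k ⟨hk, hka⟩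
      · rintro l l' hp ⟨h1, h2⟩
        refine ⟨?_, fun i hi => h2 i (hp.mem_iff.2 hi)⟩
        rintro rfl
        exact h1 hp.eq_nil
      · rintro k ⟨hk, hka⟩ hs
        rw [Submodule.mem_bot, ← F.twist_append_of_lt ψ hka hba]
        refine hzero _ ?_ ?_
        · refine List.pairwise_append.2 ⟨hs, hb, fun i hi j hj => Or.inl ?_⟩
          have h1 := hka i hi
          have h2 := hba j hj
          exact Fin.lt_def.2 (by omega)
        · intro h
          obtain ⟨i, k', rfl⟩ := List.exists_cons_of_ne_nil hk
          exact h i (by simp) (hka i (by simp))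
      · rintro l₁ i j l₂ ⟨-, hP⟩ ih
        have hi := hP i (by simp)
        have hj := hP j (by simp)
        have h1 : ψ b (F.adWord (l₁ ++ i :: j :: l₂) u) -
            koszulSign (F.p i) (F.p j) • ψ b (F.adWord (l₁ ++ j :: i :: l₂) u) =
            ψ b (F.adWord l₂ (adEnvHom (L.bracket (F.x j) (F.x i)) (F.adWord l₁ u))) := by
          rw [adEnvHom_apply, ← adEnv_bracket (F.x_mem j hj).2 (F.x_mem i hi).2, map_sub, map_sub,
            map_smul, map_smul, koszulSign_comm, adWord_append, adWord_append]
          rfl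
        rw [h1]
        have h2 : L.bracket (F.x j) (F.x i) ∈ D.m' :=
          D.m_le_m' (D.bracket_mem_m (F.x_mem_m' j hj) (F.x_mem_m' i hi))
        refine (ψ b ∘ₗ F.adWord l₂ ∘ₗ adEnvHom.flip (F.adWord l₁ u)).apply_mem_of_mem_span ?_
          (F.m'_le h2)
        rintro _ ⟨k, hk, rfl⟩
        have h3 := ih (l₁ ++ k :: l₂) ⟨by simp, ?_⟩ (by simp)
        · rwa [adWord_append] at h3
        · intro i' hi'
          rcases List.mem_append.1 hi' with h | h
          · exact hP _ (by simp [h])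
          · rcases List.mem_cons.1 h with rfl | h
            · exact hk
            · exact hP _ (by simp [h])
    intro i hi
    -- Test `ad x_i u` with all twisted functionals; each of them applies a nonempty word of `𝔪'`,
    -- starting with `i`, to `u`.
    refine (hψ.twist he hB).mem_leftIdeal he hB (n := n) ?_ ?_
    · exact F.filt_mono (by have := F.d_pos i; omega) (F.adEnv_mem_filt he hB i hi hun)
    · intro b hb
      obtain ⟨k, b', rfl, hk, hb'⟩ := F.exists_append_of_sorted hb
      rw [F.twist_append_of_lt ψ hk hb']
      refine hG b' (List.pairwise_append.1 hb).2.1 hb' (i :: k) (by simp) ?_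
      intro j hj
      rcases List.mem_cons.1 hj with rfl | hj
      · exact hi
      · exact hk j hj
  · intro b hb hdeg hba
    have h1 := hval ⟨b, by rw [Cond]; omega, hb⟩
    rw [if_pos hba] at h1
    rwa [F.twist_of_not_lt ψ hba] at h1

end

end Frame
end WDatum
end LieSuperalgebra

/-! ### The oscillator correction of the elements of weight zero. -/

namespace LieSuperalgebra

variable {g : Type w} [AddCommGroup g] [Module ℂ g] {L : LieSuperalgebra g}

namespace WDatum

variable {B : LinearMap.BilinForm ℂ g} {e : g} (D : L.WDatum B e)

/-- The left ideal generated by the elements `x - χ(x)` with `x` of weight at most `-2`. -/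
def lowIdeal : Ideal L.Env := Ideal.span {w | ∃ k q, k ≤ -2 ∧ ∃ x ∈ L.piece D.h k q,
  w = L.ι x - algebraMap ℂ L.Env (B e x)}

theorem lowIdeal_le : D.lowIdeal ≤ D.leftIdeal := by
  refine Ideal.span_le.2 ?_
  rintro _ ⟨k, q, hk, x, hx, rfl⟩
  exact sub_mem_leftIdeal (D.weightSpace_le_m hk hx.1)

variable {D}

theorem smul_mem_lowIdeal (c : ℂ) {u : L.Env} (hu : u ∈ D.lowIdeal) : c • u ∈ D.lowIdeal := by
  rw [Algebra.smul_def]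
  exact Ideal.mul_mem_left _ _ hu

theorem sub_mem_lowIdeal {k : ℤ} {q : ZMod 2} (hk : k ≤ -2) {x : g} (hx : x ∈ L.piece D.h k q) :
    L.ι x - algebraMap ℂ L.Env (B e x) ∈ D.lowIdeal :=
  Ideal.subset_span ⟨k, q, hk, x, hx, rfl⟩

variable (he : e ∈ L.part 0) (hB : L.IsBasicForm B)

include hB

theorem chi_bracket_eq_zero_of_centralizes {x : g} (hx : L.bracket e x = 0) (u : g) :
    B e (L.bracket x u) = 0 := by
  rw [← hB.invariant, hx, map_zero, LinearMap.zero_apply]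

include he

theorem ι_mem_lowIdeal {k : ℤ} {q : ZMod 2} (hk : k ≤ -3) {x : g} (hx : x ∈ L.piece D.h k q) :
    L.ι x ∈ D.lowIdeal := by
  have h1 := sub_mem_lowIdeal (by omega) hx
  rwa [D.chi_eq_zero he hB (Or.inl (by omega)) hx, map_zero, sub_zero] at h1

/-- Moving `z` to the left creates a bracket of weight at most `-3`, where `χ` vanishes. Allowing
`g(-1)` on the right, which `I_χ` does not in general, is what makes quadratic expressions in
`g(-1)` manageable. -/
theorem lowIdeal_mul_ι {q : ZMod 2} {z : g} (hz : z ∈ L.piece D.h (-1) q) {u : L.Env}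
    (hu : u ∈ D.lowIdeal) : u * L.ι z ∈ D.lowIdeal := by
  induction hu using Submodule.span_induction with
  | mem u hu =>
    obtain ⟨k, r, hk, x, hx, rfl⟩ := hu
    have hs : koszulSign r q * B e x = B e x := by
      by_cases hr : r = 0
      · rw [hr, koszulSign_zero_left, one_mul]
      · rw [D.chi_eq_zero he hB (Or.inr hr) hx, mul_zero]
    have h1 : (L.ι x - algebraMap ℂ L.Env (B e x)) * L.ι z =
        koszulSign r q • (L.ι z * (L.ι x - algebraMap ℂ L.Env (B e x))) +
          L.ι (L.bracket x z) := by
      rw [sub_mul, L.ι_mul_ι r q hx.2 hz.2, mul_sub, smul_sub, ← Algebra.commutes (B e x) (L.ι z),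
        ← Algebra.smul_def, smul_smul, hs]
      abel
    rw [h1]
    exact add_mem (smul_mem_lowIdeal _ (Ideal.mul_mem_left _ _ (sub_mem_lowIdeal hk hx)))
      (ι_mem_lowIdeal he hB (by omega) (bracket_piece D.h_mem hx hz))
  | zero => rw [zero_mul]; exact zero_mem _
  | add u v _ _ hu hv => rw [add_mul]; exact add_mem hu hv
  | smul a u _ hu => rw [smul_eq_mul, mul_assoc]; exact Ideal.mul_mem_left _ _ hu

omit he hB

variable (D) in
/-- Homogeneous bases of `g(-1)` dual to each other for the form `χ([·, ·])`. -/
structure DualBases where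
  n : ℕ
  z : Fin n → g
  y : Fin n → g
  q : Fin n → ZMod 2
  z_mem : ∀ i, z i ∈ L.piece D.h (-1) (q i)
  y_mem : ∀ i, y i ∈ L.piece D.h (-1) (q i)
  pair : ∀ i j, B e (L.bracket (z i) (y j)) = if i = j then 1 else 0
  le_span : L.weightSpace D.h (-1) ≤ Submodule.span ℂ (Set.range z)

include he hB in
theorem exists_dualBases [FiniteDimensional ℂ g]
    (hnil : IsNilpotent (L.bracket e : Module.End ℂ g)) : Nonempty D.DualBases := by
  obtain ⟨n, z, k, q, hz, -, hzk, hspan⟩ := exists_homogeneous_basis (h := D.h)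
    (L.weightSpace D.h (-1)) (fun k => k = -1) (by
      intro x hx
      have h := weightSpace_graded D.h_mem _ x hx
      rw [← L.even_add_odd x]
      exact add_mem (Submodule.subset_span ⟨h.1, -1, 0, rfl, h.1, L.even_mem x⟩)
        (Submodule.subset_span ⟨h.2, -1, 1, rfl, h.2, L.odd_mem x⟩))
  obtain ⟨y, hy, hzy⟩ := D.exists_dual he hB hnil hz
    (fun i => ⟨by rw [(hzk i).1]; decide, (hzk i).2⟩)
  refine ⟨⟨n, z, y, q, fun i => ?_, fun i => ?_, hzy, hspan⟩⟩
  · have h1 := (hzk i).2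
    rwa [(hzk i).1] at h1
  · have h1 := hy i
    rwa [(hzk i).1] at h1

namespace DualBases

variable (Z : D.DualBases)

theorem sum_z {w : g} (hw : w ∈ L.weightSpace D.h (-1)) :
    ∑ i, B e (L.bracket w (Z.y i)) • Z.z i = w := by
  obtain ⟨α, rfl⟩ := (Submodule.mem_span_range_iff_exists_fun ℂ).1 (Z.le_span hw)
  refine Finset.sum_congr rfl fun i _ => ?_
  congr 1
  rw [map_sum, LinearMap.sum_apply, map_sum, Finset.sum_eq_single i]
  · rw [map_smul, LinearMap.smul_apply, map_smul, Z.pair, if_pos rfl, smul_eq_mul, mul_one]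
  · intro j _ hj
    rw [map_smul, LinearMap.smul_apply, map_smul, Z.pair, if_neg hj, smul_zero]
  · simp

/-- Expansion in `y` with the pairing on the other side: the Gram matrices of the two bases are
inverse to each other on one side, hence on both. -/
theorem sum_y {w : g} (hw : w ∈ L.weightSpace D.h (-1)) :
    ∑ i, B e (L.bracket (Z.z i) w) • Z.y i = w := by
  let P : Matrix (Fin Z.n) (Fin Z.n) ℂ := Matrix.of fun j k => B e (L.bracket (Z.y j) (Z.y k))
  let G : Matrix (Fin Z.n) (Fin Z.n) ℂ := Matrix.of fun k i => B e (L.bracket (Z.z i) (Z.z k))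
  have hPy : ∀ j, ∑ k, P j k • Z.z k = Z.y j := fun j => Z.sum_z (Z.y_mem j).1
  have h1 : P * G = 1 := by
    ext j i
    rw [Matrix.mul_apply, Matrix.one_apply]
    have h2 := Z.pair i j
    rw [← hPy j, map_sum, map_sum] at h2
    simp only [map_smul, smul_eq_mul] at h2
    rw [show (if j = i then (1 : ℂ) else 0) = if i = j then 1 else 0 by simp only [eq_comm], ← h2]
    rfl
  have h2 : G * P = 1 := mul_eq_one_comm.1 h1
  have h3 : ∀ k, ∑ i, B e (L.bracket (Z.z i) (Z.z k)) • Z.y i = Z.z k := by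
    intro k
    calc ∑ i, B e (L.bracket (Z.z i) (Z.z k)) • Z.y i = ∑ i, G k i • ∑ l, P i l • Z.z l :=
          Finset.sum_congr rfl fun i _ => by rw [hPy]; rfl
      _ = ∑ l, (G * P) k l • Z.z l := by
          simp only [Finset.smul_sum, smul_smul, Matrix.mul_apply, Finset.sum_smul]
          exact Finset.sum_comm
      _ = Z.z k := by
          rw [h2, Finset.sum_eq_single k]
          · rw [Matrix.one_apply_eq, one_smul]
          · intro l _ hl
            rw [Matrix.one_apply_ne hl.symm, zero_smul]
          · simp
  obtain ⟨α, rfl⟩ := (Submodule.mem_span_range_iff_exists_fun ℂ).1 (Z.le_span hw)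
  simp only [map_sum, map_smul, Finset.sum_smul, smul_eq_mul]
  rw [Finset.sum_comm]
  refine Finset.sum_congr rfl fun k _ => ?_
  conv_rhs => rw [← h3 k, Finset.smul_sum]
  exact Finset.sum_congr rfl fun i _ => by rw [smul_smul]

/-- The quadratic expression `∑ [x, y_i] z_i`. -/
def quad : g →ₗ[ℂ] L.Env :=
  ∑ i, LinearMap.mulRight ℂ (L.ι (Z.z i)) ∘ₗ L.ι ∘ₗ L.bracket.flip (Z.y i)

theorem quad_apply (x : g) : Z.quad x = ∑ i, L.ι (L.bracket x (Z.y i)) * L.ι (Z.z i) := by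
  simp [quad]

/-- The oscillator correction of the elements of weight `0`. -/
def osc : g →ₗ[ℂ] L.Env := L.ι - (2⁻¹ : ℂ) • Z.quad

theorem osc_apply (x : g) : Z.osc x = L.ι x - (2⁻¹ : ℂ) • Z.quad x := rfl

theorem envParityPow_quad (r : ZMod 2) {p : ZMod 2} {x : g} (hx : x ∈ L.part p) :
    envParityPow r (Z.quad x) = koszulSign r p • Z.quad x := by
  rw [quad_apply, map_sum, Finset.smul_sum]
  refine Finset.sum_congr rfl fun i _ => ?_
  rw [map_mul, envParityPow_ι r (L.bracket_mem _ _ _ _ hx (Z.y_mem i).2),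
    envParityPow_ι r (Z.z_mem i).2, smul_mul_smul_comm, koszulSign_add_right, mul_assoc,
    koszulSign_mul_self, mul_one]

theorem envParityPow_osc (r : ZMod 2) {p : ZMod 2} {x : g} (hx : x ∈ L.part p) :
    envParityPow r (Z.osc x) = koszulSign r p • Z.osc x := by
  rw [osc_apply, map_sub, map_smul, Z.envParityPow_quad r hx, envParityPow_ι r hx, smul_sub,
    smul_comm]

theorem adEnv_quad {r p : ZMod 2} {w x : g} (hw : w ∈ L.part r) (hx : x ∈ L.part p) :
    L.adEnv w (Z.quad x) = ∑ i, (L.ι (L.bracket w (L.bracket x (Z.y i))) * L.ι (Z.z i) +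
      koszulSign r (p + Z.q i) • (L.ι (L.bracket x (Z.y i)) * L.ι (L.bracket w (Z.z i)))) := by
  rw [quad_apply, ← adEnvHom_apply, map_sum]
  refine Finset.sum_congr rfl fun i _ => ?_
  rw [adEnvHom_apply, adEnv_ι_mul hw (L.bracket_mem _ _ _ _ hx (Z.y_mem i).2), adEnv_ι hw]

theorem adEnv_osc {r : ZMod 2} {w x : g} (hw : w ∈ L.part r) :
    L.adEnv w (Z.osc x) = L.ι (L.bracket w x) - (2⁻¹ : ℂ) • L.adEnv w (Z.quad x) := by
  rw [osc_apply, ← adEnvHom_apply, map_sub, map_smul, adEnvHom_apply, adEnvHom_apply, adEnv_ι hw]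

include he hB

/-- Modulo `lowIdeal` a bracket in `g(-2)` is its value under `χ`. Thus `ad w` of the quadratic term
becomes two sums, and each is `[w, x]` by expansion in the dual bases and `χ([x, ·]) = 0`. This
explains the factor `½`. -/
theorem adEnv_osc_mem_of_neg_one {r p : ZMod 2} {w x : g} (hw : w ∈ L.piece D.h (-1) r)
    (hx : x ∈ L.piece D.h 0 p) (hxe : L.bracket e x = 0) : L.adEnv w (Z.osc x) ∈ D.lowIdeal := by
  have hwx : L.bracket w x ∈ L.weightSpace D.h (-1) := by
    simpa using (bracket_piece D.h_mem hw hx).1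
  have hskew : L.bracket w x = -(koszulSign r p • L.bracket x w) := L.skew _ _ _ _ hw.2 hx.2
  have hxy : ∀ i, L.bracket x (Z.y i) ∈ L.piece D.h (-1) (p + Z.q i) := fun i => by
    simpa using bracket_piece D.h_mem hx (Z.y_mem i)
  have h1 : ∑ i, B e (L.bracket w (L.bracket x (Z.y i))) • L.ι (Z.z i) = L.ι (L.bracket w x) := by
    conv_rhs => rw [← Z.sum_z hwx, map_sum]
    refine Finset.sum_congr rfl fun i _ => ?_
    rw [map_smul]
    congr 1
    have h2 := L.jacobi _ _ x w (Z.y i) hx.2 hw.2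
    have h3 := congrArg (B e) h2
    rw [chi_bracket_eq_zero_of_centralizes hB hxe, map_add, map_smul, smul_eq_mul] at h3
    rw [hskew, map_neg, map_smul, LinearMap.neg_apply, LinearMap.smul_apply, map_neg, map_smul,
      smul_eq_mul, koszulSign_comm r p]
    have h4 := koszulSign_mul_self p r
    linear_combination (-B e (L.bracket w (L.bracket x (Z.y i)))) * h4 - koszulSign p r * h3
  have h2 : ∑ i, (koszulSign r (p + Z.q i) * B e (L.bracket w (Z.z i))) •
      L.ι (L.bracket x (Z.y i)) = L.ι (L.bracket w x) := by
    have h3 : L.bracket w x = -(koszulSign r p • L.bracket x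
        (∑ i, B e (L.bracket (Z.z i) w) • Z.y i)) := by
      rw [Z.sum_y hw.1, hskew]
    rw [h3, map_sum, Finset.smul_sum, ← Finset.sum_neg_distrib, map_sum]
    refine Finset.sum_congr rfl fun i _ => ?_
    rw [map_neg, map_smul, map_smul, map_smul, smul_smul, ← neg_smul,
      L.skew _ _ _ _ hw.2 (Z.z_mem i).2, map_neg, map_smul, smul_eq_mul, koszulSign_add_right]
    congr 1
    have h4 := koszulSign_mul_self r (Z.q i)
    linear_combination (-koszulSign r p * B e (L.bracket (Z.z i) w)) * h4
  have h3 : L.adEnv w (Z.osc x) = -(2⁻¹ : ℂ) • ∑ i,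
      ((L.ι (L.bracket w (L.bracket x (Z.y i))) -
        algebraMap ℂ L.Env (B e (L.bracket w (L.bracket x (Z.y i))))) * L.ι (Z.z i) +
      koszulSign r (p + Z.q i) • (L.ι (L.bracket x (Z.y i)) * (L.ι (L.bracket w (Z.z i)) -
        algebraMap ℂ L.Env (B e (L.bracket w (Z.z i)))))) := by
    have h4 : ∀ i, (L.ι (L.bracket w (L.bracket x (Z.y i))) -
        algebraMap ℂ L.Env (B e (L.bracket w (L.bracket x (Z.y i))))) * L.ι (Z.z i) +
        koszulSign r (p + Z.q i) • (L.ι (L.bracket x (Z.y i)) * (L.ι (L.bracket w (Z.z i)) -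
        algebraMap ℂ L.Env (B e (L.bracket w (Z.z i))))) =
        (L.ι (L.bracket w (L.bracket x (Z.y i))) * L.ι (Z.z i) +
      koszulSign r (p + Z.q i) • (L.ι (L.bracket x (Z.y i)) * L.ι (L.bracket w (Z.z i)))) -
        (B e (L.bracket w (L.bracket x (Z.y i))) • L.ι (Z.z i) +
        (koszulSign r (p + Z.q i) * B e (L.bracket w (Z.z i))) • L.ι (L.bracket x (Z.y i))) := by
      intro i
      rw [sub_mul, mul_sub, ← Algebra.smul_def, ← Algebra.commutes, ← Algebra.smul_def, smul_sub,
        smul_smul]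
      abel
    rw [Z.adEnv_osc hw.2, Z.adEnv_quad hw.2 hx.2, Finset.sum_congr rfl fun i _ => h4 i,
      Finset.sum_sub_distrib, Finset.sum_add_distrib (f := fun i =>
        B e (L.bracket w (L.bracket x (Z.y i))) • L.ι (Z.z i)), h1, h2]
    module
  rw [h3]
  refine smul_mem_lowIdeal _ (Submodule.sum_mem _ fun i _ => add_mem ?_ (smul_mem_lowIdeal _ ?_))
  · exact lowIdeal_mul_ι he hB (Z.z_mem i)
      (sub_mem_lowIdeal (k := -1 + -1) (by decide) (bracket_piece D.h_mem hw (hxy i)))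
  · exact Ideal.mul_mem_left _ _
      (sub_mem_lowIdeal (k := -1 + -1) (by decide) (bracket_piece D.h_mem hw (Z.z_mem i)))

theorem adEnv_osc_mem_of_le {k : ℤ} (hk : k ≤ -2) {r p : ZMod 2} {w x : g}
    (hw : w ∈ L.piece D.h k r) (hx : x ∈ L.piece D.h 0 p) (hxe : L.bracket e x = 0) :
    L.adEnv w (Z.osc x) ∈ D.lowIdeal := by
  rw [Z.adEnv_osc hw.2, Z.adEnv_quad hw.2 hx.2]
  refine sub_mem ?_ (smul_mem_lowIdeal _ (Submodule.sum_mem _ fun i _ => add_mem ?_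
    (smul_mem_lowIdeal _ (Ideal.mul_mem_left _ _ ?_))))
  · have h1 := sub_mem_lowIdeal (by omega) (bracket_piece D.h_mem hw hx)
    rwa [L.skew _ _ _ _ hw.2 hx.2, map_neg (B e), map_smul (B e),
      chi_bracket_eq_zero_of_centralizes hB hxe, smul_zero, neg_zero, map_zero, sub_zero,
      ← L.skew _ _ _ _ hw.2 hx.2] at h1
  · exact lowIdeal_mul_ι he hB (Z.z_mem i) (ι_mem_lowIdeal he hB (by omega)
      (bracket_piece D.h_mem hw (bracket_piece D.h_mem hx (Z.y_mem i))))
  · exact ι_mem_lowIdeal he hB (by omega) (bracket_piece D.h_mem hw (Z.z_mem i))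

theorem osc_mem_invariants {p : ZMod 2} {x : g} (hx : x ∈ L.piece D.h 0 p)
    (hxe : L.bracket e x = 0) : Z.osc x ∈ D.invariants hB he := by
  intro w hw
  rw [m'_eq_span] at hw
  refine (adEnvHom.flip (Z.osc x)).apply_mem_of_mem_span
    (S := D.leftIdeal.restrictScalars ℂ) ?_ hw
  rintro w ((⟨k, q, hk, hw⟩ | ⟨i, -, rfl⟩) | ⟨i, -, rfl⟩)
  · exact D.lowIdeal_le (Z.adEnv_osc_mem_of_le he hB hk hw hx hxe)
  · exact D.lowIdeal_le (Z.adEnv_osc_mem_of_neg_one he hB (D.u_mem i) hx hxe)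
  · exact D.lowIdeal_le (Z.adEnv_osc_mem_of_neg_one he hB (D.v_mem i) hx hxe)

omit he in
-- An element of `g_e(0)` preserves the form `χ([·, ·])` on `g(-1)`, so it fixes the canonical
-- tensor of the dual bases; what remains is its action on `x`.
theorem adEnv_quad_eq {p p' : ZMod 2} {x y : g} (hx : x ∈ L.piece D.h 0 p)
    (hy : y ∈ L.piece D.h 0 p') (hye : L.bracket e y = 0) :
    L.adEnv y (Z.quad x) = Z.quad (L.bracket y x) := by
  have hyy : ∀ i, L.bracket y (Z.y i) ∈ L.weightSpace D.h (-1) := fun i => by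
    simpa using (bracket_piece D.h_mem hy (Z.y_mem i)).1
  have hyz : ∀ i, L.bracket y (Z.z i) ∈ L.weightSpace D.h (-1) := fun i => by
    simpa using (bracket_piece D.h_mem hy (Z.z_mem i)).1
  have h1 : ∀ i, L.ι (L.bracket y (L.bracket x (Z.y i))) * L.ι (Z.z i) =
      L.ι (L.bracket (L.bracket y x) (Z.y i)) * L.ι (Z.z i) +
        ∑ j, (koszulSign p' p * B e (L.bracket (Z.z j) (L.bracket y (Z.y i)))) •
          (L.ι (L.bracket x (Z.y j)) * L.ι (Z.z i)) := by
    intro i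
    rw [L.jacobi _ _ y x _ hy.2 hx.2, map_add, add_mul, map_smul]
    conv_lhs => rw [← Z.sum_y (hyy i)]
    rw [map_sum, map_sum, Finset.smul_sum, Finset.sum_mul]
    simp only [map_smul, smul_smul, smul_mul_assoc]
  have h2 : ∀ i, koszulSign p' (p + Z.q i) • (L.ι (L.bracket x (Z.y i)) *
      L.ι (L.bracket y (Z.z i))) = ∑ j, -((koszulSign p' p *
        B e (L.bracket (Z.z i) (L.bracket y (Z.y j)))) •
          (L.ι (L.bracket x (Z.y i)) * L.ι (Z.z j))) := by
    intro i
    conv_lhs => rw [← Z.sum_z (hyz i)]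
    rw [map_sum, Finset.mul_sum, Finset.smul_sum]
    refine Finset.sum_congr rfl fun j _ => ?_
    rw [map_smul, mul_smul_comm, smul_smul, ← neg_smul]
    congr 1
    have h3 := congrArg (B e) (L.jacobi _ _ y (Z.z i) (Z.y j) hy.2 (Z.z_mem i).2)
    rw [chi_bracket_eq_zero_of_centralizes hB hye, map_add, map_smul, smul_eq_mul] at h3
    rw [koszulSign_add_right]
    have h4 := koszulSign_mul_self p' (Z.q i)
    linear_combination (-koszulSign p' p * koszulSign p' (Z.q i)) * h3 -
      koszulSign p' p * B e (L.bracket (Z.z i) (L.bracket y (Z.y j))) * h4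
  rw [Z.adEnv_quad hy.2 hx.2, Finset.sum_add_distrib, Finset.sum_congr rfl fun i _ => h1 i,
    Finset.sum_congr rfl fun i _ => h2 i, Finset.sum_add_distrib, quad_apply, add_assoc]
  rw [Finset.sum_comm (f := fun i j => -((koszulSign p' p *
        B e (L.bracket (Z.z i) (L.bracket y (Z.y j)))) •
          (L.ι (L.bracket x (Z.y i)) * L.ι (Z.z j))))]
  simp only [Finset.sum_neg_distrib, add_neg_cancel, add_zero]

/-- The oscillator correction is compatible with the brackets modulo `I_χ`. -/
theorem osc_bracket {p p' : ZMod 2} {x y : g} (hx : x ∈ L.piece D.h 0 p)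
    (hxe : L.bracket e x = 0) (hy : y ∈ L.piece D.h 0 p') (hye : L.bracket e y = 0) :
    Z.osc y * Z.osc x - koszulSign p' p • (Z.osc x * Z.osc y) - Z.osc (L.bracket y x) ∈
      D.leftIdeal := by
  have hyy : ∀ i, L.bracket y (Z.y i) ∈ L.piece D.h (-1) (p' + Z.q i) := fun i => by
    simpa using bracket_piece D.h_mem hy (Z.y_mem i)
  have had : ∀ (r : ZMod 2) (w : g), w ∈ L.part r →
      L.ι w * Z.osc x = L.adEnv w (Z.osc x) + koszulSign r p • (Z.osc x * L.ι w) := by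
    intro r w hw
    rw [adEnv_of_mem hw, Z.envParityPow_osc r hx.2, smul_mul_assoc, sub_add_cancel]
  have h1 : L.adEnv y (Z.osc x) = Z.osc (L.bracket y x) := by
    rw [Z.adEnv_osc hy.2, Z.adEnv_quad_eq hB hx hy hye, osc_apply]
  have h2 : ∀ i, L.ι (L.bracket y (Z.y i)) * L.ι (Z.z i) * Z.osc x -
      koszulSign p' p • (Z.osc x * (L.ι (L.bracket y (Z.y i)) * L.ι (Z.z i))) =
      L.ι (L.bracket y (Z.y i)) * L.adEnv (Z.z i) (Z.osc x) +
        koszulSign (Z.q i) p • (L.adEnv (L.bracket y (Z.y i)) (Z.osc x) * L.ι (Z.z i)) := by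
    intro i
    have hs : koszulSign (Z.q i) p * koszulSign (p' + Z.q i) p = koszulSign p' p := by
      rw [koszulSign_add_left, mul_comm, mul_assoc, koszulSign_mul_self, mul_one]
    rw [mul_assoc, had _ _ (Z.z_mem i).2, mul_add, mul_smul_comm, ← mul_assoc _ (Z.osc x),
      had _ _ (hyy i).2, add_mul, smul_add, smul_mul_assoc, smul_smul, hs, mul_assoc (Z.osc x)]
    abel
  -- The linear term of `osc y` already accounts for `osc [y, x]`. The quadratic term enters only
  -- through `ad` of vectors of weight `-1` on `osc x`, which lies in `lowIdeal`.
  have h3 : Z.osc y * Z.osc x - koszulSign p' p • (Z.osc x * Z.osc y) - Z.osc (L.bracket y x) =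
      -(2⁻¹ : ℂ) • ∑ i, (L.ι (L.bracket y (Z.y i)) * L.adEnv (Z.z i) (Z.osc x) +
        koszulSign (Z.q i) p • (L.adEnv (L.bracket y (Z.y i)) (Z.osc x) * L.ι (Z.z i))) := by
    rw [← Finset.sum_congr rfl fun i _ => h2 i, Finset.sum_sub_distrib, ← Finset.sum_mul,
      ← Finset.smul_sum, ← Finset.mul_sum, ← quad_apply, ← h1]
    rw [Z.osc_apply y, sub_mul, had _ _ hy.2, mul_sub, smul_mul_assoc, mul_smul_comm]
    module
  rw [h3]
  refine D.lowIdeal_le (smul_mem_lowIdeal _ (Submodule.sum_mem _ fun i _ => add_mem ?_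
    (smul_mem_lowIdeal _ ?_)))
  · exact Ideal.mul_mem_left _ _ (Z.adEnv_osc_mem_of_neg_one he hB (Z.z_mem i) hx hxe)
  · exact lowIdeal_mul_ι he hB (Z.z_mem i) (Z.adEnv_osc_mem_of_neg_one he hB (hyy i) hx hxe)

end DualBases

namespace Frame

variable (F : D.Frame)

include he hB

theorem ι_mul_mem_of_chi {k n r : ℤ} {q : ZMod 2} {x : g} (hx : x ∈ L.piece D.h k q)
    (hχ : B e x = 0) {u : L.Env} (hu : u ∈ F.filt n r) :
    L.ι x * u ∈ F.filt (n + k + 2) (r + 1) := by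
  refine F.filt_induction (P := fun u => L.ι x * u ∈ F.filt (n + k + 2) (r + 1)) ?_ ?_ ?_ ?_ hu
  · exact fun v hv => F.leftIdeal_le_filt (Ideal.mul_mem_left _ _ hv)
  · intro l hl
    have h1 := F.ι_mul_wd_sub_chi_mem he hB hx l
    rw [hχ, zero_smul, sub_zero] at h1
    refine F.filt_mono ?_ h1
    rw [Cond] at hl; omega
  · intro a b ha hb
    rw [mul_add]; exact add_mem ha hb
  · intro c a ha
    rw [mul_smul_comm]; exact Submodule.smul_mem _ _ ha

theorem osc_sub_mem (Z : D.DualBases) {p : ZMod 2} {x : g} (hx : x ∈ L.piece D.h 0 p) :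
    Z.osc x - L.ι x ∈ F.filt 2 2 := by
  have hχ : ∀ {q : ZMod 2} {z : g}, z ∈ L.piece D.h (-1) q → B e z = 0 := fun hz =>
    D.chi_eq_zero he hB (Or.inl (by decide)) hz
  rw [Z.osc_apply, Z.quad_apply, sub_sub_cancel_left]
  refine neg_mem (Submodule.smul_mem _ _ (Submodule.sum_mem _ fun i _ => ?_))
  have h0 : (1 : L.Env) ∈ F.filt 0 0 := F.wd_mem_filt (l := []) (Or.inr ⟨rfl, le_rfl⟩)
  have h1 := F.ι_mul_mem_of_chi he hB (Z.z_mem i) (hχ (Z.z_mem i)) h0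
  have hxy : L.bracket x (Z.y i) ∈ L.piece D.h (-1) (p + Z.q i) := by
    simpa using bracket_piece D.h_mem hx (Z.y_mem i)
  have h2 := F.ι_mul_mem_of_chi he hB hxy (hχ hxy) h1
  rw [mul_one] at h2
  exact h2

end Frame
end WDatum
end LieSuperalgebra

/-! ### Commutator estimates and lifts of the basis of `g_e`. -/

namespace LieSuperalgebra

variable {g : Type w} [AddCommGroup g] [Module ℂ g] {L : LieSuperalgebra g}

theorem envParityPow_word (q : ZMod 2) {J : Type*} {b : J → g} {p : J → ZMod 2}
    (hb : ∀ j, b j ∈ L.part (p j)) (l : List J) :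
    envParityPow q (L.word b l) = koszulSign q (l.map p).sum • L.word b l := by
  induction l with
  | nil => simp [koszulSign_zero_right]
  | cons j l ih =>
    rw [word_cons, map_mul, ih, envParityPow_ι q (hb j), smul_mul_smul_comm, List.map_cons,
      List.sum_cons, koszulSign_add_right]

theorem envParity_adEnv (x : g) (u : L.Env) :
    L.envParity (L.adEnv x u) = L.adEnv (L.parityMap x) (L.envParity u) := by
  have h0 : L.parityMap (L.even x) = L.even x := by
    simpa [koszulSign_zero_left] using L.parityMap_apply_of_mem 0 (L.even_mem x)
  have h1 : L.parityMap (L.odd x) = -L.odd x := by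
    simpa [koszulSign_one_one'] using L.parityMap_apply_of_mem 1 (L.odd_mem x)
  have h2 : L.even (L.parityMap x) = L.even x := by
    rw [parityMap, LinearMap.sub_apply, map_sub, L.even_of_even (L.even_mem x),
      L.even_of_odd (L.odd_mem x), sub_zero]
  have h3 : L.odd (L.parityMap x) = -L.odd x := by
    rw [parityMap, LinearMap.sub_apply, map_sub, L.odd_of_even (L.even_mem x),
      L.odd_of_odd (L.odd_mem x), zero_sub]
  simp only [adEnv, map_sub, map_mul, envParity_ι, h0, h1, h2, h3]

namespace WDatum

variable {B : LinearMap.BilinForm ℂ g} {e : g} {D : L.WDatum B e}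
  (he : e ∈ L.part 0) (hB : L.IsBasicForm B)

theorem envParity_mem_invariants {u : L.Env} (hu : u ∈ D.invariants hB he) :
    L.envParity u ∈ D.invariants hB he := by
  intro x hx
  have hx' : L.parityMap x ∈ D.m' := sub_mem (D.m'_graded x hx).1 (D.m'_graded x hx).2
  have h1 := envParity_mem_leftIdeal he hB (hu _ hx')
  rwa [envParity_adEnv, L.parityMap_parityMap] at h1

namespace Frame

variable (F : D.Frame)

section

theorem mem_invariants_iff {u : L.Env} : u ∈ D.invariants hB he ↔
    ∀ i : Fin F.n, i.1 < F.a → L.adEnv (F.x i) u ∈ D.leftIdeal := by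
  refine ⟨fun hu i hi => hu _ (F.x_mem_m' i hi), fun hu x hx => ?_⟩
  refine (adEnvHom.flip u).apply_mem_of_mem_span (S := D.leftIdeal.restrictScalars ℂ) ?_
    (F.m'_le hx)
  rintro _ ⟨i, hi, rfl⟩
  exact hu i hi

/-- The part of `wspan n r` spanned by words of parity `q`. -/
def wspanPart (n r : ℤ) (q : ZMod 2) : Submodule ℂ L.Env :=
  Submodule.span ℂ (F.wd '' {l | F.Cond n r l ∧ (l.map F.p).sum = q})

theorem wspanPart_le (n r : ℤ) (q : ZMod 2) : F.wspanPart n r q ≤ F.wspan n r :=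
  Submodule.span_mono (Set.image_mono fun _ hl => hl.1)

include he hB

theorem exists_sub_mem_leftIdeal {n r : ℤ} {q : ZMod 2} {u : L.Env} (hu : u ∈ F.filt n r)
    (hq : L.envParity u = koszulSign q 1 • u) : ∃ A ∈ F.wspanPart n r q, u - A ∈ D.leftIdeal := by
  obtain ⟨v, hv, A, hA, rfl⟩ := Submodule.mem_sup.1 hu
  let π : L.Env →ₗ[ℂ] L.Env := (2⁻¹ : ℂ) • (LinearMap.id + koszulSign q 1 • L.envParity.toLinearMap)
  have hπ : ∀ u, π u = (2⁻¹ : ℂ) • (u + koszulSign q 1 • L.envParity u) := fun u => rfl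
  refine ⟨π A, ?_, ?_⟩
  · refine π.apply_mem_of_mem_span ?_ hA
    rintro _ ⟨l, hl, rfl⟩
    rw [hπ, wd, envParity_word fun j => (F.c_mem j).2, smul_smul]
    by_cases h : (l.map F.p).sum = q
    · rw [h, koszulSign_mul_self, one_smul]
      have h1 : F.wd l ∈ F.wspanPart n r q := Submodule.subset_span ⟨l, ⟨hl, h⟩, rfl⟩
      exact Submodule.smul_mem _ _ (add_mem h1 h1)
    · have h1 : koszulSign q 1 * koszulSign (l.map F.p).sum 1 = -1 := by
        rw [← koszulSign_add_left]
        have h2 : q + (l.map F.p).sum = 1 := by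
          have h3 : ∀ q q' : ZMod 2, ¬ q' = q → q + q' = 1 := by decide
          exact h3 _ _ h
        rw [h2, koszulSign_one_one']
      rw [h1, neg_one_smul, add_neg_cancel, smul_zero]
      exact zero_mem _
  · have h1 : π (v + A) = v + A := by
      rw [hπ, hq, smul_smul, koszulSign_mul_self, one_smul, ← two_smul ℂ, smul_smul,
        inv_mul_cancel₀ two_ne_zero, one_smul]
    have h2 : v + A - π A = π v := by
      rw [← h1, map_add, add_sub_cancel_right]
    rw [h2, hπ]
    exact smul_mem_leftIdeal _ (add_mem hv (smul_mem_leftIdeal _ (envParity_mem_leftIdeal he hB hv)))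

variable {F} in
-- The functionals of degree `n` and length `r` detect the sorted words of this degree and length,
-- and these are all that separates `filt n r` from `filt n (r + 1)`.
theorem IsDualFamily.mem_filt_succ {ψ : List (Fin F.n) → (L.Env →ₗ[ℂ] ℂ)} (hψ : F.IsDualFamily ψ)
    {n r : ℤ} {u : L.Env} (hu : u ∈ F.filt n r)
    (h0 : ∀ b, IsSortedWord F.p b → F.deg b = n → b.length = r → ψ b u = 0) :
    u ∈ F.filt n (r + 1) := by
  have hle : F.filt n r ≤ F.filt n (r + 1) ⊔
      Submodule.span ℂ (F.wd '' {l | (F.deg l = n ∧ l.length = r) ∧ IsSortedWord F.p l}) := by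
    refine (F.filt_le_sorted he hB n r).trans (sup_le (le_sup_of_le_left le_sup_left) ?_)
    rw [Submodule.span_le]
    rintro _ ⟨l, ⟨hl, hs⟩, rfl⟩
    rw [Cond] at hl
    by_cases h : F.deg l = n ∧ l.length = r
    · exact Submodule.mem_sup_right (Submodule.subset_span ⟨l, ⟨h, hs⟩, rfl⟩)
    · exact Submodule.mem_sup_left (F.wd_mem_filt (by rw [Cond]; omega))
  obtain ⟨v, hv, q, hq, rfl⟩ := Submodule.mem_sup.1 (hle hu)
  have htri : IsTriangular (fun l : {l : List (Fin F.n) // (F.deg l = n ∧ l.length = r) ∧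
      IsSortedWord F.p l} => F.wd l.1) (fun l => ψ l.1) (fun l => F.deg l.1)
      (fun l => l.1.length) := by
    constructor
    · intro b l h
      have := b.2.1.1; have := l.2.1.1; omega
    · intro b l _ h
      have := b.2.1.2; have := l.2.1.2; omega
    · intro b l h h' hne
      rw [hψ.wd _ _ (Or.inr ⟨h, by exact_mod_cast h'.le⟩),
        listPairing_eq_zero_of_ne b.2.2 l.2.2 fun h => hne (Subtype.ext h)]
    · intro b
      rw [hψ.wd _ _ (Or.inr ⟨rfl, le_rfl⟩)]
      exact listPairing_self_ne_zero b.2.2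
  have h1 : q = 0 := by
    refine htri.eq_zero_of_mem_span (by rwa [Set.image_eq_range] at hq) fun b => ?_
    have h2 := h0 b.1 b.2.2 b.2.1.1 b.2.1.2
    have h3 : ψ b.1 v = 0 := by
      refine hψ.eq_zero ?_ hv
      have := b.2.1.1; have := b.2.1.2
      omega
    rwa [map_add, h3, zero_add] at h2
  rw [h1, add_zero]
  exact hv

/-! ### Commutators of words -/

theorem adEnv_c_mul_mem (j : Fin F.n) (l t : List (Fin F.n)) :
    L.adEnv (F.c j) (F.wd l) * F.wd t ∈
      F.filt (F.d j + F.deg l + F.deg t - 2) (l.length - 1 + t.length) := by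
  induction l with
  | nil => rw [wd_nil, adEnv_one, zero_mul]; exact zero_mem _
  | cons k v ih =>
    rw [wd_cons, adEnv_ι_mul (F.c_mem j).2 (F.c_mem k).2, add_mul, smul_mul_assoc, mul_assoc,
      ← wd_append, mul_assoc]
    refine add_mem ?_ (Submodule.smul_mem _ _ ?_)
    · refine F.filt_mono ?_ (F.ι_mul_wd_mem_length he hB
        (bracket_piece D.h_mem (F.c_mem j) (F.c_mem k)) (v ++ t))
      rw [deg_append, deg_cons, List.length_append, List.length_cons]
      push_cast
      omega
    · refine F.filt_mono ?_ (F.c_mul_mem k ih)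
      rw [deg_cons, List.length_cons]
      push_cast
      omega

/-- One letter from each word is contracted to a bracket, which lowers the degree by two. The
bracket may reduce to a scalar under `χ`, so two letters can be lost in top degree. -/
theorem wd_commutator_mem (l l' : List (Fin F.n)) :
    F.wd l * F.wd l' - koszulSign (l.map F.p).sum (l'.map F.p).sum • (F.wd l' * F.wd l) ∈
      F.filt (F.deg l + F.deg l' - 2) (l.length + l'.length - 2) := by
  induction l with
  | nil =>
    simp [koszulSign_zero_left]
  | cons j t ih =>
    have h1 : F.wd (j :: t) * F.wd l' -
        koszulSign ((j :: t).map F.p).sum (l'.map F.p).sum • (F.wd l' * F.wd (j :: t)) =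
        L.ι (F.c j) * (F.wd t * F.wd l' -
          koszulSign (t.map F.p).sum (l'.map F.p).sum • (F.wd l' * F.wd t)) +
        koszulSign (t.map F.p).sum (l'.map F.p).sum •
          (L.adEnv (F.c j) (F.wd l') * F.wd t) := by
      rw [adEnv_of_mem (F.c_mem j).2, wd, wd, wd, envParityPow_word _ fun j => (F.c_mem j).2,
        List.map_cons, List.sum_cons, koszulSign_add_left, word_cons]
      simp only [sub_mul, mul_sub, smul_sub, mul_smul_comm, smul_mul_assoc, smul_smul, mul_assoc]
      rw [mul_comm (koszulSign (F.p j) _)]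
      abel
    rw [h1]
    refine add_mem ?_ (Submodule.smul_mem _ _ ?_)
    · refine F.filt_mono ?_ (F.c_mul_mem j ih)
      rw [deg_cons, List.length_cons]
      push_cast
      omega
    · refine F.filt_mono ?_ (F.adEnv_c_mul_mem he hB j l' t)
      rw [deg_cons, List.length_cons]
      push_cast
      omega

/-- For `z` of nonnegative weight the brackets with letters have weight at least `-1`, where `χ`
vanishes: a letter is replaced but never lost in top degree. -/
theorem adEnv_wd_mem {k : ℤ} (hk : 0 ≤ k) {q : ZMod 2} {z : g} (hz : z ∈ L.piece D.h k q)
    (l : List (Fin F.n)) : L.adEnv z (F.wd l) ∈ F.filt (k + F.deg l) l.length := by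
  induction l with
  | nil => rw [wd_nil, adEnv_one]; exact zero_mem _
  | cons j t ih =>
    rw [wd_cons, adEnv_ι_mul hz.2 (F.c_mem j).2]
    have hd := F.d_pos j
    have hb := bracket_piece D.h_mem hz (F.c_mem j)
    refine add_mem ?_ (Submodule.smul_mem _ _ ?_)
    · refine F.filt_mono ?_ (F.ι_mul_mem_of_chi he hB hb
        (D.chi_eq_zero he hB (Or.inl (by omega)) hb)
        (F.wd_mem_filt (l := t) (Or.inr ⟨rfl, le_rfl⟩)))
      rw [deg_cons, List.length_cons]
      push_cast
      omega
    · refine F.filt_mono ?_ (F.c_mul_mem j ih)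
      rw [deg_cons, List.length_cons]
      push_cast
      omega

theorem wspanPart_commutator_mem {n r n' r' : ℤ} {q q' : ZMod 2} {u v : L.Env}
    (hu : u ∈ F.wspanPart n r q) (hv : v ∈ F.wspanPart n' r' q') :
    u * v - koszulSign q q' • (v * u) ∈ F.filt (n + n' - 2) (r + r' - 2) := by
  refine (LinearMap.mulRight ℂ v - koszulSign q q' • LinearMap.mulLeft ℂ v).apply_mem_of_mem_span
    ?_ hu
  rintro _ ⟨l, ⟨hl, rfl⟩, rfl⟩
  refine (LinearMap.mulLeft ℂ (F.wd l) -
    koszulSign (l.map F.p).sum q' • LinearMap.mulRight ℂ (F.wd l)).apply_mem_of_mem_span ?_ hv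
  rintro _ ⟨l', ⟨hl', rfl⟩, rfl⟩
  refine F.filt_mono ?_ (F.wd_commutator_mem he hB l l')
  rw [Cond] at hl hl'
  omega

theorem wspanPart_commutator_ι_mem {k n r : ℤ} (hk : 0 ≤ k) {q q' : ZMod 2} {z : g}
    (hz : z ∈ L.piece D.h k q) {u : L.Env} (hu : u ∈ F.wspanPart n r q') :
    L.ι z * u - koszulSign q q' • (u * L.ι z) ∈ F.filt (k + n) r := by
  refine (LinearMap.mulLeft ℂ (L.ι z) -
    koszulSign q q' • LinearMap.mulRight ℂ (L.ι z)).apply_mem_of_mem_span ?_ hu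
  rintro _ ⟨l, ⟨hl, rfl⟩, rfl⟩
  have h1 := F.adEnv_wd_mem he hB hk hz l
  rw [adEnv_of_mem hz.2, wd, envParityPow_word _ fun j => (F.c_mem j).2, smul_mul_assoc] at h1
  refine F.filt_mono ?_ h1
  rw [Cond] at hl
  omega

end

/-! ### Generators of the W-superalgebra -/

/-- The indices of the basis of `g_e`. -/
abbrev Idx : Type := {j : Fin F.n // ¬ j.1 < F.a}

/-- Lifts of the basis of `g_e` to invariants. -/
structure Generators (Z : D.DualBases) where
  ν : F.Idx → D.invariants hB he
  sub_ι_mem : ∀ j : F.Idx, (ν j : L.Env) - L.ι (F.c j) ∈ F.filt (F.d j) 2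
  parity : ∀ j : F.Idx, L.envParity (ν j) = koszulSign (F.p j) 1 • (ν j : L.Env)
  eq_osc : ∀ j : F.Idx, F.d j = 2 → (ν j : L.Env) = Z.osc (F.c j)

/-- In degree two the oscillator correction is taken. In other degrees an invariant is prescribed to
have, at words in `g_e`, the leading values of the word `[j]`; comparing in top degree at lengths
zero and one pushes the difference from `c_j` up to length two. Averaging makes it homogeneous for
parity. -/
theorem exists_generators (Z : D.DualBases) (hL : L.IsBasicClassical)
    (hnil : IsNilpotent (L.bracket e : Module.End ℂ g)) : Nonempty (F.Generators he hB Z) := by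
  obtain ⟨ψ, hψ⟩ := F.exists_isDualFamily he hB hL hnil
  have key : ∀ j : F.Idx, ∃ ν : D.invariants hB he, (ν : L.Env) - L.ι (F.c j) ∈ F.filt (F.d j) 2 ∧
      L.envParity ν = koszulSign (F.p j) 1 • (ν : L.Env) ∧
      (F.d j = 2 → (ν : L.Env) = Z.osc (F.c j)) := by
    intro j
    by_cases hd : F.d j = 2
    · have hc : F.c j ∈ L.piece D.h 0 (F.p j) := by
        have := F.c_mem j
        rwa [hd] at this
      refine ⟨⟨Z.osc (F.c j), Z.osc_mem_invariants he hB hc (F.bracket_c j j.2)⟩, ?_, ?_,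
        fun _ => rfl⟩
      · rw [hd]
        exact F.osc_sub_mem he hB Z hc
      · have := Z.envParityPow_osc 1 hc.2
        rw [koszulSign_comm]
        simpa [envParityPow] using this
    · obtain ⟨u, hu, hinv, hval⟩ := hψ.exists_invariant he hB (F.d j)
        fun b => listPairing F.p b [j.1]
      have hj1 : F.Cond (F.d j) 1 [j.1] := Or.inr ⟨by simp, by simp⟩
      have hcj : F.wd [j.1] = L.ι (F.c j) := by simp
      have h1 : u - L.ι (F.c j) ∈ F.filt (F.d j) 1 := by
        refine (hψ.twist he hB).mem_filt_succ he hB (r := 0) ?_ ?_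
        · rw [← hcj]
          exact sub_mem hu (F.filt_mono (by omega) (F.wd_mem_filt hj1))
        · intro b _ hb hlen
          have : b = [] := List.length_eq_zero_iff.1 (by exact_mod_cast hlen)
          subst this
          have := F.d_pos j
          rw [deg_nil] at hb
          omega
      have h2 : u - L.ι (F.c j) ∈ F.filt (F.d j) 2 := by
        refine (hψ.twist he hB).mem_filt_succ he hB (r := 1) h1 ?_
        intro b hb hdeg hlen
        obtain ⟨k, rfl⟩ := List.length_eq_one_iff.1 (show b.length = 1 by exact_mod_cast hlen)
        -- At a letter of `𝔪'` the twisted functional vanishes on the invariant and pairs to zero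
        -- with `c j`; at a letter of `g_e` the values agree by choice.
        by_cases hk : k.1 < F.a
        · rw [map_sub, ← hcj, (hψ.twist he hB).wd _ _ (Or.inr ⟨by rw [hdeg]; simp, by simp⟩),
            listPairing_eq_zero, sub_zero, Frame.twist, if_pos hk]
          · exact hψ.zero _ _ (hinv k hk)
          · rw [List.singleton_perm_singleton]
            rintro rfl
            exact j.2 hk
        · rw [F.twist_of_not_lt ψ (by simpa using hk), map_sub, ← hcj,
            hψ.wd _ _ (Or.inr ⟨by rw [hdeg]; simp, by simp⟩),
            hval _ hb hdeg.le (by simpa using hk), sub_self]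
      have hinv' := (F.mem_invariants_iff he hB).2 hinv
      refine ⟨⟨(2⁻¹ : ℂ) • (u + koszulSign (F.p j) 1 • L.envParity u), ?_⟩, ?_, ?_,
        fun h => absurd h hd⟩
      · exact Subalgebra.smul_mem _ (add_mem hinv' (Subalgebra.smul_mem _
          (envParity_mem_invariants he hB hinv') _)) _
      · have h3 : (2⁻¹ : ℂ) • (u + koszulSign (F.p j) 1 • L.envParity u) - L.ι (F.c j) =
            (2⁻¹ : ℂ) • ((u - L.ι (F.c j)) +
              koszulSign (F.p j) 1 • L.envParity (u - L.ι (F.c j))) := by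
          rw [map_sub, L.envParity_ι, L.parityMap_apply_of_mem _ (F.c_mem j).2, map_smul, smul_sub,
            smul_smul, koszulSign_mul_self]
          module
        exact h3 ▸ Submodule.smul_mem _ _ (add_mem h2 (Submodule.smul_mem _ _
          (F.envParity_mem_filt he hB h2)))
      · have h3 := koszulSign_mul_self (F.p j) 1
        change L.envParity ((2⁻¹ : ℂ) • (u + koszulSign (F.p j) 1 • L.envParity u)) =
          koszulSign (F.p j) 1 • ((2⁻¹ : ℂ) • (u + koszulSign (F.p j) 1 • L.envParity u))
        have h4 : (koszulSign (F.p j) 1 * koszulSign (F.p j) 1) • L.envParity u = L.envParity u := by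
          rw [h3, one_smul]
        rw [map_smul, map_add, map_smul, envParity_envParity]
        linear_combination (norm := module) (-(2⁻¹ : ℂ)) • h4
  choose ν h1 h2 h3 using key
  exact ⟨⟨ν, h1, h2, h3⟩⟩

end Frame
end WDatum
end LieSuperalgebra

/-! ### Basis and relations of the W-superalgebra. -/

namespace LieSuperalgebra

variable {g : Type w} [AddCommGroup g] [Module ℂ g] {L : LieSuperalgebra g}

namespace WDatum

variable {B : LinearMap.BilinForm ℂ g} {e : g} {D : L.WDatum B e}
  {he : e ∈ L.part 0} {hB : L.IsBasicForm B}

namespace Frame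

variable {F : D.Frame} {Z : D.DualBases}

theorem exists_bracket_coeff (F : D.Frame) (he : e ∈ L.part 0) (i j : F.Idx) : ∃ γ : F.Idx → ℂ,
    L.bracket (F.c i) (F.c j) = ∑ k, γ k • F.c k ∧ ∀ k, γ k ≠ 0 → F.d k + 2 = F.d i + F.d j := by
  have h1 : L.bracket e (L.bracket (F.c i) (F.c j)) = 0 :=
    L.bracket_mem_centralizer he (F.bracket_c i i.2) (F.bracket_c j j.2)
  have h2 := mem_span_same_piece F.c_mem (bracket_piece D.h_mem (F.c_mem i) (F.c_mem j))
    (R := fun j => ¬ j.1 < F.a) (F.ker_le h1)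
  have h3 : L.bracket (F.c i) (F.c j) ∈ Submodule.span ℂ
      ((fun k : F.Idx => F.c k) '' {k | F.d k + 2 = F.d i + F.d j}) := by
    refine Submodule.span_mono ?_ h2
    rintro _ ⟨k, hk, hd, -, rfl⟩
    exact ⟨⟨k, hk⟩, by change F.d k + 2 = _; omega, rfl⟩
  obtain ⟨γ, hγ, hsum⟩ := (Finsupp.mem_span_image_iff_linearCombination ℂ).1 h3
  refine ⟨γ, ?_, fun k hk => (Finsupp.mem_supported ℂ γ).1 hγ (Finsupp.mem_support_iff.2 hk)⟩
  rw [← hsum, Finsupp.linearCombination_apply, Finsupp.sum_fintype _ _ (by simp)]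

namespace Generators

variable (N : F.Generators he hB Z)

/-- The product of the generators in a list. -/
def prod (b : List F.Idx) : D.invariants hB he := (b.map N.ν).prod

@[simp] theorem prod_nil : N.prod [] = 1 := rfl

theorem exists_lift (j : F.Idx) : ∃ A ∈ F.wspanPart (F.d j) 2 (F.p j),
    (N.ν j : L.Env) - (L.ι (F.c j) + A) ∈ D.leftIdeal := by
  obtain ⟨A, hA, h⟩ := F.exists_sub_mem_leftIdeal he hB (N.sub_ι_mem j) (q := F.p j) (by
    rw [map_sub, N.parity, L.envParity_ι, L.parityMap_apply_of_mem _ (F.c_mem j).2, map_smul,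
      smul_sub])
  exact ⟨A, hA, by rwa [← sub_sub]⟩

theorem mul_sub_mem (j : F.Idx) {n r : ℤ} (u : D.invariants hB he) (hu : (u : L.Env) ∈ F.filt n r) :
    ((N.ν j * u : D.invariants hB he) : L.Env) - L.ι (F.c j) * u ∈ F.filt (F.d j + n) (2 + r) := by
  obtain ⟨A, hA, h⟩ := N.exists_lift j
  have h1 : ((N.ν j * u : D.invariants hB he) : L.Env) - L.ι (F.c j) * u =
      ((N.ν j : L.Env) - (L.ι (F.c j) + A)) * u + A * u := by
    rw [MulMemClass.coe_mul]
    noncomm_ring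
  rw [h1]
  exact add_mem (F.leftIdeal_le_filt (D.leftIdeal_mul hB he h u.2))
    (F.wspan_mul_filt (F.wspanPart_le _ _ _ hA) hu)

theorem prod_sub_mem (b : List F.Idx) : (N.prod b : L.Env) - F.wd (b.map (↑)) ∈
    F.filt (F.deg (b.map (↑))) (b.length + 1) := by
  induction b with
  | nil => rw [prod_nil]; simp
  | cons j b ih =>
    have h0 : (N.prod b : L.Env) ∈ F.filt (F.deg (b.map (↑))) b.length := by
      have h1 := add_mem (F.filt_mono (n' := F.deg (b.map (↑))) (r' := b.length) (by omega) ih)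
        (F.wd_mem_filt (l := b.map (↑)) (Or.inr ⟨rfl, by simp⟩))
      rwa [sub_add_cancel] at h1
    have h1 := add_mem (F.filt_mono (n' := F.deg ((j :: b).map (↑))) (r' := (j :: b).length + 1) (by
        rw [List.map_cons, deg_cons, List.length_cons]; push_cast; omega) (N.mul_sub_mem j _ h0))
      (F.filt_mono (n' := F.deg ((j :: b).map (↑))) (r' := (j :: b).length + 1) (by
        rw [List.map_cons, deg_cons, List.length_cons]; push_cast; omega) (F.c_mul_mem j.1 ih))
    rwa [mul_sub, sub_add_sub_cancel, ← wd_cons] at h1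

theorem prod_mem_filt (b : List F.Idx) :
    (N.prod b : L.Env) ∈ F.filt (F.deg (b.map (↑))) b.length := by
  have h1 := add_mem (F.filt_mono (n' := F.deg (b.map (↑))) (r' := b.length) (by omega)
    (N.prod_sub_mem b)) (F.wd_mem_filt (l := b.map (↑)) (Or.inr ⟨rfl, by simp⟩))
  rwa [sub_add_cancel] at h1

theorem isSortedWord_map {b : List F.Idx} :
    IsSortedWord F.p (b.map (↑)) ↔ IsSortedWord (fun j : F.Idx => F.p j) b := by
  rw [IsSortedWord, IsSortedWord, List.pairwise_map]
  simp only [Subtype.coe_lt_coe, Subtype.coe_inj]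

theorem isTriangular {ψ : List (Fin F.n) → (L.Env →ₗ[ℂ] ℂ)} (hψ : F.IsDualFamily ψ)
    (R : List F.Idx → Prop) : IsTriangular
      (fun b : {b : List F.Idx // R b ∧ IsSortedWord (fun j : F.Idx => F.p j) b} =>
        (N.prod b.1 : L.Env)) (fun b => ψ (b.1.map (↑))) (fun b => F.deg (b.1.map (↑)))
      (fun b => b.1.length) := by
  have key : ∀ b c : List F.Idx, F.deg (b.map (↑)) = F.deg (c.map (↑)) → b.length = c.length →
      ψ (c.map (↑)) (N.prod b) = listPairing F.p (c.map (↑)) (b.map (↑)) := by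
    intro b c h h'
    have h1 := hψ.eq_zero (b := c.map (↑)) (Or.inr ⟨h, by simp [h']⟩) (N.prod_sub_mem b)
    rw [map_sub, sub_eq_zero] at h1
    rw [h1, hψ.wd _ _ (Or.inr ⟨h, by simp [h']⟩)]
  constructor
  · intro c b h
    exact hψ.eq_zero (Or.inl h) (N.prod_mem_filt b.1)
  · intro c b h h'
    exact hψ.eq_zero (Or.inr ⟨h, by simpa using h'⟩) (N.prod_mem_filt b.1)
  · intro c b h h' hne
    rw [key _ _ h h'.symm]
    refine listPairing_eq_zero_of_ne (isSortedWord_map.2 c.2.2) (isSortedWord_map.2 b.2.2) ?_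
    intro h
    exact hne (Subtype.ext (List.map_injective_iff.2 Subtype.val_injective h))
  · intro b
    rw [key _ _ rfl rfl]
    exact listPairing_self_ne_zero (isSortedWord_map.2 b.2.2)

/-- Sorted products of generators can match the finitely many relevant functionals at words in
`g_e`. The difference is an invariant on which all those functionals vanish. -/
theorem exists_sub_mem_leftIdeal {ψ : List (Fin F.n) → (L.Env →ₗ[ℂ] ℂ)} (hψ : F.IsDualFamily ψ) {n r : ℤ}
    (hr : 0 ≤ r) (u : D.invariants hB he) (hu : (u : L.Env) ∈ F.filt n r) :
    ∃ q ∈ Submodule.span ℂ (N.prod '' {b | F.Cond n r (b.map (↑)) ∧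
      IsSortedWord (fun j : F.Idx => F.p j) b}), ((u - q : D.invariants hB he) : L.Env) ∈
        D.leftIdeal := by
  have hfin : Finite {b : List F.Idx // F.Cond n r (b.map (↑)) ∧
      IsSortedWord (fun j : F.Idx => F.p j) b} := by
    refine Set.Finite.to_subtype ((List.finite_length_le F.Idx n.toNat).subset ?_)
    rintro l ⟨hl, -⟩
    rw [Cond] at hl
    have := F.length_le_deg (l.map (↑))
    rw [List.length_map] at this
    rw [Set.mem_ofPred_eq]
    omega
  obtain ⟨q, hq, hval⟩ := (N.isTriangular hψ fun b => F.Cond n r (b.map (↑))).exists_unique_values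
    fun b => ψ (b.1.map (↑)) u
  have h1 : Submodule.span ℂ (Set.range fun b : {b : List F.Idx // F.Cond n r (b.map (↑)) ∧
      IsSortedWord (fun j : F.Idx => F.p j) b} => (N.prod b.1 : L.Env)) =
      (Submodule.span ℂ (N.prod '' {b | F.Cond n r (b.map (↑)) ∧
      IsSortedWord (fun j : F.Idx => F.p j) b})).map (D.invariants hB he).val.toLinearMap := by
    rw [Submodule.map_span, Set.image_eq_range N.prod, ← Set.range_comp]
    rfl
  rw [h1] at hq
  obtain ⟨q, hq, rfl⟩ := hq
  have hqf : (q : L.Env) ∈ F.filt n r := by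
    refine (D.invariants hB he).val.toLinearMap.apply_mem_of_mem_span ?_ hq
    rintro _ ⟨b, ⟨hb, -⟩, rfl⟩
    refine F.filt_mono ?_ (N.prod_mem_filt b)
    rw [Cond, List.length_map] at hb
    omega
  have huq : ((u - q : D.invariants hB he) : L.Env) ∈ F.filt n r := sub_mem hu hqf
  refine ⟨q, hq, hψ.mem_leftIdeal_of_invariant he hB (F.filt_mono (n' := n) (r' := 0) (by omega) huq)
    ((F.mem_invariants_iff he hB).1 (u - q).2) ?_⟩
  intro b hb hba
  by_cases hc : F.Cond n r b
  · lift b to List F.Idx using hba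
    have h2 := hval ⟨b, hc, isSortedWord_map.1 hb⟩
    change ψ _ (u - q : L.Env) = 0
    rw [map_sub, sub_eq_zero]
    exact h2.symm
  · refine hψ.eq_zero ?_ huq
    rw [Cond] at hc
    omega

/-- Modulo `I_χ` write `ν_i = c_i + A` and `ν_j = c_j + A'`, the corrections having length at least
two in top degree. The letters produce the bracket, whose terms `c_k` differ from `ν_k` by
admissible terms; the commutators involving `A` or `A'` obey the bound by the previous estimates,
which use that `c_i`, `c_j` have nonnegative weight. -/
theorem commutator_mem {i j : F.Idx} {γ : F.Idx → ℂ}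
    (hγ : L.bracket (F.c i) (F.c j) = ∑ k, γ k • F.c k)
    (hd : ∀ k, γ k ≠ 0 → F.d k + 2 = F.d i + F.d j) :
    ((N.ν i * N.ν j - koszulSign (F.p i) (F.p j) • (N.ν j * N.ν i) - ∑ k, γ k • N.ν k :
      D.invariants hB he) : L.Env) ∈ F.filt (F.d i + F.d j - 2) 2 := by
  obtain ⟨A, hA, hi⟩ := N.exists_lift i
  obtain ⟨A', hA', hj⟩ := N.exists_lift j
  have h2i := F.two_le i i.2
  have h2j := F.two_le j j.2
  have hmod : ∀ (i j : F.Idx) (A A' : L.Env), (N.ν i : L.Env) - (L.ι (F.c i) + A) ∈ D.leftIdeal →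
      (N.ν j : L.Env) - (L.ι (F.c j) + A') ∈ D.leftIdeal →
      (N.ν i : L.Env) * N.ν j - (L.ι (F.c i) + A) * (L.ι (F.c j) + A') ∈ D.leftIdeal := by
    intro i j A A' hi hj
    have h1 : (N.ν i : L.Env) * N.ν j - (L.ι (F.c i) + A) * (L.ι (F.c j) + A') =
        ((N.ν i : L.Env) - (L.ι (F.c i) + A)) * N.ν j +
          (L.ι (F.c i) + A) * ((N.ν j : L.Env) - (L.ι (F.c j) + A')) := by noncomm_ring
    rw [h1]
    exact add_mem (D.leftIdeal_mul hB he hi (N.ν j).2) (Ideal.mul_mem_left _ _ hj)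
  have hij := hmod i j A A' hi hj
  have hji := hmod j i A' A hj hi
  have hsum : ∑ k, γ k • ((N.ν k : L.Env) - L.ι (F.c k)) ∈ F.filt (F.d i + F.d j - 2) 2 := by
    refine Submodule.sum_mem _ fun k _ => ?_
    by_cases hk : γ k = 0
    · rw [hk, zero_smul]; exact zero_mem _
    · refine Submodule.smul_mem _ _ ?_
      have h1 := hd k hk
      refine F.filt_mono ?_ (N.sub_ι_mem k)
      omega
  have hιι : L.ι (F.c i) * L.ι (F.c j) - koszulSign (F.p i) (F.p j) •
      (L.ι (F.c j) * L.ι (F.c i)) = ∑ k, γ k • L.ι (F.c k) := by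
    rw [L.ι_mul_ι _ _ (F.c_mem i).2 (F.c_mem j).2, add_sub_cancel_left, hγ, map_sum]
    simp only [map_smul]
  have hιA := F.wspanPart_commutator_ι_mem he hB (by omega) (F.c_mem i) hA'
  have hAι := F.wspanPart_commutator_ι_mem he hB (by omega) (F.c_mem j) hA
  have hAA := F.wspanPart_commutator_mem he hB hA hA'
  have hs := koszulSign_mul_self (F.p i) (F.p j)
  have hcoe : ((∑ k, γ k • N.ν k : D.invariants hB he) : L.Env) = ∑ k, γ k • (N.ν k : L.Env) := by
    rw [AddSubmonoidClass.coe_finsetSum]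
    rfl
  have key : ((N.ν i * N.ν j - koszulSign (F.p i) (F.p j) • (N.ν j * N.ν i) - ∑ k, γ k • N.ν k :
      D.invariants hB he) : L.Env) =
      ((N.ν i : L.Env) * N.ν j - (L.ι (F.c i) + A) * (L.ι (F.c j) + A')) -
      koszulSign (F.p i) (F.p j) •
        ((N.ν j : L.Env) * N.ν i - (L.ι (F.c j) + A') * (L.ι (F.c i) + A)) +
      (L.ι (F.c i) * A' - koszulSign (F.p i) (F.p j) • (A' * L.ι (F.c i))) -
      koszulSign (F.p i) (F.p j) • (L.ι (F.c j) * A - koszulSign (F.p j) (F.p i) •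
        (A * L.ι (F.c j))) +
      (A * A' - koszulSign (F.p i) (F.p j) • (A' * A)) -
      ∑ k, γ k • ((N.ν k : L.Env) - L.ι (F.c k)) := by
    have h1 : ∑ k, γ k • ((N.ν k : L.Env) - L.ι (F.c k)) = ∑ k, γ k • (N.ν k : L.Env) -
        (L.ι (F.c i) * L.ι (F.c j) - koszulSign (F.p i) (F.p j) •
          (L.ι (F.c j) * L.ι (F.c i))) := by
      rw [hιι, ← Finset.sum_sub_distrib]
      simp only [smul_sub]
    rw [AddSubgroupClass.coe_sub, AddSubgroupClass.coe_sub, hcoe, h1]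
    change (N.ν i : L.Env) * N.ν j - koszulSign (F.p i) (F.p j) • ((N.ν j : L.Env) * N.ν i) - _ = _
    simp only [mul_add, add_mul, smul_sub, smul_add, smul_smul, koszulSign_comm (F.p j), hs,
      one_smul]
    abel
  rw [key]
  refine sub_mem (add_mem (sub_mem (add_mem (sub_mem (F.leftIdeal_le_filt hij)
    (F.leftIdeal_le_filt (smul_mem_leftIdeal _ hji))) ?_) (Submodule.smul_mem _ _ ?_)) ?_) hsum
  · exact F.filt_mono (by omega) hιA
  · exact F.filt_mono (by omega) hAι
  · exact F.filt_mono (by omega) hAA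

/-- For two letters of weight zero no smaller weight exists to absorb an error, so the relation has
to be exact; the oscillator correction makes it so. -/
theorem commutator_mem_leftIdeal {i j : F.Idx} {γ : F.Idx → ℂ}
    (hγ : L.bracket (F.c i) (F.c j) = ∑ k, γ k • F.c k)
    (hd : ∀ k, γ k ≠ 0 → F.d k + 2 = F.d i + F.d j) (hi : F.d i = 2) (hj : F.d j = 2) :
    ((N.ν i * N.ν j - koszulSign (F.p i) (F.p j) • (N.ν j * N.ν i) - ∑ k, γ k • N.ν k :
      D.invariants hB he) : L.Env) ∈ D.leftIdeal := by
  have hci := F.c_mem i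
  have hcj := F.c_mem j
  rw [hi] at hci
  rw [hj] at hcj
  have h1 := Z.osc_bracket he hB hcj (F.bracket_c j j.2) hci (F.bracket_c i i.2)
  have hcoe : ((∑ k, γ k • N.ν k : D.invariants hB he) : L.Env) =
      Z.osc (L.bracket (F.c i) (F.c j)) := by
    rw [hγ, AddSubmonoidClass.coe_finsetSum, map_sum]
    refine Finset.sum_congr rfl fun k _ => ?_
    change γ k • (N.ν k : L.Env) = _
    rw [map_smul]
    by_cases hk : γ k = 0
    · rw [hk, zero_smul, zero_smul]
    · rw [N.eq_osc k (by have := hd k hk; omega)]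
  rw [AddSubgroupClass.coe_sub, AddSubgroupClass.coe_sub, hcoe]
  change (N.ν i : L.Env) * N.ν j - koszulSign (F.p i) (F.p j) • ((N.ν j : L.Env) * N.ν i) - _ ∈ _
  rw [N.eq_osc i hi, N.eq_osc j hj]
  exact h1

/-- The supercommutator of two generators of the W-superalgebra, up to terms of smaller weight. -/
theorem exists_commutator {ψ : List (Fin F.n) → (L.Env →ₗ[ℂ] ℂ)} (hψ : F.IsDualFamily ψ)
    {i j : F.Idx} {γ : F.Idx → ℂ} (hγ : L.bracket (F.c i) (F.c j) = ∑ k, γ k • F.c k)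
    (hd : ∀ k, γ k ≠ 0 → F.d k + 2 = F.d i + F.d j) :
    ∃ q ∈ Submodule.span ℂ (N.prod '' {b |
      (b.map fun k : F.Idx => F.d k).sum < F.d i + F.d j ∧
      (b.map fun k : F.Idx => F.d k - 2).sum < (F.d i - 2) + (F.d j - 2)}),
      ((N.ν i * N.ν j - koszulSign (F.p i) (F.p j) • (N.ν j * N.ν i) - ∑ k, γ k • N.ν k - q :
      D.invariants hB he) : L.Env) ∈ D.leftIdeal := by
  have h2i := F.two_le i i.2
  have h2j := F.two_le j j.2
  by_cases h2 : F.d i = 2 ∧ F.d j = 2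
  · exact ⟨0, zero_mem _, by rw [sub_zero]; exact N.commutator_mem_leftIdeal hγ hd h2.1 h2.2⟩
  · obtain ⟨q, hq, h⟩ := N.exists_sub_mem_leftIdeal hψ (by decide) _ (N.commutator_mem hγ hd)
    refine ⟨q, Submodule.span_mono (Set.image_mono ?_) hq, h⟩
    rintro b ⟨hb, -⟩
    -- Weight is degree minus twice the length. Degree below `d i + d j - 2`, or equal to it with at
    -- least two letters, forces weight below `d i + d j - 4`; this includes the empty word, as `d i
    -- + d j > 4` here.
    have hwt : ∀ b : List F.Idx, ((b.map fun k : F.Idx => F.d k - 2).sum : ℤ) + 2 * b.length =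
        F.deg (b.map (↑)) := by
      intro b
      induction b with
      | nil => simp
      | cons k b ih =>
        have := F.two_le k k.2
        rw [List.map_cons, List.map_cons, List.sum_cons, deg_cons, ← ih, List.length_cons]
        push_cast [Nat.cast_sub this]
        ring
    have hdeg : ((b.map fun k : F.Idx => F.d k).sum : ℤ) = F.deg (b.map (↑)) := by
      rw [deg, List.map_map]
      rfl
    have h3 := hwt b
    rw [Cond, List.length_map, ← hdeg] at hb
    rw [← hdeg] at h3
    rw [Set.mem_ofPred_eq]
    have h4 : b.length = 0 → (b.map fun k : F.Idx => F.d k - 2).sum = 0 := by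
      intro h
      rw [List.length_eq_zero_iff.1 h]
      rfl
    omega

end Generators
end Frame
end WDatum
end LieSuperalgebra

/-! ### The Rees algebra of the weight filtration. -/

section Contraction

variable {W : Type w} [Ring W] [Algebra ℂ W]

/-- The functions `ℂ → W` as an algebra over the polynomial functions. -/
@[reducible] def functionAlgebra (W : Type w) [Ring W] [Algebra ℂ W] : Algebra ℂ[X] (ℂ → W) :=
  RingHom.toAlgebra' (RingHom.pi fun c => (algebraMap ℂ W).comp (Polynomial.evalRingHom c)) (by
    intro f h
    funext c
    exact Algebra.commutes _ _)

attribute [local instance] functionAlgebra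

theorem functionAlgebra_smul_apply (f : ℂ[X]) (h : ℂ → W) (c : ℂ) : (f • h) c = f.eval c • h c := by
  rw [Algebra.smul_def, Algebra.smul_def]
  rfl

instance : IsScalarTower ℂ ℂ[X] (ℂ → W) := ⟨fun a f h => funext fun c => by
  rw [Pi.smul_apply, functionAlgebra_smul_apply, functionAlgebra_smul_apply, Polynomial.eval_smul, smul_assoc]⟩

/-- The function `c ↦ c ^ n x`. -/
def powSmul (n : ℕ) (x : W) : ℂ → W := fun c => c ^ n • x

theorem powSmul_mul (m n : ℕ) (x y : W) :
    powSmul m x * powSmul n y = powSmul (m + n) (x * y) := by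
  funext c
  simp only [powSmul, Pi.mul_apply, smul_mul_smul_comm, pow_add]

theorem prod_map_powSmul {J : Type*} (wt : J → ℕ) (Θ : J → W) (b : List J) :
    (b.map fun j => powSmul (wt j) (Θ j)).prod = powSmul (b.map wt).sum (b.map Θ).prod := by
  induction b with
  | nil => funext c; simp [powSmul]
  | cons j b ih =>
    rw [List.map_cons, List.prod_cons, ih, powSmul_mul, List.map_cons, List.map_cons,
      List.sum_cons, List.prod_cons]

variable {J : Type*} [LinearOrder J] [Fintype J]

/-- Generators of an algebra whose sorted words are a basis, and whose supercommutators have the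
given linear parts of top weight. -/
structure IsFilteredBasis (p : J → ZMod 2) (wt d : J → ℕ) (Θ : J → W) (γ : J → J → J → ℂ)
    (P : W →ₐ[ℂ] W) : Prop where
  linearIndependent : LinearIndependent ℂ fun b : {b : List J // IsSortedWord p b} =>
    (b.1.map Θ).prod
  span : Submodule.span ℂ (Set.range fun b : {b : List J // IsSortedWord p b} =>
    (b.1.map Θ).prod) = ⊤
  parity : ∀ j, P (Θ j) = koszulSign (p j) 1 • Θ j
  involutive : ∀ w, P (P w) = w
  coeff : ∀ i j k, γ i j k ≠ 0 → wt k = wt i + wt j ∧ d k < d i + d j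
  rel : ∀ i j, Θ i * Θ j - koszulSign (p i) (p j) • (Θ j * Θ i) - ∑ k, γ i j k • Θ k ∈
    Submodule.span ℂ ((fun b : List J => (b.map Θ).prod) ''
      {b | (b.map d).sum < d i + d j ∧ (b.map wt).sum < wt i + wt j})

/-- The Rees algebra of the filtration by weight. -/
def weightRees (wt : J → ℕ) (Θ : J → W) : Subalgebra ℂ[X] (ℂ → W) :=
  Algebra.adjoin ℂ[X] (Set.range fun j => powSmul (wt j) (Θ j))

/-- The generators of the Rees algebra. -/
def reesGenerator (wt : J → ℕ) (Θ : J → W) (j : J) : weightRees wt Θ :=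
  ⟨powSmul (wt j) (Θ j), Algebra.subset_adjoin ⟨j, rfl⟩⟩

/-- The products of generators of the Rees algebra. -/
def reesWord (wt : J → ℕ) (Θ : J → W) (b : List J) : weightRees wt Θ :=
  (b.map (reesGenerator wt Θ)).prod

variable {p : J → ZMod 2} {wt d : J → ℕ} {Θ : J → W} {γ : J → J → J → ℂ} {P : W →ₐ[ℂ] W}

omit [LinearOrder J] [Fintype J] in
theorem coe_reesWord (b : List J) :
    (reesWord wt Θ b : ℂ → W) = powSmul (b.map wt).sum (b.map Θ).prod := by
  rw [← prod_map_powSmul]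
  induction b with
  | nil => rfl
  | cons j b ih =>
    rw [List.map_cons, List.prod_cons, ← ih]
    rfl

omit [LinearOrder J] [Fintype J] in
theorem reesWord_append (b b' : List J) :
    reesWord wt Θ (b ++ b') = reesWord wt Θ b * reesWord wt Θ b' := by
  rw [reesWord, List.map_append, List.prod_append]
  rfl

omit [LinearOrder J] [Fintype J] in
theorem span_range_reesWord : Submodule.span ℂ[X] (Set.range (reesWord wt Θ)) = ⊤ := by
  rw [eq_top_iff]
  rintro ⟨h, hh⟩ -
  have key : Subalgebra.toSubmodule (weightRees wt Θ) ≤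
      (Submodule.span ℂ[X] (Set.range (reesWord wt Θ))).map (weightRees wt Θ).val.toLinearMap := by
    refine (Algebra.adjoin_eq_span _ _).trans_le (Submodule.span_le.2 ?_)
    intro x hx
    obtain ⟨l, hl, rfl⟩ := Submonoid.exists_list_of_mem_closure hx
    have h1 : ∃ b : List J, l = b.map fun j => powSmul (wt j) (Θ j) := by
      clear hx
      induction l with
      | nil => exact ⟨[], rfl⟩
      | cons y l ih =>
        obtain ⟨b, rfl⟩ := ih fun z hz => hl z (List.mem_cons_of_mem _ hz)
        obtain ⟨j, rfl⟩ := hl y List.mem_cons_self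
        exact ⟨j :: b, rfl⟩
    obtain ⟨b, rfl⟩ := h1
    refine ⟨reesWord wt Θ b, Submodule.subset_span ⟨b, rfl⟩, ?_⟩
    rw [prod_map_powSmul]
    exact coe_reesWord b
  obtain ⟨h', hh', heq⟩ := key hh
  have : h' = ⟨h, hh⟩ := Subtype.ext heq
  rwa [← this]

namespace IsFilteredBasis

variable (hΘ : IsFilteredBasis p wt d Θ γ P)

include hΘ

/-- Multiply the relation by `c ^ (wt i + wt j)`: the linear terms use up all powers, and every
other word has at least one power to spare, so `X` can be extracted. -/
theorem exists_rees_commutator (i j : J) : ∃ R ∈ Submodule.span ℂ[X]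
      (reesWord wt Θ '' {b | (b.map d).sum < d i + d j}),
    reesGenerator wt Θ i * reesGenerator wt Θ j - Polynomial.C (koszulSign (p i) (p j)) •
      (reesGenerator wt Θ j * reesGenerator wt Θ i) -
        ∑ k, Polynomial.C (γ i j k) • reesGenerator wt Θ k = (Polynomial.X : ℂ[X]) • R := by
  have key : ∀ r ∈ Submodule.span ℂ ((fun b : List J => (b.map Θ).prod) ''
      {b | (b.map d).sum < d i + d j ∧ (b.map wt).sum < wt i + wt j}),
      ∃ R ∈ Submodule.span ℂ[X] (reesWord wt Θ '' {b | (b.map d).sum < d i + d j}),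
        powSmul (wt i + wt j) r = (Polynomial.X : ℂ[X]) • (R : ℂ → W) := by
    intro r hr
    induction hr using Submodule.span_induction with
    | mem r hr =>
      obtain ⟨b, ⟨hb, hb'⟩, rfl⟩ := hr
      -- One of the spare powers is the extracted factor `X`, hence the `- 1`, a genuine subtraction
      -- since the weight of `b` is strictly smaller.
      refine ⟨(Polynomial.X : ℂ[X]) ^ (wt i + wt j - (b.map wt).sum - 1) • reesWord wt Θ b,
        Submodule.smul_mem _ _ (Submodule.subset_span ⟨b, hb, rfl⟩), ?_⟩
      funext c
      rw [functionAlgebra_smul_apply, Subalgebra.coe_smul, functionAlgebra_smul_apply, coe_reesWord]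
      simp only [powSmul, Polynomial.eval_X, Polynomial.eval_pow, smul_smul, ← pow_succ', ← pow_add]
      congr 2
      omega
    | zero =>
      refine ⟨0, zero_mem _, ?_⟩
      funext c
      rw [functionAlgebra_smul_apply]
      simp [powSmul]
    | add x y _ _ hx hy =>
      obtain ⟨R, hR, h⟩ := hx
      obtain ⟨R', hR', h'⟩ := hy
      refine ⟨R + R', add_mem hR hR', ?_⟩
      rw [Subalgebra.coe_add, smul_add, ← h, ← h']
      funext c
      simp [powSmul]
    | smul a x _ hx =>
      obtain ⟨R, hR, h⟩ := hx
      refine ⟨Polynomial.C a • R, Submodule.smul_mem _ _ hR, ?_⟩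
      rw [Subalgebra.coe_smul, smul_comm, ← h]
      funext c
      rw [functionAlgebra_smul_apply]
      simp only [powSmul, Polynomial.eval_C]
      rw [smul_comm]
  obtain ⟨R, hR, h⟩ := key _ (hΘ.rel i j)
  refine ⟨R, hR, Subtype.ext ?_⟩
  rw [Subalgebra.coe_smul, ← h]
  funext c
  rw [Subalgebra.coe_sub, Subalgebra.coe_sub, Subalgebra.coe_smul, Subalgebra.coe_mul,
    Subalgebra.coe_mul, AddSubmonoidClass.coe_finsetSum, Pi.sub_apply, Pi.sub_apply,
    functionAlgebra_smul_apply, Finset.sum_apply]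
  simp only [reesGenerator, powSmul_mul, Subalgebra.coe_smul, functionAlgebra_smul_apply,
    Polynomial.eval_C]
  simp only [powSmul, smul_sub, Finset.smul_sum]
  congr 1
  · rw [add_comm (wt j), smul_comm]
  · refine Finset.sum_congr rfl fun k _ => ?_
    by_cases hk : γ i j k = 0
    · rw [hk, zero_smul, zero_smul, smul_zero]
    · rw [(hΘ.coeff i j k hk).1, smul_comm]

/-- Straightening is run on the degree `d`. The weight does not decrease in the linear terms of the
relations, but `d` does. -/
theorem span_reesWord : Submodule.span ℂ[X] (Set.range
    fun b : {b : List J // IsSortedWord p b} => reesWord wt Θ b.1) = ⊤ := by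
  rw [eq_top_iff, ← span_range_reesWord, Submodule.span_le]
  rintro _ ⟨l, rfl⟩
  refine straightening (p := p) (reesWord wt Θ) ((Submodule.span ℂ[X] (Set.range
    fun b : {b : List J // IsSortedWord p b} => reesWord wt Θ b.1)).restrictScalars ℂ) d
    (fun _ => True) (fun _ _ _ _ => trivial) (fun b _ hb => Submodule.subset_span ⟨⟨b, hb⟩, rfl⟩)
    ?_ l trivial
  intro l₁ i j l₂ _ ih
  obtain ⟨R, hR, h⟩ := hΘ.exists_rees_commutator i j
  have hsmul : ∀ (a : ℂ) (u : weightRees wt Θ), a • u = Polynomial.C a • u := by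
    intro a u
    rw [← algebraMap_smul ℂ[X] a u]
    rfl
  have h1 : reesWord wt Θ (l₁ ++ i :: j :: l₂) -
      koszulSign (p i) (p j) • reesWord wt Θ (l₁ ++ j :: i :: l₂) =
      ∑ k, Polynomial.C (γ i j k) • reesWord wt Θ (l₁ ++ k :: l₂) +
        (Polynomial.X : ℂ[X]) • (reesWord wt Θ l₁ * R * reesWord wt Θ l₂) := by
    have hcons : ∀ k (l : List J), reesWord wt Θ (k :: l) =
        reesGenerator wt Θ k * reesWord wt Θ l := fun _ _ => rfl
    have h2 : reesGenerator wt Θ i * reesGenerator wt Θ j =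
        ∑ k, Polynomial.C (γ i j k) • reesGenerator wt Θ k + (Polynomial.X : ℂ[X]) • R +
        Polynomial.C (koszulSign (p i) (p j)) •
          (reesGenerator wt Θ j * reesGenerator wt Θ i) := by
      rw [← h]; abel
    simp only [reesWord_append, hcons, hsmul]
    rw [← mul_assoc (reesGenerator wt Θ i), h2]
    simp only [add_mul, mul_add, smul_mul_assoc, mul_smul_comm, mul_assoc, Finset.sum_mul,
      Finset.mul_sum]
    abel
  rw [h1]
  refine add_mem (Submodule.sum_mem _ fun k _ => ?_) (Submodule.smul_mem
    (Submodule.span ℂ[X] (Set.range fun b : {b : List J // IsSortedWord p b} =>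
      reesWord wt Θ b.1)) (Polynomial.X : ℂ[X]) ?_)
  · by_cases hk : γ i j k = 0
    · rw [hk, Polynomial.C_0, zero_smul]; exact zero_mem _
    · refine Submodule.smul_mem (Submodule.span ℂ[X] (Set.range
        fun b : {b : List J // IsSortedWord p b} => reesWord wt Θ b.1)) _ (ih _ trivial ?_)
      have := (hΘ.coeff i j k hk).2
      simp only [List.map_append, List.map_cons, List.sum_append, List.sum_cons]
      omega
  · refine Submodule.span_le.2 (?_ : _ ⊆ ((Submodule.span ℂ[X] (Set.range
      fun b : {b : List J // IsSortedWord p b} => reesWord wt Θ b.1)).comap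
        (LinearMap.mulRight ℂ[X] (reesWord wt Θ l₂) ∘ₗ LinearMap.mulLeft ℂ[X] (reesWord wt Θ l₁)) :
          Set (weightRees wt Θ))) hR
    rintro _ ⟨b, hb, rfl⟩
    rw [Set.mem_ofPred_eq] at hb
    have h3 := ih (l₁ ++ b ++ l₂) trivial (by
      simp only [List.map_append, List.map_cons, List.sum_append, List.sum_cons]
      omega)
    rw [reesWord_append, reesWord_append] at h3
    exact h3

/-- Evaluating a relation at any `c ≠ 0` gives a relation of sorted words in `W`, so each
coefficient polynomial vanishes at all nonzero `c`. -/
theorem linearIndependent_reesWord : LinearIndependent ℂ[X]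
    fun b : {b : List J // IsSortedWord p b} => reesWord wt Θ b.1 := by
  rw [linearIndependent_iff]
  intro α hα
  have h1 : ∀ c : ℂ, c ≠ 0 → ∀ b, (α b).eval c = 0 := by
    intro c hc
    have h2 : ∑ b ∈ α.support, ((α b).eval c * c ^ (b.1.map wt).sum) • (b.1.map Θ).prod = 0 := by
      have h3 := congrFun (congrArg Subtype.val hα) c
      rw [Finsupp.linearCombination_apply, Finsupp.sum, AddSubmonoidClass.coe_finsetSum,
        Finset.sum_apply] at h3
      refine Eq.trans ?_ h3
      refine Finset.sum_congr rfl fun b _ => ?_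
      rw [Subalgebra.coe_smul, functionAlgebra_smul_apply, coe_reesWord, powSmul, smul_smul]
    intro b
    by_cases hb : b ∈ α.support
    · have h3 := linearIndependent_iff'.1 hΘ.linearIndependent _ _ h2 b hb
      exact (mul_eq_zero.1 h3).resolve_right (pow_ne_zero _ hc)
    · rw [Finsupp.notMem_support_iff.1 hb, Polynomial.eval_zero]
  ext1 b
  refine Polynomial.eq_zero_of_infinite_isRoot _ ((Set.finite_singleton (0 : ℂ)).infinite_compl.mono
    fun c hc => h1 c hc b)

theorem weightRees_free : Module.Free ℂ[X] (weightRees wt Θ) :=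
  Module.Free.of_basis (Module.Basis.mk hΘ.linearIndependent_reesWord hΘ.span_reesWord.ge)

end IsFilteredBasis

end Contraction

/-! ### Specializations and gradings given by involutions. -/

section Specialization

variable {H : Type w} [Ring H] [Algebra ℂ[X] H] {c : ℂ}

namespace SpecializationAt

theorem mk_surjective : Function.Surjective (mk H c) := Ideal.Quotient.mk_surjective

theorem mk_eq_zero_iff {h : H} :
    mk H c h = 0 ↔ ∃ k : H, h = (Polynomial.X - Polynomial.C c : ℂ[X]) • k := by
  refine (Ideal.Quotient.eq_zero_iff_mem).trans (Ideal.mem_span_singleton'.trans ?_)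
  refine exists_congr fun k => ?_
  rw [← Algebra.commutes, ← Algebra.smul_def, eq_comm]

theorem mk_C_smul (z : ℂ) (h : H) : mk H c ((Polynomial.C z : ℂ[X]) • h) = z • mk H c h := by
  rw [Algebra.smul_def, map_mul, Algebra.smul_def]
  rfl

theorem mk_smul (f : ℂ[X]) (h : H) : mk H c (f • h) = f.eval c • mk H c h := by
  rw [← mk_C_smul, ← sub_eq_zero, ← map_sub, ← sub_smul, mk_eq_zero_iff]
  obtain ⟨k, hk⟩ := Polynomial.X_sub_C_dvd_sub_C_eval (a := c) (p := f)
  exact ⟨k • h, by rw [hk, mul_smul]⟩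

theorem mk_mem_span {T : Type*} {v : T → H} (hv : Submodule.span ℂ[X] (Set.range v) = ⊤) :
    Submodule.span ℂ (Set.range fun a => mk H c (v a)) = ⊤ := by
  rw [eq_top_iff]
  rintro s -
  obtain ⟨h, rfl⟩ := mk_surjective s
  have hh : h ∈ Submodule.span ℂ[X] (Set.range v) := hv ▸ Submodule.mem_top
  induction hh using Submodule.span_induction with
  | mem h hh =>
    obtain ⟨a, rfl⟩ := hh
    exact Submodule.subset_span ⟨a, rfl⟩
  | zero => rw [map_zero]; exact zero_mem _
  | add x y _ _ hx hy => rw [map_add]; exact add_mem hx hy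
  | smul f x _ hx => rw [mk_smul]; exact Submodule.smul_mem _ _ hx

/-- A constant coefficient divisible by `X - c` is zero, as evaluation at `c` shows. -/
theorem linearIndependent_mk {T : Type*} {v : T → H} (hv : LinearIndependent ℂ[X] v)
    (hs : Submodule.span ℂ[X] (Set.range v) = ⊤) :
    LinearIndependent ℂ fun a => mk H c (v a) := by
  classical
  rw [linearIndependent_iff'']
  intro s α hα hsum a
  have h1 : mk H c (∑ a ∈ s, Polynomial.C (α a) • v a) = 0 := by
    rw [map_sum, ← hsum]
    exact Finset.sum_congr rfl fun a _ => mk_C_smul _ _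
  obtain ⟨k, hk⟩ := mk_eq_zero_iff.1 h1
  obtain ⟨β, rfl⟩ := Finsupp.mem_span_range_iff_exists_finsupp.1
    (hs ▸ Submodule.mem_top : k ∈ Submodule.span ℂ[X] (Set.range v))
  let b := Module.Basis.mk hv hs.ge
  have h2 := congrArg (fun x => b.repr x a) hk
  have hb : ∀ a, v a = b a := fun a => (Module.Basis.mk_apply hv hs.ge a).symm
  simp only [Finsupp.sum, hb, map_sum, map_smul, Module.Basis.repr_self, Finsupp.coe_finsetSum,
    Finset.sum_apply, Finsupp.smul_apply, smul_eq_mul, Finsupp.single_apply, mul_ite, mul_one,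
    mul_zero, Finset.sum_ite_eq'] at h2
  have h3 := congrArg (Polynomial.eval c) h2
  have h4 : ((if a ∈ β.support then (Polynomial.X - Polynomial.C c) * β a else 0 : ℂ[X])).eval c =
      0 := by
    split_ifs <;> simp
  rw [h4] at h3
  by_cases ha : a ∈ s
  · rwa [if_pos ha, Polynomial.eval_C] at h3
  · exact hα a ha

/-- Homomorphisms out of the specialization. -/
def lift {A : Type*} [Ring A] [Algebra ℂ A] (f : H →+* A)
    (hf : ∀ (q : ℂ[X]) (h : H), f (q • h) = q.eval c • f h) : SpecializationAt H c →ₐ[ℂ] A :=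
  { (Ideal.Quotient.lift (specializationIdeal H c) f fun h hh => by
      obtain ⟨k, rfl⟩ := mk_eq_zero_iff.1 (Ideal.Quotient.eq_zero_iff_mem.2 hh)
      simp [hf] : SpecializationAt H c →+* A) with
    commutes' := fun z => by
      change f (algebraMap ℂ[X] H (Polynomial.C z)) = _
      rw [Algebra.algebraMap_eq_smul_one, hf, map_one, Polynomial.eval_C,
        Algebra.algebraMap_eq_smul_one] }

end SpecializationAt

/-- The part of parity `i` with respect to an involution. -/
def involutionPart (σ : H →ₐ[ℂ[X]] H) (i : ZMod 2) : Submodule ℂ[X] H :=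
  Module.End.eigenspace σ.toLinearMap (Polynomial.C (koszulSign i 1))

variable {σ : H →ₐ[ℂ[X]] H}

theorem mem_involutionPart {i : ZMod 2} {h : H} :
    h ∈ involutionPart σ i ↔ σ h = Polynomial.C (koszulSign i 1) • h :=
  Module.End.mem_eigenspace_iff

theorem add_smul_mem_involutionPart (hσ : ∀ h, σ (σ h) = h) (i : ZMod 2) (h : H) :
    Polynomial.C (1 / 2 : ℂ) • (h + Polynomial.C (koszulSign i 1) • σ h) ∈ involutionPart σ i := by
  rw [mem_involutionPart, map_smul, map_add, map_smul, hσ, smul_comm (Polynomial.C (koszulSign i 1))]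
  congr 1
  rw [smul_add, smul_smul, ← Polynomial.C_mul, koszulSign_mul_self, Polynomial.C_1, one_smul,
    add_comm]

theorem half_add_half_smul {R M : Type*} [CommRing R] [Algebra ℂ R] [AddCommGroup M] [Module R M]
    (h : M) : algebraMap ℂ R (1 / 2) • h + algebraMap ℂ R (1 / 2) • h = h := by
  rw [← add_smul, ← map_add, add_halves, map_one, one_smul]

theorem isCompl_involutionPart (hσ : ∀ h, σ (σ h) = h) :
    IsCompl (involutionPart σ 0) (involutionPart σ 1) := by
  constructor
  · rw [Submodule.disjoint_def]
    intro h h0 h1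
    rw [mem_involutionPart, LieSuperalgebra.koszulSign_zero_one, Polynomial.C_1, one_smul] at h0
    rw [mem_involutionPart, LieSuperalgebra.koszulSign_one_one, h0, Polynomial.C_neg,
      Polynomial.C_1, neg_smul, one_smul] at h1
    rw [← half_add_half_smul (R := ℂ[X]) h]
    nth_rw 1 [h1]
    rw [smul_neg, neg_add_cancel]
  · rw [codisjoint_iff, eq_top_iff]
    rintro h -
    refine Submodule.mem_sup.2 ⟨_, add_smul_mem_involutionPart hσ 0 h, _,
      add_smul_mem_involutionPart hσ 1 h, ?_⟩
    rw [LieSuperalgebra.koszulSign_zero_one, LieSuperalgebra.koszulSign_one_one,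
      Polynomial.C_neg, Polynomial.C_1, neg_smul, one_smul, ← smul_add, add_add_add_comm, add_neg_cancel, add_zero, smul_add]
    exact half_add_half_smul (R := ℂ[X]) h

theorem exists_gradedAlgebra (hσ : ∀ h, σ (σ h) = h) :
    Nonempty (GradedAlgebra (involutionPart σ)) := by
  have hint : DirectSum.IsInternal (involutionPart σ) := by
    rw [DirectSum.isInternal_submodule_iff_isCompl _ (i := 0) (j := 1) (by decide)]
    · exact isCompl_involutionPart hσ
    · ext i
      have hi : ∀ i : ZMod 2, i = 0 ∨ i = 1 := by decide
      simpa using hi i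
  exact ⟨{
    one_mem := by
      rw [mem_involutionPart, map_one, LieSuperalgebra.koszulSign_zero_one, Polynomial.C_1, one_smul]
    mul_mem := by
      intro i j x y hx hy
      rw [mem_involutionPart] at hx hy ⊢
      rw [map_mul, hx, hy, smul_mul_smul_comm, LieSuperalgebra.koszulSign_add_one, Polynomial.C_mul]
    toDecomposition := hint.chooseDecomposition }⟩

/-- An isomorphism from a specialization that intertwines involutions is an isomorphism of
superalgebras. -/
theorem superalgebraIso_involutionPart (hσ : ∀ h, σ (σ h) = h) {A : Type*} [Ring A] [Algebra ℂ A]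
    (φ : SpecializationAt H c ≃ₐ[ℂ] A) (P : A →ₐ[ℂ] A)
    (hφ : ∀ h, φ (SpecializationAt.mk H c (σ h)) = P (φ (SpecializationAt.mk H c h))) :
    SuperalgebraIso (specializationPart c (involutionPart σ))
      (fun i => Module.End.eigenspace P.toLinearMap (koszulSign i 1)) := by
  refine ⟨φ, fun i => le_antisymm ?_ ?_⟩
  · rw [Submodule.map_le_iff_le_comap, specializationPart, Submodule.span_le]
    rintro _ ⟨h, hh, rfl⟩
    have hh' := mem_involutionPart.1 hh
    change φ (SpecializationAt.mk H c h) ∈ Module.End.eigenspace P.toLinearMap (koszulSign i 1)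
    rw [Module.End.mem_eigenspace_iff]
    change P _ = _
    rw [← hφ, hh', SpecializationAt.mk_C_smul, map_smul]
  · intro a ha
    rw [Module.End.mem_eigenspace_iff] at ha
    have ha' : P a = koszulSign i 1 • a := ha
    obtain ⟨s, rfl⟩ := φ.surjective a
    obtain ⟨h, rfl⟩ := SpecializationAt.mk_surjective s
    refine ⟨_, Submodule.subset_span ⟨_, add_smul_mem_involutionPart hσ i h, rfl⟩, ?_⟩
    change φ _ = _
    rw [SpecializationAt.mk_C_smul, map_smul, map_add, map_add, SpecializationAt.mk_C_smul, map_smul,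
      hφ, ha', smul_smul, koszulSign_mul_self, one_smul, smul_add]
    exact half_add_half_smul (R := ℂ) _

end Specialization

theorem LinearMap.bijective_of_linearIndependent {T V V' : Type*} [AddCommGroup V] [Module ℂ V]
    [AddCommGroup V'] [Module ℂ V'] (f : V →ₗ[ℂ] V') {v : T → V}
    (hv : Submodule.span ℂ (Set.range v) = ⊤) (hi : LinearIndependent ℂ fun a => f (v a))
    (hs : Submodule.span ℂ (Set.range fun a => f (v a)) = ⊤) : Function.Bijective f := by
  constructor
  · rw [injective_iff_map_eq_zero]
    intro x hx
    obtain ⟨α, rfl⟩ := Finsupp.mem_span_range_iff_exists_finsupp.1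
      (hv ▸ Submodule.mem_top : x ∈ Submodule.span ℂ (Set.range v))
    rw [linearIndependent_iff.1 hi α, Finsupp.sum_zero_index]
    rw [Finsupp.linearCombination_apply, ← hx, Finsupp.sum, Finsupp.sum, map_sum]
    exact Finset.sum_congr rfl fun a _ => (map_smul f _ _).symm
  · rw [← LinearMap.range_eq_top, eq_top_iff, ← hs, Submodule.span_le]
    rintro _ ⟨a, rfl⟩
    exact ⟨v a, rfl⟩

/-! ### The fibres of the Rees algebra. -/

namespace LieSuperalgebra

variable {g : Type w} [AddCommGroup g] [Module ℂ g] {L : LieSuperalgebra g}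

theorem envHom_ext {A : Type*} [Ring A] [Algebra ℂ A] {f f' : L.Env →ₐ[ℂ] A}
    (h : f.toLinearMap ∘ₗ L.ι = f'.toLinearMap ∘ₗ L.ι) : f = f' := by
  have h1 : f.comp L.envMk = f'.comp L.envMk := TensorAlgebra.hom_ext h
  ext u
  obtain ⟨t, rfl⟩ := L.envMk_surjective u
  exact DFunLike.congr_fun h1 t

theorem mem_span_of_mem_part {J : Type*} [Fintype J] {p : J → ZMod 2} (c : Module.Basis J ℂ g)
    (hc : ∀ j, c j ∈ L.part (p j)) {i : ZMod 2} {x : g} (hx : x ∈ L.part i) :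
    x ∈ Submodule.span ℂ (c '' {j | p j = i}) := by
  rw [← c.sum_repr x]
  refine Submodule.sum_mem _ fun j _ => ?_
  by_cases hj : p j = i
  · exact Submodule.smul_mem _ _ (Submodule.subset_span ⟨j, hj, rfl⟩)
  · have h1 : c.coord j ∘ₗ L.parityMap = koszulSign (p j) 1 • c.coord j := by
      refine c.ext fun k => ?_
      rw [LinearMap.comp_apply, L.parityMap_apply_of_mem _ (hc k), map_smul, LinearMap.smul_apply,
        Module.Basis.coord_apply, Module.Basis.repr_self]
      by_cases hk : k = j
      · rw [hk]
      · rw [Finsupp.single_eq_of_ne (Ne.symm hk), smul_zero, smul_zero]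
    have h2 := LinearMap.congr_fun h1 x
    rw [LinearMap.comp_apply, L.parityMap_apply_of_mem _ hx, map_smul, LinearMap.smul_apply,
      smul_eq_mul, smul_eq_mul] at h2
    have h3 : c.repr x j = 0 := by
      by_contra h0
      exact hj (koszulSign_one_eq_of_ne (mul_right_cancel₀ h0 h2)).symm
    rw [h3, zero_smul]
    exact zero_mem _

theorem supercomm_of_basis {A J : Type*} [Ring A] [Algebra ℂ A] [Fintype J] {p : J → ZMod 2}
    (c : Module.Basis J ℂ g) (hc : ∀ j, c j ∈ L.part (p j)) (f : g →ₗ[ℂ] A)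
    (hf : ∀ i j, f (c i) * f (c j) = koszulSign (p i) (p j) • (f (c j) * f (c i)) +
      f (L.bracket (c i) (c j))) (i j : ZMod 2) (x y : g) (hx : x ∈ L.part i) (hy : y ∈ L.part j) :
    f x * f y = koszulSign i j • (f y * f x) + f (L.bracket x y) := by
  have hx' := mem_span_of_mem_part c hc hx
  have hy' := mem_span_of_mem_part c hc hy
  clear hx hy
  induction hx' using Submodule.span_induction with
  | mem x hx =>
    obtain ⟨k, rfl, rfl⟩ := hx
    induction hy' using Submodule.span_induction with
    | mem y hy =>
      obtain ⟨l, rfl, rfl⟩ := hy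
      exact hf k l
    | zero => simp
    | add x y _ _ hx hy =>
      rw [map_add, mul_add, hx, hy, map_add, map_add, add_mul, smul_add]
      abel
    | smul a x _ hx =>
      rw [map_smul, mul_smul_comm, hx, map_smul, map_smul, smul_mul_assoc, smul_add, smul_comm a]
  | zero => simp
  | add x y _ _ hx hy =>
    rw [map_add, add_mul, hx, hy, map_add, LinearMap.add_apply, map_add, mul_add, smul_add]
    abel
  | smul a x _ hx =>
    rw [map_smul, smul_mul_assoc, hx, map_smul, LinearMap.smul_apply, map_smul, mul_smul_comm,
      smul_add, smul_comm a]

end LieSuperalgebra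

section Contraction

variable {W : Type w} [Ring W] [Algebra ℂ W]

attribute [local instance] functionAlgebra

variable {J : Type*} [LinearOrder J] [Fintype J]
  {p : J → ZMod 2} {wt d : J → ℕ} {Θ : J → W} {γ : J → J → J → ℂ} {P : W →ₐ[ℂ] W}

/-- Composition with an algebra endomorphism. -/
def functionMap (P : W →ₐ[ℂ] W) : (ℂ → W) →ₐ[ℂ[X]] (ℂ → W) :=
  { (P : W →+* W).compLeft ℂ with
    commutes' := fun _ => funext fun _ => P.commutes _ }

theorem functionMap_apply (h : ℂ → W) (c : ℂ) : functionMap P h c = P (h c) := rfl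

namespace IsFilteredBasis

variable (hΘ : IsFilteredBasis p wt d Θ γ P)

include hΘ

theorem functionMap_powSmul (j : J) : functionMap P (powSmul (wt j) (Θ j)) =
    Polynomial.C (koszulSign (p j) 1) • powSmul (wt j) (Θ j) := by
  funext c
  rw [functionMap_apply, functionAlgebra_smul_apply, Polynomial.eval_C, powSmul, map_smul,
    hΘ.parity, smul_comm]

theorem functionMap_mem {h : ℂ → W} (hh : h ∈ weightRees wt Θ) :
    functionMap P h ∈ weightRees wt Θ := by
  have h1 : weightRees wt Θ ≤ (weightRees wt Θ).comap (functionMap P) := by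
    refine Algebra.adjoin_le ?_
    rintro _ ⟨j, rfl⟩
    change functionMap P _ ∈ weightRees wt Θ
    rw [hΘ.functionMap_powSmul]
    exact Subalgebra.smul_mem _ (show _ ∈ weightRees wt Θ from Algebra.subset_adjoin ⟨j, rfl⟩) _
  exact h1 hh

/-- The parity automorphism of the Rees algebra. -/
def parityHom : weightRees wt Θ →ₐ[ℂ[X]] weightRees wt Θ :=
  ((functionMap P).comp (weightRees wt Θ).val).codRestrict _ fun h => hΘ.functionMap_mem h.2

theorem parityHom_parityHom (h : weightRees wt Θ) : hΘ.parityHom (hΘ.parityHom h) = h :=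
  Subtype.ext (funext fun _ => hΘ.involutive _)

theorem parityHom_generator (j : J) : hΘ.parityHom (reesGenerator wt Θ j) =
    Polynomial.C (koszulSign (p j) 1) • reesGenerator wt Θ j :=
  Subtype.ext (hΘ.functionMap_powSmul j)

omit hΘ in
/-- The evaluation of elements of the Rees algebra. -/
def evalSpecialization (wt : J → ℕ) (Θ : J → W) (c : ℂ) :
    SpecializationAt (weightRees wt Θ) c →ₐ[ℂ] W :=
  SpecializationAt.lift ((Pi.evalRingHom (fun _ => W) c).comp
    (weightRees wt Θ).val.toRingHom) fun q h => functionAlgebra_smul_apply q h.1 c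

omit [LinearOrder J] [Fintype J] hΘ in
theorem evalSpecialization_mk (c : ℂ) (h : weightRees wt Θ) :
    evalSpecialization wt Θ c (SpecializationAt.mk _ c h) = (h : ℂ → W) c := rfl

/-- The basis of sorted Rees words goes to the basis of sorted words, up to powers of `c`, which are
invertible. -/
theorem evalSpecialization_bijective {c : ℂ} (hc : c ≠ 0) :
    Function.Bijective (evalSpecialization wt Θ c) := by
  have hword : ∀ b : {b : List J // IsSortedWord p b}, evalSpecialization wt Θ c
      (SpecializationAt.mk _ c (reesWord wt Θ b.1)) =
      ((Units.mk0 c hc) ^ (b.1.map wt).sum : ℂˣ) • (b.1.map Θ).prod := by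
    intro b
    rw [evalSpecialization_mk, coe_reesWord, powSmul, Units.smul_def, Units.val_pow_eq_pow_val,
      Units.val_mk0]
  refine LinearMap.bijective_of_linearIndependent (evalSpecialization wt Θ c).toLinearMap
    (SpecializationAt.mk_mem_span (c := c) hΘ.span_reesWord) ?_ ?_
  · have h1 := hΘ.linearIndependent.units_smul fun b => (Units.mk0 c hc) ^ (b.1.map wt).sum
    exact (congrArg (fun v => LinearIndependent ℂ v) (funext hword)).mpr h1
  · rw [eq_top_iff, ← hΘ.span, Submodule.span_le]
    rintro _ ⟨b, rfl⟩
    have h1 : (b.1.map Θ).prod = ((((Units.mk0 c hc) ^ (b.1.map wt).sum)⁻¹ : ℂˣ) : ℂ) •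
        evalSpecialization wt Θ c (SpecializationAt.mk _ c (reesWord wt Θ b.1)) := by
      rw [hword, ← Units.smul_def, inv_smul_smul]
    change (b.1.map Θ).prod ∈ _
    rw [h1]
    exact Submodule.smul_mem _ _ (Submodule.subset_span ⟨b, rfl⟩)

theorem superalgebraIso_of_ne_zero {c : ℂ} (hc : c ≠ 0) :
    SuperalgebraIso (specializationPart c (involutionPart hΘ.parityHom))
      (fun i => Module.End.eigenspace P.toLinearMap (koszulSign i 1)) :=
  superalgebraIso_involutionPart hΘ.parityHom_parityHom
    (AlgEquiv.ofBijective _ (hΘ.evalSpecialization_bijective hc)) P fun _ => rfl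

variable {k : Type w} [AddCommGroup k] [Module ℂ k] {L : LieSuperalgebra k}

/-- At `0` the multiples of `X` drop out and the generators satisfy the defining relations of
`U(k)`. The resulting map from `U(k)` sends the sorted words, which span, to a basis of the fibre.
PBW for `k` is not needed as an input; it comes out. -/
theorem superalgebraIso_zero (b : Module.Basis J ℂ k) (hb : ∀ j, b j ∈ L.part (p j))
    (hγ : ∀ i j, L.bracket (b i) (b j) = ∑ k, γ i j k • b k) :
    SuperalgebraIso (specializationPart 0 (involutionPart hΘ.parityHom)) L.envPart := by
  let S := SpecializationAt (weightRees wt Θ) 0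
  let f : k →ₗ[ℂ] S := b.constr ℂ fun j => SpecializationAt.mk _ 0 (reesGenerator wt Θ j)
  have hfb : ∀ j, f (b j) = SpecializationAt.mk _ 0 (reesGenerator wt Θ j) := fun j =>
    b.constr_basis ℂ _ j
  have hf : ∀ i j, f (b i) * f (b j) = koszulSign (p i) (p j) • (f (b j) * f (b i)) +
      f (L.bracket (b i) (b j)) := by
    intro i j
    obtain ⟨R, -, hR⟩ := hΘ.exists_rees_commutator i j
    have h1 := congrArg (SpecializationAt.mk _ 0) hR
    rw [SpecializationAt.mk_smul, Polynomial.eval_X, zero_smul, map_sub, map_sub,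
      SpecializationAt.mk_C_smul, map_mul, map_mul, map_sum] at h1
    rw [hγ, map_sum]
    simp only [map_smul, hfb]
    simp only [SpecializationAt.mk_C_smul] at h1
    rw [sub_sub, sub_eq_zero] at h1
    exact h1
  let ψ : L.Env →ₐ[ℂ] S := L.envExtend f (L.supercomm_of_basis b hb f hf)
  have hψι : ∀ x, ψ (L.ι x) = f x := L.envExtend_ι f _
  have hψ : ∀ l : List J, ψ (L.word b l) = SpecializationAt.mk _ 0 (reesWord wt Θ l) := by
    intro l
    induction l with
    | nil => rw [L.word_nil, map_one]; exact (map_one _).symm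
    | cons j l ih =>
      rw [L.word_cons, map_mul, ih, hψι, hfb, ← map_mul]
      rfl
  have hbij : Function.Bijective ψ := by
    have h1 := SpecializationAt.linearIndependent_mk (c := 0) hΘ.linearIndependent_reesWord
      hΘ.span_reesWord
    have h2 := SpecializationAt.mk_mem_span (c := 0) hΘ.span_reesWord
    simp only [← hψ] at h1 h2
    refine LinearMap.bijective_of_linearIndependent ψ.toLinearMap ?_ h1 h2
    have h3 := L.span_sorted_word b.span_eq hb
    rwa [Set.image_eq_range] at h3
  refine superalgebraIso_involutionPart hΘ.parityHom_parityHom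
    (AlgEquiv.ofBijective ψ hbij).symm L.envParity ?_
  intro h
  let σ : S →ₐ[ℂ] S := SpecializationAt.lift ((SpecializationAt.mk _ 0).comp
    hΘ.parityHom.toRingHom) fun q h => by
      change SpecializationAt.mk _ 0 (hΘ.parityHom (q • h)) = _
      rw [map_smul, SpecializationAt.mk_smul]
      rfl
  have hσ : σ.comp ψ = ψ.comp L.envParity := by
    refine LieSuperalgebra.envHom_ext (b.ext fun j => ?_)
    change σ (ψ (L.ι (b j))) = ψ (L.envParity (L.ι (b j)))
    rw [L.envParity_ι, L.parityMap_apply_of_mem _ (hb j), map_smul, map_smul, hψι, hfb]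
    change SpecializationAt.mk _ 0 (hΘ.parityHom _) = _
    rw [hΘ.parityHom_generator, SpecializationAt.mk_C_smul]
  rw [AlgEquiv.symm_apply_eq]
  change _ = ψ (L.envParity _)
  have h4 := DFunLike.congr_fun hσ ((AlgEquiv.ofBijective ψ hbij).symm (SpecializationAt.mk _ 0 h))
  refine Eq.trans ?_ h4
  have h5 : ψ ((AlgEquiv.ofBijective ψ hbij).symm (SpecializationAt.mk _ 0 h)) =
      SpecializationAt.mk _ 0 h := (AlgEquiv.ofBijective ψ hbij).apply_symm_apply _
  change _ = σ (ψ _)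
  rw [h5]
  rfl

end IsFilteredBasis

end Contraction

/-- A filtered basis of a quotient algebra, in terms of representatives. -/
theorem IsFilteredBasis.of_surjective {A W J : Type*} [Ring A] [Algebra ℂ A] [Ring W] [Algebra ℂ W]
    [LinearOrder J] [Fintype J] {p : J → ZMod 2} {wt d : J → ℕ} {γ : J → J → J → ℂ}
    (π : A →ₐ[ℂ] W) (hπ : Function.Surjective π) {ν : J → A} {σ : A →ₐ[ℂ] A} {P : W →ₐ[ℂ] W}
    (hP : ∀ u, P (π u) = π (σ u)) (hσ : ∀ u, σ (σ u) = u)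
    (hσν : ∀ j, σ (ν j) = koszulSign (p j) 1 • ν j)
    (hli : ∀ α : {b : List J // True ∧ IsSortedWord p b} →₀ ℂ,
      π (∑ b ∈ α.support, α b • (b.1.map ν).prod) = 0 → α = 0)
    (hsp : ∀ u, ∃ q ∈ Submodule.span ℂ ((fun b : List J => (b.map ν).prod) ''
      {b | IsSortedWord p b}), π (u - q) = 0)
    (hcoeff : ∀ i j k, γ i j k ≠ 0 → wt k = wt i + wt j ∧ d k < d i + d j)
    (hrel : ∀ i j, ∃ q ∈ Submodule.span ℂ ((fun b : List J => (b.map ν).prod) ''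
      {b | (b.map d).sum < d i + d j ∧ (b.map wt).sum < wt i + wt j}),
      π (ν i * ν j - koszulSign (p i) (p j) • (ν j * ν i) - ∑ k, γ i j k • ν k - q) = 0) :
    IsFilteredBasis p wt d (fun j => π (ν j)) γ P := by
  have hprod : ∀ b : List J, (b.map fun j => π (ν j)).prod = π (b.map ν).prod := fun b => by
    rw [map_list_prod, List.map_map]; rfl
  have hmap : ∀ (s : Set (List J)) (q : A),
      q ∈ Submodule.span ℂ ((fun b : List J => (b.map ν).prod) '' s) →
      π q ∈ Submodule.span ℂ ((fun b : List J => (b.map fun j => π (ν j)).prod) '' s) := by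
    intro s q hq
    have h2 := Submodule.mem_map_of_mem (f := π.toLinearMap) hq
    rw [Submodule.map_span, Set.image_image] at h2
    simp only [hprod]
    exact h2
  constructor
  · simp only [hprod]
    have h1 : LinearIndependent ℂ fun b : {b : List J // True ∧ IsSortedWord p b} =>
        π (b.1.map ν).prod := by
      rw [linearIndependent_iff]
      intro α hα
      refine hli α ?_
      rw [← hα, Finsupp.linearCombination_apply, Finsupp.sum, map_sum]
      exact Finset.sum_congr rfl fun b _ => map_smul π _ _
    exact h1.comp (fun b : {b : List J // IsSortedWord p b} => ⟨b.1, trivial, b.2⟩) fun b b' h =>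
      Subtype.ext (congrArg (fun b => b.1) h)
  · rw [eq_top_iff]
    rintro x -
    obtain ⟨u, rfl⟩ := hπ x
    obtain ⟨q, hq, h⟩ := hsp u
    rw [map_sub, sub_eq_zero] at h
    rw [h]
    have h2 := hmap _ q hq
    rwa [Set.image_eq_range] at h2
  · intro j
    rw [hP, hσν, map_smul]
  · intro x
    obtain ⟨u, rfl⟩ := hπ x
    rw [hP, hP, hσ]
  · exact hcoeff
  · intro i j
    obtain ⟨q, hq, h⟩ := hrel i j
    rw [map_sub, sub_eq_zero] at h
    simp only [map_sub, map_smul, map_mul, map_sum] at h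
    rw [h]
    exact hmap _ q hq

/-! ### Application to the W-superalgebra. -/

namespace LieSuperalgebra

variable {g : Type w} [AddCommGroup g] [Module ℂ g] {L : LieSuperalgebra g}

namespace WDatum

variable {B : LinearMap.BilinForm ℂ g} {e : g} (D : L.WDatum B e)
  (hB : L.IsBasicForm B) (he : e ∈ L.part 0)

/-- The parity automorphism on representatives of elements of the W-superalgebra. -/
def invariantsParity : D.invariants hB he →ₐ[ℂ] D.invariants hB he :=
  (L.envParity.comp (D.invariants hB he).val).codRestrict _ fun u =>
    envParity_mem_invariants he hB u.2

/-- The quotient map onto the W-superalgebra. -/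
def refinedWMk : D.invariants hB he →ₐ[ℂ] D.RefinedW hB he :=
  Ideal.Quotient.mkₐ ℂ (D.invariantsIdeal hB he)

theorem refinedWMk_surjective : Function.Surjective (D.refinedWMk hB he) :=
  Ideal.Quotient.mkₐ_surjective ℂ (D.invariantsIdeal hB he)

theorem refinedWMk_eq_zero_iff {u : D.invariants hB he} :
    D.refinedWMk hB he u = 0 ↔ (u : L.Env) ∈ D.leftIdeal :=
  Ideal.Quotient.eq_zero_iff_mem

/-- The parity automorphism of the W-superalgebra. -/
def refinedWParity : D.RefinedW hB he →ₐ[ℂ] D.RefinedW hB he :=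
  Ideal.Quotient.liftₐ _ ((D.refinedWMk hB he).comp
    (D.invariantsParity hB he)) fun u hu => by
      refine Ideal.Quotient.eq_zero_iff_mem.2 ?_
      exact envParity_mem_leftIdeal he hB hu

theorem refinedWParity_mk (u : D.invariants hB he) :
    D.refinedWParity hB he (D.refinedWMk hB he u) =
      D.refinedWMk hB he (D.invariantsParity hB he u) := rfl

/-- Averaging a representative with its image under parity turns a homogeneous class into one with a
homogeneous representative. -/
theorem refinedWPart_eq (i : ZMod 2) : D.refinedWPart hB he i =
    Module.End.eigenspace (D.refinedWParity hB he).toLinearMap (koszulSign i 1) := by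
  refine le_antisymm ?_ ?_
  · rintro _ ⟨u, hu, rfl⟩
    have hu' : L.envParity u = koszulSign i 1 • (u : L.Env) := Module.End.mem_eigenspace_iff.1 hu
    have hu'' : D.invariantsParity hB he u = koszulSign i 1 • u := Subtype.ext hu'
    rw [Module.End.mem_eigenspace_iff]
    change D.refinedWParity hB he (D.refinedWMk hB he u) =
      koszulSign i 1 • D.refinedWMk hB he u
    rw [refinedWParity_mk, hu'', map_smul]
  · intro a ha
    obtain ⟨u, rfl⟩ := D.refinedWMk_surjective hB he a
    rw [Module.End.mem_eigenspace_iff] at ha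
    change D.refinedWParity hB he (D.refinedWMk hB he u) =
      koszulSign i 1 • D.refinedWMk hB he u at ha
    rw [refinedWParity_mk] at ha
    refine ⟨(1 / 2 : ℂ) • (u + koszulSign i 1 • D.invariantsParity hB he u), ?_, ?_⟩
    · refine Module.End.mem_eigenspace_iff.2 ?_
      change L.envParity ((1 / 2 : ℂ) • ((u : L.Env) + koszulSign i 1 • L.envParity u)) =
        koszulSign i 1 • ((1 / 2 : ℂ) • ((u : L.Env) + koszulSign i 1 • L.envParity u))
      rw [map_smul, map_add, map_smul, envParity_envParity, smul_comm (koszulSign i 1)]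
      congr 1
      rw [smul_add, smul_smul, koszulSign_mul_self, one_smul, add_comm]
    · change D.refinedWMk hB he _ = _
      rw [map_smul, map_add, map_smul, ha, smul_smul, koszulSign_mul_self, one_smul, smul_add]
      exact half_add_half_smul (R := ℂ) _

namespace Frame

variable {D hB he} (F : D.Frame)

/-- The basis of the centralizer given by a frame. -/
theorem exists_basis_centralizer : ∃ b : Module.Basis F.Idx ℂ (LinearMap.ker (L.bracket e)),
    ∀ j : F.Idx, (b j : g) = F.c j := by
  let v : F.Idx → LinearMap.ker (L.bracket e) := fun j => ⟨F.c j, F.bracket_c j j.2⟩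
  have hli : LinearIndependent ℂ v := by
    refine LinearIndependent.of_comp (LinearMap.ker (L.bracket e)).subtype ?_
    have hc : LinearIndependent ℂ F.c := by
      rw [Fintype.linearIndependent_iff]
      intro α hα j
      rw [F.eq_zero_of_sum_mem α (hα ▸ zero_mem _)]
      rfl
    exact hc.comp (fun j : F.Idx => j.1) Subtype.val_injective
  have hsp : ⊤ ≤ Submodule.span ℂ (Set.range v) := by
    rintro ⟨x, hx⟩ -
    have h1 := F.ker_le hx
    have h2 : Submodule.span ℂ {y | ∃ j : Fin F.n, ¬ j.1 < F.a ∧ y = F.c j} ≤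
        (Submodule.span ℂ (Set.range v)).map (LinearMap.ker (L.bracket e)).subtype := by
      rw [Submodule.span_le]
      rintro _ ⟨j, hj, rfl⟩
      exact ⟨v ⟨j, hj⟩, Submodule.subset_span ⟨_, rfl⟩, rfl⟩
    obtain ⟨y, hy, hyx⟩ := h2 h1
    have h3 : y = ⟨x, hx⟩ := Subtype.ext hyx
    rwa [← h3]
  exact ⟨Module.Basis.mk hli hsp, fun j => by rw [Module.Basis.mk_apply]⟩

variable {F} {Z : D.DualBases} (N : F.Generators he hB Z)

/-- Two gradings play different roles: the `ad h`-weight `d - 2` governs the contraction, and the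
Kazhdan degree `d`, which is at least two on `g_e`, makes straightening terminate. -/
theorem Generators.isFilteredBasis (hL : L.IsBasicClassical)
    (hnil : IsNilpotent (L.bracket e : Module.End ℂ g)) {γ : F.Idx → F.Idx → F.Idx → ℂ}
    (hγ : ∀ i j : F.Idx, L.bracket (F.c i) (F.c j) = ∑ k, γ i j k • F.c k)
    (hd : ∀ i j k, γ i j k ≠ 0 → F.d k + 2 = F.d i + F.d j) :
    IsFilteredBasis (fun j : F.Idx => F.p j) (fun j => F.d j - 2) (fun j => F.d j)
      (fun j => D.refinedWMk hB he (N.ν j)) γ (D.refinedWParity hB he) := by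
  obtain ⟨ψ, hψ⟩ := F.exists_isDualFamily he hB hL hnil
  have := hL.finiteDimensional
  refine IsFilteredBasis.of_surjective (D.refinedWMk hB he) (D.refinedWMk_surjective hB he)
    (D.refinedWParity_mk hB he) (fun u => Subtype.ext (envParity_envParity _))
    (fun j => Subtype.ext (N.parity j)) (fun α hα => ?_) (fun u => ?_) (fun i j k h => ?_)
    fun i j => ?_
  · have h1 := (D.refinedWMk_eq_zero_iff hB he).1 hα
    rw [AddSubmonoidClass.coe_finsetSum] at h1
    exact (N.isTriangular hψ fun _ => True).eq_zero α fun a _ => hψ.zero _ _ h1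
  · obtain ⟨n, hn⟩ := F.exists_mem_filt he hB hnil u
    obtain ⟨q, hq, h⟩ := N.exists_sub_mem_leftIdeal hψ le_rfl u hn
    exact ⟨q, Submodule.span_mono (Set.image_mono fun b hb => hb.2) hq,
      (D.refinedWMk_eq_zero_iff hB he).2 h⟩
  · have h1 := hd i j k h
    have h2 := F.two_le i i.2
    have h3 := F.two_le j j.2
    have h4 := F.two_le k k.2
    exact ⟨by omega, by omega⟩
  · obtain ⟨q, hq, h⟩ := N.exists_commutator hψ (hγ i j) (hd i j)
    exact ⟨q, hq, (D.refinedWMk_eq_zero_iff hB he).2 h⟩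

end Frame

end WDatum

end LieSuperalgebra

attribute [local instance] functionAlgebra in
theorem theorem4p4 {g : Type w} [AddCommGroup g] [Module ℂ g] (L : LieSuperalgebra g)
    (hL : L.IsBasicClassical)
    (B : LinearMap.BilinForm ℂ g) (hB : L.IsBasicForm B)
    (e : g) (he : e ∈ L.part 0) (hnil : IsNilpotent (L.bracket e : Module.End ℂ g))
    (D : L.WDatum B e) :
    ∃ (H : Type w) (_ : Ring H) (_ : Algebra ℂ[X] H)
      (𝒜 : ZMod 2 → Submodule ℂ[X] H) (_ : GradedAlgebra 𝒜),
      Module.Free ℂ[X] H ∧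
      (∀ c : ℂ, c ≠ 0 →
        SuperalgebraIso (specializationPart c 𝒜) (D.refinedWPart hB he)) ∧
      SuperalgebraIso (specializationPart 0 𝒜) (L.centralizer e he).envPart := by
  have := hL.finiteDimensional
  obtain ⟨F⟩ := D.exists_frame he hB hnil
  obtain ⟨Z⟩ := D.exists_dualBases he hB hnil
  obtain ⟨N⟩ := F.exists_generators he hB Z hL hnil
  choose γ hγ hd using F.exists_bracket_coeff he
  have hΘ := N.isFilteredBasis hL hnil hγ hd
  obtain ⟨b, hb⟩ := F.exists_basis_centralizer
  obtain ⟨hgr⟩ := exists_gradedAlgebra hΘ.parityHom_parityHom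
  refine ⟨_, inferInstance, inferInstance, involutionPart hΘ.parityHom, hgr, hΘ.weightRees_free,
    fun c hc => ?_, hΘ.superalgebraIso_zero b (fun j => ?_) fun i j => ?_⟩
  · rw [show D.refinedWPart hB he = _ from funext (D.refinedWPart_eq hB he)]
    exact hΘ.superalgebraIso_of_ne_zero hc
  · change (b j : g) ∈ L.part (F.p j)
    rw [hb]
    exact (F.c_mem j).2
  · refine Subtype.ext ?_
    change L.bracket (b i) (b j) = ((∑ k, γ i j k • b k : LinearMap.ker (L.bracket e)) : g)
    rw [hb, hb, hγ, AddSubmonoidClass.coe_finsetSum]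
    exact Finset.sum_congr rfl fun k _ => by rw [← hb]; rfl

end
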